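/- Let $n\ge 2$ and $1\le k\le n$ be integers and let $B_1$ be the open unit ball of $\mathbb R^n$. For an $n\times n$ matrix $A$ let $S_k(A)$ be the sum of its principal $k\times k$ minors (the $k$-th elementary symmetric function of its eigenvalues) and $S_k^{ij}(A)=\partial S_k/\partial a_{ij}(A)$. Write $u\in W^{1,k+1}(B_1,|x|^{1-k})$ if $u\in L^{k+1}(B_1)$ has a weak gradient in $B_1$ with $\int_{B_1}|x|^{1-k}|\nabla u|^{k+1}\,dx<\infty$. A solution of $$S_k(D^2u)=g(u)\quad\text{in }B_1 \tag{1}$$ is either a classical solution, i.e. $u\in C^2(B_1)\cap C(\overline{B_1})$ with $u=0$ on $\partial B_1$, $S_l(D^2u)>0$ in $B_1$ for $l=1,\dots,k$, and (1) holding pointwise; or a weak solution, i.e. $u\in L^{k+1}(B_1)$, $g(u)\in L^1(B_1)$, $\sum_{i,j}u_iu_jS_k^{ij}(D^2u)\in L^1(B_1)$ and $$\int_{B_1}\Big\{\frac1k\sum_{i,j}u_i\eta_jS_k^{ij}(D^2u)+g(u)\eta\Big\}\,dx=0\qquad\text{for all }\eta\in C_c^1(B_1),$$ where $\nabla u$ is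 the weak gradient in $B_1$ and $D^2u$ the weak Hessian in $B_1\setminus\{0\}$. A solution $u$ is semistable if $$\int_{B_1}\Big\{\sum_{i,j}\varphi_i\varphi_jS_k^{ij}(D^2u)+g'(u)\varphi^2\Big\}\,dx\ge 0\qquad\text{for all }\varphi\in C_c^1(B_1\setminus\{0\}).$$ (It is understood that these integrals exist; the value given to $g'$ at points where $g$ is not differentiable is $0$.) Put $$\delta_{n,k}=\frac{-(k+1)n+2\sqrt{2(k+1)n-4k}+2k^2+6k}{(k+1)^2}.$$ **Theorem.** There is a constant $D_{n,k}>0$ depending only on $n$ and $k$ such that the following holds. Let $g:\mathbb R\to\mathbb R$ be nonnegative, nonincreasing and locally Lipschitz, and let $u\in W^{1,k+1}(B_1,|x|^{1-k})$ be a semistable radial solution of (1). Then, after modification on a null set, $u(x)=u(r)$, $r=|x|$, with $u(r)$ of class $C^1$ on $(0,1]$ (so that $u(1)$ and the one-sided derivative $u'(1)$ are defined), and with $C=D_{n,k}\min_{t\in[1/2,1]}u'(t)$: 1. if $n<2k+8$, then $|u(r)-u(1)|\le C(1-r)$ for all $r\in(0,1]$; 2. if $n=2k+8$, then $|u(r)-u(1)|\le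 C|\log r|$ for all $r\in(0,1]$; 3. if $n>2k+8$, then $|u(r)-u(1)|\le C\,(r^{\delta_{n,k}}-1)$ for all $r\in(0,1]$. -/

import Mathlib

open Set MeasureTheory
open scoped ContDiff

noncomputable section

namespace KHessian

/-- The open unit ball of `ℝⁿ`. -/
def unitBall (n : ℕ) : Set (EuclideanSpace ℝ (Fin n)) := Metric.ball 0 1

/-- The unit ball without its centre. -/
def puncturedBall (n : ℕ) : Set (EuclideanSpace ℝ (Fin n)) := Metric.ball 0 1 \ {0}

/-- The classical partial derivative in the `i`-th coordinate direction. -/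
def partialDeriv {n : ℕ} (i : Fin n) (f : EuclideanSpace ℝ (Fin n) → ℝ)
    (x : EuclideanSpace ℝ (Fin n)) : ℝ :=
  fderiv ℝ f x (EuclideanSpace.single i 1)

/-- `φ` belongs to `C_c^m(Ω)`. -/
def IsTestFunction {n : ℕ} (m : WithTop ℕ∞) (Ω : Set (EuclideanSpace ℝ (Fin n)))
    (φ : EuclideanSpace ℝ (Fin n) → ℝ) : Prop :=
  ContDiff ℝ m φ ∧ HasCompactSupport φ ∧ tsupport φ ⊆ Ω

/-- `h` is the weak `i`-th partial derivative of `f` in the open set `Ω`. -/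
def HasWeakPartial {n : ℕ} (Ω : Set (EuclideanSpace ℝ (Fin n))) (i : Fin n)
    (f h : EuclideanSpace ℝ (Fin n) → ℝ) : Prop :=
  LocallyIntegrableOn f Ω ∧ LocallyIntegrableOn h Ω ∧
    ∀ φ : EuclideanSpace ℝ (Fin n) → ℝ, IsTestFunction ∞ Ω φ →
      ∫ x in Ω, f x * partialDeriv i φ x = -∫ x in Ω, h x * φ x

/-- `G` is the weak gradient of `u` in `Ω`. -/
def HasWeakGradient {n : ℕ} (Ω : Set (EuclideanSpace ℝ (Fin n)))
    (u : EuclideanSpace ℝ (Fin n) → ℝ)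
    (G : EuclideanSpace ℝ (Fin n) → EuclideanSpace ℝ (Fin n)) : Prop :=
  ∀ i, HasWeakPartial Ω i u (fun x => G x i)

/-- `H` is the weak Hessian of `u` in `Ω`. -/
def HasWeakHessian {n : ℕ} (Ω : Set (EuclideanSpace ℝ (Fin n)))
    (u : EuclideanSpace ℝ (Fin n) → ℝ)
    (H : EuclideanSpace ℝ (Fin n) → Matrix (Fin n) (Fin n) ℝ) : Prop :=
  ∃ G : EuclideanSpace ℝ (Fin n) → EuclideanSpace ℝ (Fin n),
    HasWeakGradient Ω u G ∧ ∀ i j, HasWeakPartial Ω j (fun x => G x i) (fun x => H x i j)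

/-- The classical Hessian matrix. -/
def classicalHessian {n : ℕ} (u : EuclideanSpace ℝ (Fin n) → ℝ)
    (x : EuclideanSpace ℝ (Fin n)) : Matrix (Fin n) (Fin n) ℝ :=
  Matrix.of fun i j => partialDeriv j (partialDeriv i u) x

/-- `S_k(A)`: the sum of the principal `k × k` minors of `A`, that is, the `k`-th elementary
symmetric function of the eigenvalues of `A`. -/
def kHessian {n : ℕ} (k : ℕ) (A : Matrix (Fin n) (Fin n) ℝ) : ℝ :=
  ∑ s ∈ (Finset.univ : Finset (Fin n)).powersetCard k,
    (A.submatrix (fun i : s => (i : Fin n)) (fun i : s => (i : Fin n))).det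

/-- `S_k^{ij}(A)`: the partial derivative of `S_k` with respect to the entry `(i, j)`, at `A`. -/
def kHessianDeriv {n : ℕ} (k : ℕ) (A : Matrix (Fin n) (Fin n) ℝ) (i j : Fin n) : ℝ :=
  deriv (fun t : ℝ => kHessian k (A + t • Matrix.single i j (1 : ℝ))) 0

/-- The bilinear expression `∑ a_i b_j S_k^{ij}(A)`. -/
def kHessianForm {n : ℕ} (k : ℕ) (A : Matrix (Fin n) (Fin n) ℝ) (a b : Fin n → ℝ) : ℝ :=
  ∑ i, ∑ j, a i * b j * kHessianDeriv k A i j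

/-- The weighted space `W^{1,k+1}(B₁, |x|^{1-k})`: `u ∈ L^{k+1}(B₁)` is weakly differentiable in
`B₁` and `|x|^{1-k} |∇u|^{k+1}` is integrable over `B₁`. -/
def MemWeightedSobolev {n : ℕ} (k : ℕ) (u : EuclideanSpace ℝ (Fin n) → ℝ) : Prop :=
  MemLp u ((k : ENNReal) + 1) (volume.restrict (unitBall n)) ∧
    ∃ G : EuclideanSpace ℝ (Fin n) → EuclideanSpace ℝ (Fin n),
      HasWeakGradient (unitBall n) u G ∧
        IntegrableOn (fun x => ‖x‖ ^ (1 - (k : ℤ)) * ‖G x‖ ^ (k + 1)) (unitBall n)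

/-- `u` is (a.e. equal to) a radial function in the unit ball. -/
def IsRadial {n : ℕ} (u : EuclideanSpace ℝ (Fin n) → ℝ) : Prop :=
  ∃ f : ℝ → ℝ, ∀ᵐ x ∂(volume.restrict (unitBall n)), u x = f ‖x‖

/-- Classical solutions of `S_k(D²u) = g(u)` in `B₁`: `u ∈ C²(B₁) ∩ C(closure B₁)` is `k`-convex,
vanishes on the boundary, and satisfies the equation pointwise. -/
def IsClassicalSolution {n : ℕ} (k : ℕ) (g : ℝ → ℝ) (u : EuclideanSpace ℝ (Fin n) → ℝ) : Prop :=
  ContDiffOn ℝ 2 u (unitBall n) ∧ ContinuousOn u (Metric.closedBall 0 1) ∧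
    (∀ x ∈ unitBall n, ∀ l ∈ Finset.Icc 1 k, 0 < kHessian l (classicalHessian u x)) ∧
    (∀ x ∈ Metric.sphere (0 : EuclideanSpace ℝ (Fin n)) 1, u x = 0) ∧
    ∀ x ∈ unitBall n, kHessian k (classicalHessian u x) = g (u x)

/-- Weak solutions of `S_k(D²u) = g(u)` in `B₁`. The second derivatives are weak derivatives away
from the origin. -/
def IsWeakSolution {n : ℕ} (k : ℕ) (g : ℝ → ℝ) (u : EuclideanSpace ℝ (Fin n) → ℝ) : Prop :=
  MemLp u ((k : ENNReal) + 1) (volume.restrict (unitBall n)) ∧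
    IntegrableOn (fun x => g (u x)) (unitBall n) ∧
    ∃ (G : EuclideanSpace ℝ (Fin n) → EuclideanSpace ℝ (Fin n))
      (H : EuclideanSpace ℝ (Fin n) → Matrix (Fin n) (Fin n) ℝ),
      HasWeakGradient (unitBall n) u G ∧ HasWeakHessian (puncturedBall n) u H ∧
        IntegrableOn (fun x => kHessianForm k (H x) (fun i => G x i) (fun i => G x i))
          (unitBall n) ∧
        ∀ η : EuclideanSpace ℝ (Fin n) → ℝ, IsTestFunction 1 (unitBall n) η →
          IntegrableOn (fun x => (1 / (k : ℝ)) *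
              kHessianForm k (H x) (fun i => G x i) (fun j => partialDeriv j η x)
              + g (u x) * η x) (unitBall n) ∧
          ∫ x in unitBall n, ((1 / (k : ℝ)) *
              kHessianForm k (H x) (fun i => G x i) (fun j => partialDeriv j η x)
              + g (u x) * η x) = 0

/-- Solutions of `S_k(D²u) = g(u)` in `B₁`, classical or weak. -/
def IsSolution {n : ℕ} (k : ℕ) (g : ℝ → ℝ) (u : EuclideanSpace ℝ (Fin n) → ℝ) : Prop :=
  IsClassicalSolution k g u ∨ IsWeakSolution k g u

/-- The semistability inequality: `∫_{B₁} (∑ φ_i φ_j S_k^{ij}(D²u) + g'(u) φ²) ≥ 0` for every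
`φ ∈ C_c^1(B₁ \ {0})`. -/
def IsSemistable {n : ℕ} (k : ℕ) (g : ℝ → ℝ) (u : EuclideanSpace ℝ (Fin n) → ℝ) : Prop :=
  ∃ H : EuclideanSpace ℝ (Fin n) → Matrix (Fin n) (Fin n) ℝ,
    HasWeakHessian (puncturedBall n) u H ∧
      ∀ φ : EuclideanSpace ℝ (Fin n) → ℝ, IsTestFunction 1 (puncturedBall n) φ →
        IntegrableOn (fun x =>
            kHessianForm k (H x) (fun i => partialDeriv i φ x) (fun j => partialDeriv j φ x)
            + deriv g (u x) * φ x ^ 2) (unitBall n) ∧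
        0 ≤ ∫ x in unitBall n, (
            kHessianForm k (H x) (fun i => partialDeriv i φ x) (fun j => partialDeriv j φ x)
            + deriv g (u x) * φ x ^ 2)

/-- The exponent `δ_{n,k}`. -/
def delta (n k : ℕ) : ℝ :=
  (-((k : ℝ) + 1) * n + 2 * Real.sqrt (2 * ((k : ℝ) + 1) * n - 4 * k) + 2 * (k : ℝ) ^ 2 + 6 * k)
    / ((k : ℝ) + 1) ^ 2

end KHessian

end

/-! For u(x) = v(|x|) with p = v', the Hessian has the eigenvalue p/r on directions tangent to the
sphere and v'' in the radial direction, so S_k(D²u) = r^{1-n} (c r^{n-k} p^k)' with c =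
C(n-1,k-1)/k. The equation integrates to the flux identity c r^{n-k} p^k = ∫_0^r s^{n-1} g(v) ds,
and semistability against radial test functions becomes ∫ r^{n-1} (k c (p/r)^{k-1} ψ'² + g'(v) ψ²) ≥
0. `SemistableProfile` collects these facts together with the finite weighted energy; from there the
argument is one-dimensional.

Once p ≥ 0 is known, the flux identity yields two monotone quantities: r^{n-k} p^k is nondecreasing
because g ≥ 0, and p/r is nonincreasing because g(v) is. They compare p with q = u'(1) near the
boundary, and q with the minimum of u' on [1/2, 1].

Near the origin the estimate comes from testing stability with ψ = p ζ. Since g'(v) p = (g ∘ v)', an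
integration by parts and the equation remove both g and p', leaving (`hardy`) ∫ r^{n-k} p^{k+1} (ζ'²
+ 2b ζζ'/r - d ζ²/r²) ≥ 0 with b = (k-1)/(k+1) and d = (2n-k-1)/(k+1). The form vanishes on r^{-β},
β = `hardyExponent n k`. For n ≥ 2k and ζ = r (r + r₀)^{-1-β}, cut off between 1/2 and 3/4, the form
is nonpositive on (0, 1/2) and of order -r₀^{-2-2β} for r comparable to r₀, while the part on [1/2,
1) is controlled by q. Hence p(r₀)^{k+1} r₀^{n-k-1-2β} ≤ C q^{k+1}, that is, p ≤ C q r^{δ-1}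
(`exists_deriv_le_rpow_delta`). The finite energy is what admits test functions that are merely O(r)
at the origin (`hardy_of_le`). For n < 2k the monotone flux alone gives p ≤ q r^{-(n-k)/k}.
Integrating these powers from r to 1 produces the three cases, as δ changes sign at n = 2k + 8.

The reduction to one variable (`exists_semistableProfile`) averages weak derivatives over spheres: a
radial function with a weak Hessian off the origin has a C¹ profile on (0, 1), and uniqueness of
weak derivatives makes the Hessian the expected radial matrix. The flux identity carries no constant
of integration, because the weak equation may be tested with functions that are constant near the
origin, and because the gradient of a classical solution vanishes there. -/

noncomputable section

namespace KHessian

/-! ### Semistable profiles in one variable, and the sign of the derivative. -/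

open Filter Topology

/-- The data that a semistable radial solution `u(x) = v(|x|)` provides in one variable; `p` is the
derivative of the profile `v`. -/
structure SemistableProfile (n k : ℕ) (c : ℝ) (g v p : ℝ → ℝ) : Prop where
  nonneg : ∀ t, 0 ≤ g t
  antitone : Antitone g
  lipschitz : LocallyLipschitz g
  hasDerivAt : ∀ r ∈ Ioo (0 : ℝ) 1, HasDerivAt v (p r) r
  continuousOn : ContinuousOn p (Ioo 0 1)
  integrableOn : IntegrableOn (fun s => s ^ (n - 1) * g (v s)) (Ioo 0 1)
  flux : ∀ r ∈ Ioo (0 : ℝ) 1, c * (r ^ (n - k) * p r ^ k) = ∫ s in (0 : ℝ)..r, s ^ (n - 1) * g (v s)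
  stable : ∀ ψ : ℝ → ℝ, ContDiff ℝ 1 ψ → HasCompactSupport ψ → tsupport ψ ⊆ Ioo 0 1 →
    IntegrableOn (fun r => r ^ (n - 1) *
      (k * c * (p r / r) ^ (k - 1) * deriv ψ r ^ 2 + deriv g (v r) * ψ r ^ 2)) (Ioo 0 1) ∧
    0 ≤ ∫ r in Ioo (0 : ℝ) 1, r ^ (n - 1) *
      (k * c * (p r / r) ^ (k - 1) * deriv ψ r ^ 2 + deriv g (v r) * ψ r ^ 2)
  energy : IntegrableOn (fun r => r ^ (n - k) * |p r| ^ (k + 1)) (Ioo 0 1)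

/-- Off the support of ζ the product vanishes locally, so f may be arbitrary outside U. -/
theorem contDiff_mul_of_tsupport_subset {E : Type*} [NormedAddCommGroup E] [NormedSpace ℝ E]
    {m : WithTop ℕ∞} {U : Set E} (hU : IsOpen U) {f ζ : E → ℝ} (hf : ContDiffOn ℝ m f U)
    (hζ : ContDiff ℝ m ζ) (hs : tsupport ζ ⊆ U) : ContDiff ℝ m (fun x => f x * ζ x) := by
  rw [contDiff_iff_contDiffAt]
  intro x
  by_cases hx : x ∈ tsupport ζ
  · exact (hf.contDiffAt (hU.mem_nhds (hs hx))).mul hζ.contDiffAt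
  · have : (fun x => f x * ζ x) =ᶠ[𝓝 x] fun _ => 0 := by
      filter_upwards [notMem_tsupport_iff_eventuallyEq.1 hx] with y hy
      simp [hy]
    exact contDiffAt_const.congr_of_eventuallyEq this

/-- Writing the derivative with `r ^ m / r` avoids the truncated exponent m - 1 at m = 0. -/
theorem hasDerivAt_pow_div {r : ℝ} (hr : r ≠ 0) (m : ℕ) :
    HasDerivAt (fun x : ℝ => x ^ m) (m * r ^ m / r) r := by
  refine (hasDerivAt_pow m r).congr_deriv ?_
  rcases m with _ | m
  · simp
  · rw [pow_succ, Nat.add_sub_cancel]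
    field_simp

theorem antitone_deriv_nonpos {g : ℝ → ℝ} (hg : Antitone g) (t : ℝ) : deriv g t ≤ 0 :=
  hg.deriv_nonpos

namespace SemistableProfile

variable {n k : ℕ} {c : ℝ} {g v p : ℝ → ℝ}

theorem flux_nonneg (h : SemistableProfile n k c g v p) {r : ℝ} (hr : r ∈ Ioo (0 : ℝ) 1) :
    0 ≤ ∫ s in (0 : ℝ)..r, s ^ (n - 1) * g (v s) :=
  intervalIntegral.integral_nonneg hr.1.le fun _ hs => mul_nonneg (pow_nonneg hs.1 _) (h.nonneg _)

/-- For odd k the sign of p is read off p^k in the flux identity. For even k the flux says nothing.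
But p < 0 near r makes (p/r)^{k-1} negative there, and with g' ≤ 0 the stability integrand of a bump
supported there is nonpositive. Stability then forces the bump to have zero derivative almost
everywhere, although it equals 1 at r and 0 at r - ε/2. -/
theorem deriv_nonneg (h : SemistableProfile n k c g v p) (hk : 1 ≤ k) (hc : 0 < c) {r : ℝ}
    (hr : r ∈ Ioo (0 : ℝ) 1) : 0 ≤ p r := by
  by_contra! hneg
  rcases Nat.even_or_odd k with he | ho
  · have hodd : Odd (k - 1) := Nat.Even.sub_odd hk he odd_one
    have hev : ∀ᶠ s in 𝓝 r, s ∈ Ioo (0 : ℝ) 1 ∧ p s < 0 := by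
      refine Filter.Eventually.and (isOpen_Ioo.mem_nhds hr) ?_
      exact (h.continuousOn.continuousAt (isOpen_Ioo.mem_nhds hr)).eventually_lt_const hneg
    obtain ⟨ε, hε, hball⟩ := Metric.eventually_nhds_iff_ball.1 hev
    let f : ContDiffBump r := ⟨ε / 4, ε / 2, by linarith, by linarith⟩
    have hsupp : tsupport f ⊆ Metric.ball r ε := by
      rw [f.tsupport_eq]
      exact Metric.closedBall_subset_ball (by change ε / 2 < ε; linarith)
    obtain ⟨hint, hpos⟩ := h.stable f f.contDiff f.hasCompactSupport
      fun s hs => (hball s (hsupp hs)).1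
    have hle : ∀ s ∈ Ioo (0 : ℝ) 1, s ^ (n - 1) *
        (k * c * (p s / s) ^ (k - 1) * deriv f s ^ 2 + deriv g (v s) * f s ^ 2) ≤
        s ^ (n - 1) * (k * c * (p s / s) ^ (k - 1) * deriv f s ^ 2) := by
      intro s hs
      have h1 := antitone_deriv_nonpos h.antitone (v s)
      have h2 : deriv g (v s) * f s ^ 2 ≤ 0 := mul_nonpos_of_nonpos_of_nonneg h1 (sq_nonneg _)
      exact mul_le_mul_of_nonneg_left (by linarith) (pow_nonneg hs.1.le _)
    have hle' : ∀ s ∈ Ioo (0 : ℝ) 1,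
        s ^ (n - 1) * (k * c * (p s / s) ^ (k - 1) * deriv f s ^ 2) ≤ 0 := by
      intro s hs
      by_cases hs' : s ∈ tsupport f
      · have h1 : p s / s < 0 := div_neg_of_neg_of_pos (hball s (hsupp hs')).2 hs.1
        have h2 : (p s / s) ^ (k - 1) < 0 := hodd.pow_neg h1
        have h3 : (k : ℝ) * c * (p s / s) ^ (k - 1) * deriv f s ^ 2 ≤ 0 := by
          apply mul_nonpos_of_nonpos_of_nonneg _ (sq_nonneg _)
          exact mul_nonpos_of_nonneg_of_nonpos (by positivity) h2.le
        exact mul_nonpos_of_nonneg_of_nonpos (pow_nonneg hs.1.le _) h3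
      · have : deriv f s = 0 := by
          have := support_deriv_subset (f := (f : ℝ → ℝ))
          by_contra h0
          exact hs' (this h0)
        simp [this]
    have hzero := (setIntegral_eq_zero_iff_of_nonneg_ae
      (f := fun s => - (s ^ (n - 1) *
        (k * c * (p s / s) ^ (k - 1) * deriv f s ^ 2 + deriv g (v s) * f s ^ 2)))
      (s := Ioo (0 : ℝ) 1) (μ := volume)
      ((ae_restrict_mem measurableSet_Ioo).mono fun s hs => by
        have := (hle s hs).trans (hle' s hs)
        simp only [Pi.zero_apply]; linarith) hint.neg).1 (by
          refine le_antisymm ?_ ?_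
          · rw [integral_neg]; linarith
          · refine setIntegral_nonneg measurableSet_Ioo fun s hs => ?_
            have := (hle s hs).trans (hle' s hs)
            linarith)
    have hderiv : ∀ᵐ s ∂(volume.restrict (Ioo (0 : ℝ) 1)), deriv f s = 0 := by
      filter_upwards [hzero, ae_restrict_mem measurableSet_Ioo] with s hs0 hs
      by_cases hs' : s ∈ tsupport f
      · have h1 : p s / s < 0 := div_neg_of_neg_of_pos (hball s (hsupp hs')).2 hs.1
        have h2 : (p s / s) ^ (k - 1) < 0 := hodd.pow_neg h1
        have h4 := hle s hs
        have h5 := hle' s hs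
        simp only [Pi.zero_apply] at hs0
        have h6 : s ^ (n - 1) * (k * c * (p s / s) ^ (k - 1) * deriv f s ^ 2) = 0 := by linarith
        have hs1 : s ^ (n - 1) ≠ 0 := pow_ne_zero _ hs.1.ne'
        have hk0 : (k : ℝ) ≠ 0 := by positivity
        simpa [hs1, hk0, hc.ne', h2.ne] using h6
      · by_contra h0
        exact hs' (support_deriv_subset h0)
    have hrs : ∀ s ∈ Icc (r - ε / 2) r, s ∈ Ioo (0 : ℝ) 1 := fun s hs =>
      (hball s (by
        rw [Metric.mem_ball, Real.dist_eq, abs_lt]; constructor <;> linarith [hs.1, hs.2])).1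
    have hftc : ∫ s in (r - ε / 2)..r, deriv f s = f r - f (r - ε / 2) :=
      intervalIntegral.integral_deriv_eq_sub
        (fun s _ => (f.contDiff (n := 1)).differentiable one_ne_zero s)
        (((f.contDiff (n := 1)).continuous_deriv le_rfl).intervalIntegrable _ _)
    have h0 : ∫ s in (r - ε / 2)..r, deriv f s = 0 := by
      rw [intervalIntegral.integral_of_le (by linarith)]
      refine integral_eq_zero_of_ae ?_
      refine ae_restrict_of_ae_restrict_of_subset (fun s hs => hrs s ⟨hs.1.le, hs.2⟩) hderiv
    have h1 : f r = 1 := f.one_of_mem_closedBall (by simp [f.rIn_pos.le])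
    have h2 : f (r - ε / 2) = 0 := f.zero_of_le_dist (by
      rw [Real.dist_eq]; change ε / 2 ≤ _; rw [abs_of_nonpos] <;> linarith)
    rw [h0, h1, h2] at hftc
    norm_num at hftc
  · have h1 := h.flux r hr
    have h2 := h.flux_nonneg hr
    have h3 : p r ^ k < 0 := ho.pow_neg hneg
    have h4 : r ^ (n - k) * p r ^ k < 0 := mul_neg_of_pos_of_neg (pow_pos hr.1 _) h3
    nlinarith

end SemistableProfile

/-! ### Monotone quantities and regularity of the profile. -/

theorem contDiffOn_one_of_hasDerivAt {U : Set ℝ} (hU : IsOpen U) {f f' : ℝ → ℝ}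
    (hf : ∀ x ∈ U, HasDerivAt f (f' x) x) (hf' : ContinuousOn f' U) : ContDiffOn ℝ 1 f U := by
  have h1 : ContDiffOn ℝ (0 + 1) f U := by
    rw [contDiffOn_succ_iff_deriv_of_isOpen hU]
    refine ⟨fun x hx => (hf x hx).differentiableAt.differentiableWithinAt, by simp, ?_⟩
    rw [contDiffOn_zero]
    exact hf'.congr fun x hx => (hf x hx).deriv
  simpa using h1

namespace SemistableProfile

variable {n k : ℕ} {c : ℝ} {g v p : ℝ → ℝ}

theorem intervalIntegrable (h : SemistableProfile n k c g v p) {a b : ℝ} (ha : a ∈ Icc (0 : ℝ) 1)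
    (hb : b ∈ Icc (0 : ℝ) 1) :
    IntervalIntegrable (fun s => s ^ (n - 1) * g (v s)) volume a b := by
  have h1 : IntervalIntegrable (fun s => s ^ (n - 1) * g (v s)) volume 0 1 :=
    (intervalIntegrable_iff_integrableOn_Ioo_of_le zero_le_one).2 h.integrableOn
  refine h1.mono_set ?_
  rw [uIcc_of_le zero_le_one]
  exact uIcc_subset_Icc ha hb

theorem continuousOn_profile (h : SemistableProfile n k c g v p) : ContinuousOn v (Ioo 0 1) :=
  fun r hr => (h.hasDerivAt r hr).continuousAt.continuousWithinAt

theorem continuousOn_source (h : SemistableProfile n k c g v p) :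
    ContinuousOn (fun s => s ^ (n - 1) * g (v s)) (Ioo 0 1) :=
  (continuous_pow _).continuousOn.mul
    (h.lipschitz.continuous.comp_continuousOn h.continuousOn_profile)

theorem monotoneOn_profile (h : SemistableProfile n k c g v p) (hk : 1 ≤ k) (hc : 0 < c) :
    MonotoneOn v (Ioo 0 1) := by
  refine monotoneOn_of_deriv_nonneg (convex_Ioo 0 1) h.continuousOn_profile ?_ ?_
  · rw [interior_Ioo]
    exact fun r hr => (h.hasDerivAt r hr).differentiableAt.differentiableWithinAt
  · rw [interior_Ioo]
    intro r hr
    rw [(h.hasDerivAt r hr).deriv]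
    exact h.deriv_nonneg hk hc hr

theorem flux_mono (h : SemistableProfile n k c g v p) {r t : ℝ} (hr : 0 < r) (hrt : r ≤ t)
    (ht : t < 1) :
    ∫ s in (0 : ℝ)..r, s ^ (n - 1) * g (v s) ≤ ∫ s in (0 : ℝ)..t, s ^ (n - 1) * g (v s) := by
  rw [← intervalIntegral.integral_add_adjacent_intervals
    (h.intervalIntegrable (a := 0) (b := r) (by simp) ⟨hr.le, by linarith⟩)
    (h.intervalIntegrable (a := r) (b := t) ⟨hr.le, by linarith⟩ ⟨by linarith, ht.le⟩)]
  have := intervalIntegral.integral_nonneg (μ := volume) hrt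
    (f := fun s => s ^ (n - 1) * g (v s))
    fun s hs => mul_nonneg (pow_nonneg (hr.le.trans hs.1) _) (h.nonneg _)
  linarith

/-- Since g ∘ v is nonincreasing, its mean with weight s^{n-1} over (0, r) is nonincreasing in r:
the value g(v r) bounds the source from below on (0, r) and from above on (r, t). -/
theorem flux_mul_pow_le (h : SemistableProfile n k c g v p) (hn : 1 ≤ n) (hk : 1 ≤ k) (hc : 0 < c)
    {r t : ℝ} (hr : 0 < r) (hrt : r ≤ t) (ht : t < 1) :
    (∫ s in (0 : ℝ)..t, s ^ (n - 1) * g (v s)) * r ^ n ≤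
      (∫ s in (0 : ℝ)..r, s ^ (n - 1) * g (v s)) * t ^ n := by
  have hr1 : r ∈ Ioo (0 : ℝ) 1 := ⟨hr, by linarith⟩
  have i1 := h.intervalIntegrable (a := 0) (b := r) (by simp) ⟨hr.le, by linarith⟩
  have i2 := h.intervalIntegrable (a := r) (b := t) ⟨hr.le, by linarith⟩ ⟨by linarith, ht.le⟩
  have hpow : ∀ a b : ℝ, ∫ s in a..b, s ^ (n - 1) * g (v r) = (b ^ n - a ^ n) / n * g (v r) := by
    intro a b
    rw [intervalIntegral.integral_mul_const, integral_pow, Nat.sub_add_cancel hn, Nat.cast_sub hn]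
    simp
  have hi : ∀ a b : ℝ, IntervalIntegrable (fun s => s ^ (n - 1) * g (v r)) volume a b :=
    fun a b => ((continuous_pow _).mul continuous_const).intervalIntegrable a b
  have e1 : r ^ n / n * g (v r) ≤ ∫ s in (0 : ℝ)..r, s ^ (n - 1) * g (v s) := by
    have := hpow 0 r
    rw [zero_pow (by omega), sub_zero] at this
    rw [← this]
    refine intervalIntegral.integral_mono_on_of_le_Ioo hr.le (hi _ _) i1 fun s hs => ?_
    refine mul_le_mul_of_nonneg_left (h.antitone ?_) (pow_nonneg hs.1.le _)
    exact h.monotoneOn_profile hk hc ⟨hs.1, hs.2.trans hr1.2⟩ hr1 hs.2.le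
  have e2 : ∫ s in r..t, s ^ (n - 1) * g (v s) ≤ (t ^ n - r ^ n) / n * g (v r) := by
    rw [← hpow]
    refine intervalIntegral.integral_mono_on_of_le_Ioo hrt i2 (hi _ _) fun s hs => ?_
    refine mul_le_mul_of_nonneg_left (h.antitone ?_) (pow_nonneg (hr.le.trans hs.1.le) _)
    exact h.monotoneOn_profile hk hc hr1 ⟨hr.trans hs.1, hs.2.trans ht⟩ hs.1.le
  rw [← intervalIntegral.integral_add_adjacent_intervals i1 i2]
  have hrn : 0 < r ^ n := pow_pos hr n
  have htr : r ^ n ≤ t ^ n := pow_le_pow_left₀ hr.le hrt n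
  set F := ∫ s in (0 : ℝ)..r, s ^ (n - 1) * g (v s)
  have hn0 : (0 : ℝ) < n := by exact_mod_cast hn
  have e3 : (t ^ n - r ^ n) / n * g (v r) * r ^ n ≤ F * (t ^ n - r ^ n) := by
    have : (t ^ n - r ^ n) / n * g (v r) * r ^ n = (r ^ n / n * g (v r)) * (t ^ n - r ^ n) := by
      ring
    rw [this]
    exact mul_le_mul_of_nonneg_right e1 (by linarith)
  nlinarith [mul_le_mul_of_nonneg_right e2 hrn.le]

theorem pow_mul_deriv_pow_mono (h : SemistableProfile n k c g v p) (hc : 0 < c)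
    {r t : ℝ} (hr : 0 < r) (hrt : r ≤ t) (ht : t < 1) :
    r ^ (n - k) * p r ^ k ≤ t ^ (n - k) * p t ^ k := by
  have := h.flux_mono hr hrt ht
  rw [← h.flux r ⟨hr, by linarith⟩, ← h.flux t ⟨by linarith, ht⟩] at this
  exact le_of_mul_le_mul_left this hc

/-- By the flux identity the mean of the source over (0, r) is proportional to (p/r)^k, so p/r is
nonincreasing. -/
theorem deriv_mul_le (h : SemistableProfile n k c g v p) (hk : 1 ≤ k) (hkn : k ≤ n)
    (hc : 0 < c) {r t : ℝ} (hr : 0 < r) (hrt : r ≤ t) (ht : t < 1) : p t * r ≤ p r * t := by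
  have h1 := h.flux_mul_pow_le (hk.trans hkn) hk hc hr hrt ht
  have ht0 : 0 < t := hr.trans_le hrt
  rw [← h.flux r ⟨hr, by linarith⟩, ← h.flux t ⟨by linarith, ht⟩] at h1
  have e : ∀ x : ℝ, x ^ n = x ^ (n - k) * x ^ k := fun x => by
    rw [← pow_add, Nat.sub_add_cancel hkn]
  rw [e r, e t] at h1
  have h2 : (c * (t ^ (n - k) * r ^ (n - k))) * (p t * r) ^ k ≤
      (c * (t ^ (n - k) * r ^ (n - k))) * (p r * t) ^ k := by
    rw [mul_pow, mul_pow]; linarith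
  have h3 := le_of_mul_le_mul_left h2 (by positivity)
  exact le_of_pow_le_pow_left₀ (by omega)
    (mul_nonneg (h.deriv_nonneg hk hc ⟨hr, by linarith⟩) ht0.le) h3

section Boundary

variable {q : ℝ}

theorem eventually_Ioo_left {t : ℝ} (ht : t < 1) : ∀ᶠ s in 𝓝[<] (1 : ℝ), t < s ∧ s < 1 :=
  Ioo_mem_nhdsLT ht

theorem mul_boundary_deriv_le (h : SemistableProfile n k c g v p) (hk : 1 ≤ k) (hkn : k ≤ n)
    (hc : 0 < c) (hq : Tendsto p (𝓝[<] 1) (𝓝 q)) {r : ℝ} (hr : r ∈ Ioo (0 : ℝ) 1) :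
    q * r ≤ p r := by
  have h1 : Tendsto (fun t => p t * r) (𝓝[<] 1) (𝓝 (q * r)) := hq.mul_const r
  have h2 : Tendsto (fun t => p r * t) (𝓝[<] 1) (𝓝 (p r * 1)) :=
    (tendsto_id.mono_left nhdsWithin_le_nhds).const_mul _
  rw [mul_one] at h2
  refine le_of_tendsto_of_tendsto h1 h2 ?_
  filter_upwards [eventually_Ioo_left hr.2] with t ht
  exact h.deriv_mul_le hk hkn hc hr.1 ht.1.le ht.2

theorem pow_mul_deriv_pow_le_boundary (h : SemistableProfile n k c g v p) (hc : 0 < c)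
    (hq : Tendsto p (𝓝[<] 1) (𝓝 q)) {r : ℝ} (hr : r ∈ Ioo (0 : ℝ) 1) :
    r ^ (n - k) * p r ^ k ≤ q ^ k := by
  have h1 : Tendsto (fun t : ℝ => t ^ (n - k) * p t ^ k) (𝓝[<] 1) (𝓝 (1 ^ (n - k) * q ^ k)) :=
    ((tendsto_id.mono_left nhdsWithin_le_nhds).pow _).mul (hq.pow _)
  rw [one_pow, one_mul] at h1
  refine ge_of_tendsto h1 ?_
  filter_upwards [eventually_Ioo_left hr.2] with t ht
  exact h.pow_mul_deriv_pow_mono hc hr.1 ht.1.le ht.2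

theorem boundary_deriv_nonneg (h : SemistableProfile n k c g v p) (hk : 1 ≤ k) (hc : 0 < c)
    (hq : Tendsto p (𝓝[<] 1) (𝓝 q)) : 0 ≤ q := by
  refine ge_of_tendsto hq ?_
  filter_upwards [eventually_Ioo_left zero_lt_one] with t ht
  exact h.deriv_nonneg hk hc ht

end Boundary

theorem hasDerivAt_flux (h : SemistableProfile n k c g v p) {r : ℝ} (hr : r ∈ Ioo (0 : ℝ) 1) :
    HasDerivAt (fun r => ∫ s in (0 : ℝ)..r, s ^ (n - 1) * g (v s)) (r ^ (n - 1) * g (v r)) r := by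
  refine intervalIntegral.integral_hasDerivAt_right
    (h.intervalIntegrable (by simp) ⟨hr.1.le, hr.2.le⟩) ?_
    (h.continuousOn_source.continuousAt (isOpen_Ioo.mem_nhds hr))
  exact h.continuousOn_source.stronglyMeasurableAtFilter isOpen_Ioo r hr

/-- Solving the flux identity for p presents it as the k-th root of a C¹ function, and the root is
differentiable because p > 0. -/
theorem contDiffOn_deriv (h : SemistableProfile n k c g v p) (hk : 1 ≤ k) (hc : 0 < c)
    (hp : ∀ r ∈ Ioo (0 : ℝ) 1, 0 < p r) : ContDiffOn ℝ 1 p (Ioo 0 1) := by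
  have hF : ContDiffOn ℝ 1 (fun r => ∫ s in (0 : ℝ)..r, s ^ (n - 1) * g (v s)) (Ioo 0 1) :=
    contDiffOn_one_of_hasDerivAt isOpen_Ioo (fun r hr => h.hasDerivAt_flux hr)
      h.continuousOn_source
  have hΦ : ContDiffOn ℝ 1 (fun r => ((∫ s in (0 : ℝ)..r, s ^ (n - 1) * g (v s)) /
      (c * r ^ (n - k))) ^ ((k : ℝ)⁻¹)) (Ioo 0 1) := by
    refine ContDiffOn.rpow_const_of_ne (hF.div (contDiffOn_const.mul (contDiffOn_id.pow _)) ?_) ?_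
    · exact fun r hr => (mul_pos hc (pow_pos hr.1 _)).ne'
    · intro r hr
      rw [← h.flux r hr]
      have := hp r hr
      have := hr.1
      positivity
  refine hΦ.congr fun r hr => ?_
  have h1 := hr.1
  rw [← h.flux r hr, ← mul_assoc, mul_div_cancel_left₀ _ (by positivity),
    Real.pow_rpow_inv_natCast (hp r hr).le (by omega)]

theorem deriv_flux_eq (h : SemistableProfile n k c g v p) (hk : 1 ≤ k) (hc : 0 < c)
    (hp : ∀ r ∈ Ioo (0 : ℝ) 1, 0 < p r) {r : ℝ} (hr : r ∈ Ioo (0 : ℝ) 1) :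
    c * ((n - k : ℕ) * r ^ (n - k) / r * p r ^ k +
      r ^ (n - k) * (k * p r ^ (k - 1) * deriv p r)) = r ^ (n - 1) * g (v r) := by
  have hpd : HasDerivAt p (deriv p r) r :=
    (((h.contDiffOn_deriv hk hc hp).contDiffAt (isOpen_Ioo.mem_nhds hr)).differentiableAt
      one_ne_zero).hasDerivAt
  have h1 : HasDerivAt (fun r => c * (r ^ (n - k) * p r ^ k)) _ r :=
    ((hasDerivAt_pow_div hr.1.ne' (n - k)).mul (hpd.pow k)).const_mul c
  have h2 : HasDerivAt (fun r => c * (r ^ (n - k) * p r ^ k)) (r ^ (n - 1) * g (v r)) r :=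
    (h.hasDerivAt_flux hr).congr_of_eventuallyEq (by
      filter_upwards [isOpen_Ioo.mem_nhds hr] with s hs using h.flux s hs)
  exact h1.unique h2

/-- The flux identity expresses p through an integral that makes sense for every r > 0 once the
source is cut off at 1. The resulting P is continuous across r = 1, which makes the profile C¹ up to
the boundary. -/
theorem exists_extension (h : SemistableProfile n k c g v p) (hk : 1 ≤ k) (hc : 0 < c) :
    ∃ V P : ℝ → ℝ, (∀ r ∈ Ioo (0 : ℝ) 1, V r = v r ∧ P r = p r) ∧
      (∀ r > 0, HasDerivAt V (P r) r) ∧ ContinuousOn P (Ioi 0) := by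
  set w : ℝ → ℝ := (Ioo (0 : ℝ) 1).indicator fun s => s ^ (n - 1) * g (v s)
  have hw : Integrable w := (integrable_indicator_iff measurableSet_Ioo).2 h.integrableOn
  have hF : Continuous fun r => ∫ s in (0 : ℝ)..r, w s :=
    intervalIntegral.continuous_primitive (fun a b => hw.intervalIntegrable) 0
  set P : ℝ → ℝ := fun r => ((∫ s in (0 : ℝ)..r, w s) / (c * r ^ (n - k))) ^ ((k : ℝ)⁻¹)
  have hP : ContinuousOn P (Ioi 0) := by
    refine ContinuousOn.rpow_const (hF.continuousOn.div ?_ ?_) fun _ _ =>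
      Or.inr (inv_nonneg.2 (Nat.cast_nonneg k))
    · exact (continuous_const.mul (continuous_pow _)).continuousOn
    · exact fun r hr => (mul_pos hc (pow_pos hr _)).ne'
  have hPp : ∀ r ∈ Ioo (0 : ℝ) 1, P r = p r := by
    intro r hr
    have h1 := hr.1
    have : ∫ s in (0 : ℝ)..r, w s = ∫ s in (0 : ℝ)..r, s ^ (n - 1) * g (v s) := by
      rw [intervalIntegral.integral_of_le hr.1.le, intervalIntegral.integral_of_le hr.1.le]
      refine setIntegral_congr_fun measurableSet_Ioc fun s hs => ?_
      exact indicator_of_mem (M := ℝ) (s := Ioo 0 1) ⟨hs.1, hs.2.trans_lt hr.2⟩ _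
    simp only [P]
    rw [this, ← h.flux r hr, ← mul_assoc, mul_div_cancel_left₀ _ (by positivity),
      Real.pow_rpow_inv_natCast (h.deriv_nonneg hk hc hr) (by omega)]
  have hint : ∀ a b : ℝ, 0 < a → 0 < b → IntervalIntegrable P volume a b := by
    intro a b ha hb
    exact (hP.mono fun x hx => (lt_min ha hb).trans_le hx.1).intervalIntegrable
  have hV : ∀ r > 0, HasDerivAt (fun r => v (1 / 2) + ∫ s in (1 / 2 : ℝ)..r, P s) (P r) r := by
    intro r hr
    refine (intervalIntegral.integral_hasDerivAt_right (hint _ _ (by norm_num) hr) ?_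
      (hP.continuousAt (Ioi_mem_nhds hr))).const_add _
    exact hP.stronglyMeasurableAtFilter isOpen_Ioi r hr
  refine ⟨_, P, fun r hr => ⟨?_, hPp r hr⟩, hV, hP⟩
  have hsub : uIcc (1 / 2) r ⊆ Ioo (0 : ℝ) 1 := fun s hs =>
    ⟨(lt_min (by norm_num) hr.1).trans_le hs.1, hs.2.trans_lt (max_lt (by norm_num) hr.2)⟩
  rw [intervalIntegral.integral_eq_sub_of_hasDerivAt (f := v)
    (fun s hs => by rw [hPp s (hsub hs)]; exact h.hasDerivAt s (hsub hs))
    (hint _ _ (by norm_num) hr.1)]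
  ring

end SemistableProfile

/-! ### The Hardy type inequality for compactly supported test functions. -/

theorem exists_Icc_of_isCompact_subset_Ioo {K : Set ℝ} (hK : IsCompact K) (h : K ⊆ Ioo 0 1) :
    ∃ a b : ℝ, 0 < a ∧ a < b ∧ b < 1 ∧ K ⊆ Ioo a b := by
  rcases K.eq_empty_or_nonempty with rfl | hne
  · exact ⟨1 / 3, 2 / 3, by norm_num, by norm_num, by norm_num, empty_subset _⟩
  · obtain ⟨a, ha, ha'⟩ := hK.exists_isLeast hne
    obtain ⟨b, hb, hb'⟩ := hK.exists_isGreatest hne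
    have h1 := h ha
    have h2 := h hb
    have h3 := ha' hb
    refine ⟨a / 2, (b + 1) / 2, by linarith [h1.1], by linarith [h1.1, h2.2], by linarith [h2.2],
      fun x hx => ⟨?_, ?_⟩⟩
    · linarith [ha' hx, h1.1]
    · linarith [hb' hx, h2.2]

theorem setIntegral_Ioo_eq_intervalIntegral {f : ℝ → ℝ} {a b : ℝ} (ha : 0 < a) (hab : a < b)
    (hb : b < 1) (hf : ∀ r, r ∉ Ioo a b → f r = 0) :
    ∫ r in Ioo (0 : ℝ) 1, f r = ∫ r in a..b, f r := by
  rw [intervalIntegral.integral_of_le hab.le, integral_Ioc_eq_integral_Ioo]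
  refine setIntegral_eq_of_subset_of_forall_sdiff_eq_zero measurableSet_Ioo
    (Ioo_subset_Ioo ha.le hb.le) fun x hx => hf x hx.2

/-- As p ≠ 0, v has a local inverse, through which differentiability of g ∘ v at r passes to g at v
r. As g ∘ v is differentiable almost everywhere, the value given to g' at its corners matters only
on a null set of radii. -/
theorem deriv_comp_mul_of_hasStrictDerivAt {g v : ℝ → ℝ} {r p : ℝ} (hv : HasStrictDerivAt v p r)
    (hp : p ≠ 0) (hg : DifferentiableAt ℝ (fun s => g (v s)) r) :
    deriv g (v r) * p = deriv (fun s => g (v s)) r := by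
  have h1 := hv.to_localInverse hp
  have h2 : hv.localInverse v p r hp (v r) = r :=
    (hv.eventually_left_inverse hp).self_of_nhds
  have h3 : HasDerivAt (fun s => g (v s)) (deriv (fun s => g (v s)) r)
      (hv.localInverse v p r hp (v r)) := by
    rw [h2]; exact hg.hasDerivAt
  have h4 := h3.comp (v r) h1.hasDerivAt
  have h5 : HasDerivAt g (deriv (fun s => g (v s)) r * p⁻¹) (v r) := by
    refine h4.congr_of_eventuallyEq ?_
    filter_upwards [hv.eventually_right_inverse hp] with y hy
    simp only [Function.comp]
    rw [hy]
  rw [h5.deriv, mul_assoc, inv_mul_cancel₀ hp, mul_one]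

/-- The quadratic form in the Hardy type inequality for semistable profiles; `y` and `z` stand for
the values of a test function and of its derivative at the radius `r`. -/
def hardyForm (n k : ℕ) (y z r : ℝ) : ℝ :=
  z ^ 2 + 2 * ((k - 1) / (k + 1)) * (y * z / r) - (2 * n - k - 1) / (k + 1) * (y ^ 2 / r ^ 2)

namespace SemistableProfile

variable {n k : ℕ} {c : ℝ} {g v p : ℝ → ℝ}

/-- The equation cancels the terms in p'² and in p' y z. What is left of p' is a multiple of p^k p'
y², and ((k+1)n - 2k)/(k+1) is the coefficient for which subtracting the derivative of r^{n-k} r⁻¹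
p^{k+1} ζ² removes it. The separate factor r⁻¹ keeps the expression correct for n = k. -/
theorem hardyForm_identity (hk : 1 ≤ k) (hkn : k ≤ n) {r P p' y z G : ℝ} (hr : 0 < r)
    (hode : c * ((n - k : ℕ) * r ^ (n - k) / r * P ^ k +
      r ^ (n - k) * (k * P ^ (k - 1) * p')) = r ^ (n - 1) * G) :
    r ^ (n - 1) * (k * c * (P / r) ^ (k - 1) * (p' * y + P * z) ^ 2) -
      G * (((n - 1 : ℕ) * r ^ (n - 1) / r * P + r ^ (n - 1) * p') * y ^ 2 +
        r ^ (n - 1) * P * (2 * y * z)) =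
      c * k * (r ^ (n - k) * P ^ (k + 1) * hardyForm n k y z r) -
      c * (((k + 1) * n - 2 * k) / (k + 1)) *
        ((((n - k : ℕ) * r ^ (n - k) / r * r⁻¹ + r ^ (n - k) * (-(r ^ 2)⁻¹)) * P ^ (k + 1) +
          r ^ (n - k) * r⁻¹ * ((k + 1) * P ^ k * p')) * y ^ 2 +
          r ^ (n - k) * r⁻¹ * P ^ (k + 1) * (2 * y * z)) := by
  obtain ⟨k, rfl⟩ : ∃ j, k = j + 1 := ⟨k - 1, by omega⟩
  obtain ⟨m, rfl⟩ : ∃ m, n = m + (k + 1) := ⟨n - (k + 1), by omega⟩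
  have e1 : m + (k + 1) - 1 = m + k := by omega
  have e2 : m + (k + 1) - (k + 1) = m := by omega
  have e3 : k + 1 - 1 = k := by omega
  rw [e1, e2, e3] at hode ⊢
  have hG : G * (((m + k : ℕ) * r ^ (m + k) / r * P + r ^ (m + k) * p') * y ^ 2 +
        r ^ (m + k) * P * (2 * y * z)) = (r ^ (m + k) * G) *
        (((m + k : ℕ) / r * P + p') * y ^ 2 + P * (2 * y * z)) := by ring
  rw [hG, ← hode, hardyForm]
  simp only [div_pow, pow_add, pow_one]
  push_cast
  have hr0 : r ≠ 0 := hr.ne'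
  have hk2 : (k : ℝ) + 1 + 1 ≠ 0 := by positivity
  field_simp
  ring

/-- Testing semistability with the product of the derivative of the profile and of `ζ`. -/
theorem hardy (h : SemistableProfile n k c g v p) (hk : 1 ≤ k) (hkn : k ≤ n) (hc : 0 < c)
    (hp : ∀ r ∈ Ioo (0 : ℝ) 1, 0 < p r) {ζ : ℝ → ℝ} (hζ : ContDiff ℝ 1 ζ)
    (hζc : HasCompactSupport ζ) (hζs : tsupport ζ ⊆ Ioo 0 1) :
    0 ≤ ∫ r in Ioo (0 : ℝ) 1,
      r ^ (n - k) * p r ^ (k + 1) * hardyForm n k (ζ r) (deriv ζ r) r := by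
  obtain ⟨a, b, ha, hab, hb, hK⟩ := exists_Icc_of_isCompact_subset_Ioo hζc hζs
  have hpC := h.contDiffOn_deriv hk hc hp
  have hsub : Icc a b ⊆ Ioo (0 : ℝ) 1 := fun x hx => ⟨ha.trans_le hx.1, hx.2.trans_lt hb⟩
  have hu : uIcc a b = Icc a b := uIcc_of_le hab.le
  have hout : ∀ r, r ∉ Ioo a b → ζ r = 0 ∧ deriv ζ r = 0 := by
    intro r hr
    have hr' : r ∉ tsupport ζ := fun h' => hr (hK h')
    refine ⟨image_eq_zero_of_notMem_tsupport hr', ?_⟩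
    by_contra h0
    exact hr' (support_deriv_subset h0)
  have hζd : ∀ r, HasDerivAt ζ (deriv ζ r) r := fun r =>
    (hζ.differentiable one_ne_zero r).hasDerivAt
  have hpd : ∀ r ∈ Icc a b, HasDerivAt p (deriv p r) r := fun r hr =>
    (((hpC).contDiffAt (isOpen_Ioo.mem_nhds (hsub hr))).differentiableAt one_ne_zero).hasDerivAt
  have hp'c : ContinuousOn (deriv p) (Icc a b) :=
    (hpC.continuousOn_deriv_of_isOpen isOpen_Ioo le_rfl).mono hsub
  have hpc : ContinuousOn p (Icc a b) := h.continuousOn.mono hsub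
  have hζ'c : Continuous (deriv ζ) := hζ.continuous_deriv le_rfl
  have hgv : ContinuousOn (fun r => g (v r)) (Icc a b) :=
    h.lipschitz.continuous.comp_continuousOn (h.continuousOn_profile.mono hsub)
  -- the test function
  set ψ : ℝ → ℝ := fun r => p r * ζ r
  have hψC : ContDiff ℝ 1 ψ := contDiff_mul_of_tsupport_subset isOpen_Ioo hpC hζ hζs
  have hψs : tsupport ψ ⊆ tsupport ζ := closure_mono (Function.support_mul_subset_right _ _)
  have hψd : ∀ r ∈ Icc a b, deriv ψ r = deriv p r * ζ r + p r * deriv ζ r := fun r hr =>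
    ((hpd r hr).mul (hζd r)).deriv
  obtain ⟨-, hst⟩ := h.stable ψ hψC (HasCompactSupport.mul_left hζc) (hψs.trans hζs)
  rw [setIntegral_Ioo_eq_intervalIntegral ha hab hb] at hst
  swap
  · intro r hr
    have hr' : r ∉ tsupport ψ := fun h' => hr (hK (hψs h'))
    have h1 : ψ r = 0 := image_eq_zero_of_notMem_tsupport hr'
    have h2 : deriv ψ r = 0 := by
      by_contra h0
      exact hr' (support_deriv_subset h0)
    simp [h1, h2]
  rw [setIntegral_Ioo_eq_intervalIntegral ha hab hb]
  swap
  · intro r hr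
    simp [(hout r hr).1, (hout r hr).2, hardyForm]
  -- the composition with the nonlinearity
  have hvC : ContDiffOn ℝ 1 v (Ioo 0 1) :=
    contDiffOn_one_of_hasDerivAt isOpen_Ioo h.hasDerivAt h.continuousOn
  have hgvAC : AbsolutelyContinuousOnInterval (fun r => g (v r)) a b := by
    obtain ⟨K, hKv⟩ := (hvC.mono hsub).exists_lipschitzOnWith one_ne_zero (convex_Icc _ _)
      isCompact_Icc
    obtain ⟨L, hL⟩ := LocallyLipschitzOn.exists_lipschitzOnWith_of_compact
      (isCompact_Icc.image_of_continuousOn (h.continuousOn_profile.mono hsub))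
      (h.lipschitz.locallyLipschitzOn (s := v '' Icc a b))
    have : LipschitzOnWith (L * K) (fun r => g (v r)) (uIcc a b) := by
      rw [hu]; exact hL.comp hKv (mapsTo_image _ _)
    exact this.absolutelyContinuousOnInterval
  -- With ψ = p ζ the potential term r^{n-1} g'(v) ψ² is (g ∘ v)' Φ almost everywhere, and g ∘ v,
  -- being Lipschitz on [a, b], can be integrated by parts against Φ.
  set Φ : ℝ → ℝ := fun r => r ^ (n - 1) * p r * ζ r ^ 2
  have hΦC : ContDiff ℝ 1 Φ := by
    have h1 : ContDiffOn ℝ 1 (fun r => r ^ (n - 1) * p r * ζ r) (Ioo 0 1) :=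
      (((contDiff_id.pow _).contDiffOn).mul hpC).mul hζ.contDiffOn
    have h2 := contDiff_mul_of_tsupport_subset isOpen_Ioo h1 hζ hζs
    have e : Φ = fun r => r ^ (n - 1) * p r * ζ r * ζ r := by
      funext r
      simp only [Φ]; ring
    rw [e]
    exact h2
  have hΦd : ∀ r ∈ Icc a b, HasDerivAt Φ (((n - 1 : ℕ) * r ^ (n - 1) / r * p r +
      r ^ (n - 1) * deriv p r) * ζ r ^ 2 + r ^ (n - 1) * p r * (2 * ζ r * deriv ζ r)) r := by
    intro r hr
    have := ((hasDerivAt_pow_div (hsub hr).1.ne' (n - 1)).fun_mul (hpd r hr)).fun_mul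
      ((hζd r).fun_pow 2)
    simpa using this
  have hΦAC : AbsolutelyContinuousOnInterval Φ a b :=
    hΦC.contDiffOn.absolutelyContinuousOnInterval
  have hΦa : Φ a = 0 := by simp [Φ, (hout a (by simp)).1]
  have hΦb : Φ b = 0 := by simp [Φ, (hout b (by simp)).1]
  have hparts := hgvAC.integral_mul_deriv_eq_deriv_mul hΦAC
  rw [hΦa, hΦb, mul_zero, mul_zero, sub_zero, zero_sub] at hparts
  -- the boundary term
  set Ψ : ℝ → ℝ := fun r => r ^ (n - k) * r⁻¹ * p r ^ (k + 1) * ζ r ^ 2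
  have hΨd : ∀ r ∈ Icc a b, HasDerivAt Ψ ((((n - k : ℕ) * r ^ (n - k) / r * r⁻¹ +
      r ^ (n - k) * (-(r ^ 2)⁻¹)) * p r ^ (k + 1) +
          r ^ (n - k) * r⁻¹ * ((k + 1) * p r ^ k * deriv p r)) * ζ r ^ 2 +
          r ^ (n - k) * r⁻¹ * p r ^ (k + 1) * (2 * ζ r * deriv ζ r)) r := by
    intro r hr
    have := (((hasDerivAt_pow_div (hsub hr).1.ne' (n - k)).fun_mul
      (hasDerivAt_inv (hsub hr).1.ne')).fun_mul ((hpd r hr).fun_pow (k + 1))).fun_mul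
      ((hζd r).fun_pow 2)
    simpa using this
  set Ψ' : ℝ → ℝ := fun r => ((((n - k : ℕ) * r ^ (n - k) / r * r⁻¹ +
      r ^ (n - k) * (-(r ^ 2)⁻¹)) * p r ^ (k + 1) +
          r ^ (n - k) * r⁻¹ * ((k + 1) * p r ^ k * deriv p r)) * ζ r ^ 2 +
          r ^ (n - k) * r⁻¹ * p r ^ (k + 1) * (2 * ζ r * deriv ζ r))
  have hne : ∀ r ∈ Icc a b, r ≠ 0 := fun r hr => (hsub hr).1.ne'
  have hΨ'c : ContinuousOn Ψ' (Icc a b) := by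
    have hz := hζ.continuous.continuousOn (s := Icc a b)
    have hz' := hζ'c.continuousOn (s := Icc a b)
    have hne2 : ∀ r ∈ Icc a b, r ^ 2 ≠ 0 := fun r hr => pow_ne_zero _ (hne r hr)
    fun_prop (disch := assumption)
  have hΨi : IntervalIntegrable Ψ' volume a b := (hΨ'c.mono hu.subset).intervalIntegrable
  have hΨ0 : ∫ r in a..b, Ψ' r = 0 := by
    rw [intervalIntegral.integral_eq_sub_of_hasDerivAt (f := Ψ)
      (fun r hr => hΨd r (hu ▸ hr)) hΨi]
    simp [Ψ, (hout a (by simp)).1, (hout b (by simp)).1]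
  set T : ℝ → ℝ := fun r => r ^ (n - 1) * (k * c * (p r / r) ^ (k - 1) *
    (deriv p r * ζ r + p r * deriv ζ r) ^ 2)
  have hTi : IntervalIntegrable T volume a b := by
    refine ContinuousOn.intervalIntegrable ?_
    rw [hu]
    have hz := hζ.continuous.continuousOn (s := Icc a b)
    have hz' := hζ'c.continuousOn (s := Icc a b)
    fun_prop (disch := assumption)
  have hgΦi : IntervalIntegrable (fun r => deriv (fun s => g (v s)) r * Φ r) volume a b :=
    hgvAC.intervalIntegrable_deriv.mul_continuousOn hΦC.continuous.continuousOn
  have hgΦ'i : IntervalIntegrable (fun r => g (v r) * deriv Φ r) volume a b := by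
    refine ContinuousOn.intervalIntegrable ?_
    rw [hu]
    exact hgv.mul (hΦC.continuous_deriv le_rfl).continuousOn
  have hst' : 0 ≤ ∫ r in a..b, (T r + deriv (fun s => g (v s)) r * Φ r) := by
    refine hst.trans_eq (intervalIntegral.integral_congr_ae ?_)
    filter_upwards [hgvAC.ae_differentiableAt] with r hr1 hr2
    have hr : r ∈ Icc a b := hu ▸ uIoc_subset_uIcc hr2
    have h1 := deriv_comp_mul_of_hasStrictDerivAt
      ((hvC.contDiffAt (isOpen_Ioo.mem_nhds (hsub hr))).hasStrictDerivAt'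
        (h.hasDerivAt r (hsub hr)) one_ne_zero) (hp r (hsub hr)).ne' (hr1 (uIoc_subset_uIcc hr2))
    rw [hψd r hr, ← h1]
    simp only [T, Φ, ψ]
    ring
  rw [intervalIntegral.integral_add hTi hgΦi] at hst'
  have hmain : ∫ r in a..b, (T r - g (v r) * deriv Φ r) =
      ∫ r in a..b, (c * k * (r ^ (n - k) * p r ^ (k + 1) *
        hardyForm n k (ζ r) (deriv ζ r) r) - c * (((k + 1) * n - 2 * k) / (k + 1)) * Ψ' r) := by
    refine intervalIntegral.integral_congr fun r hr => ?_
    rw [hu] at hr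
    rw [(hΦd r hr).deriv]
    exact hardyForm_identity hk hkn (hsub hr).1 (h.deriv_flux_eq hk hc hp (hsub hr))
  have hHi : IntervalIntegrable (fun r => r ^ (n - k) * p r ^ (k + 1) *
      hardyForm n k (ζ r) (deriv ζ r) r) volume a b := by
    refine ContinuousOn.intervalIntegrable ?_
    rw [hu]
    unfold hardyForm
    have hz := hζ.continuous.continuousOn (s := Icc a b)
    have hz' := hζ'c.continuousOn (s := Icc a b)
    have hne2 : ∀ r ∈ Icc a b, r ^ 2 ≠ 0 := fun r hr => pow_ne_zero _ (hne r hr)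
    fun_prop (disch := assumption)
  rw [intervalIntegral.integral_sub hTi hgΦ'i, intervalIntegral.integral_sub (hHi.const_mul _)
    (hΨi.const_mul _), intervalIntegral.integral_const_mul, intervalIntegral.integral_const_mul,
    hΨ0, mul_zero, sub_zero, hparts, sub_neg_eq_add] at hmain
  rw [hmain] at hst'
  have hk0 : (0 : ℝ) < k := by exact_mod_cast hk
  exact nonneg_of_mul_nonneg_right hst' (by positivity)

end SemistableProfile

/-! ### Cut-offs, and the Hardy type inequality up to the origin. -/

theorem deriv_smoothTransition_eq_zero {t : ℝ} (ht : t < 0 ∨ 1 < t) :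
    deriv Real.smoothTransition t = 0 := by
  rcases ht with ht | ht
  · have : Real.smoothTransition =ᶠ[𝓝 t] fun _ => 0 := by
      filter_upwards [Iio_mem_nhds ht] with s hs
      exact Real.smoothTransition.zero_of_nonpos (le_of_lt hs)
    rw [this.deriv_eq, deriv_const]
  · have : Real.smoothTransition =ᶠ[𝓝 t] fun _ => 1 := by
      filter_upwards [Ioi_mem_nhds ht] with s hs
      exact Real.smoothTransition.one_of_one_le (le_of_lt hs)
    rw [this.deriv_eq, deriv_const]

theorem exists_abs_deriv_smoothTransition_le :
    ∃ K : ℝ, 0 ≤ K ∧ ∀ t, |deriv Real.smoothTransition t| ≤ K := by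
  have hc : Continuous (deriv Real.smoothTransition) :=
    (Real.smoothTransition.contDiff (n := 1)).continuous_deriv le_rfl
  obtain ⟨K, hK⟩ := (isCompact_Icc (a := (0 : ℝ)) (b := 1)).exists_bound_of_continuousOn
    hc.continuousOn
  refine ⟨K, (norm_nonneg _).trans (hK 0 (by simp)), fun t => ?_⟩
  by_cases ht : t ∈ Icc (0 : ℝ) 1
  · exact hK t ht
  · rw [deriv_smoothTransition_eq_zero (by rwa [mem_Icc, not_and_or, not_le, not_le] at ht),
      abs_zero]
    exact (norm_nonneg _).trans (hK 0 (by simp))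

theorem smoothTransition_hasDerivAt (t : ℝ) :
    HasDerivAt Real.smoothTransition (deriv Real.smoothTransition t) t :=
  ((Real.smoothTransition.contDiff (n := 1)).differentiable one_ne_zero t).hasDerivAt

/-- In the variables y/r and z the form has constant coefficients. -/
theorem abs_hardyForm_le (n k : ℕ) {y z r M : ℝ} (hr : 0 < r) (hy : |y| ≤ M * r) (hz : |z| ≤ M) :
    |hardyForm n k y z r| ≤
      (1 + 2 * |((k : ℝ) - 1) / (k + 1)| + |(2 * (n : ℝ) - k - 1) / (k + 1)|) * M ^ 2 := by
  have hy' : |y / r| ≤ M := by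
    rwa [abs_div, abs_of_pos hr, div_le_iff₀ hr]
  have h1 : z ^ 2 ≤ M ^ 2 := by rw [← sq_abs]; gcongr
  have h2 : (y / r) ^ 2 ≤ M ^ 2 := by rw [← sq_abs]; gcongr
  have h3 : |y / r * z| ≤ M ^ 2 := by
    rw [abs_mul, sq]
    exact mul_le_mul hy' hz (abs_nonneg _) ((abs_nonneg _).trans hy')
  have e : hardyForm n k y z r = z ^ 2 + 2 * ((k - 1) / (k + 1)) * (y / r * z) -
      (2 * n - k - 1) / (k + 1) * (y / r) ^ 2 := by
    unfold hardyForm; rw [div_pow]; ring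
  rw [e]
  set b := ((k : ℝ) - 1) / (k + 1)
  set d := (2 * (n : ℝ) - k - 1) / (k + 1)
  calc _ ≤ |z ^ 2| + |2 * b * (y / r * z)| + |d * (y / r) ^ 2| := by
        refine (abs_sub _ _).trans ?_
        gcongr
        exact abs_add_le _ _
    _ ≤ M ^ 2 + 2 * |b| * M ^ 2 + |d| * M ^ 2 := by
        rw [abs_mul (2 * b), abs_mul 2, abs_mul d, abs_of_nonneg (sq_nonneg z),
          abs_of_nonneg (sq_nonneg (y / r)), abs_two]
        gcongr
    _ = _ := by ring

namespace SemistableProfile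

variable {n k : ℕ} {c : ℝ} {g v p : ℝ → ℝ}

theorem integrableOn_weight (h : SemistableProfile n k c g v p)
    (hp : ∀ r ∈ Ioo (0 : ℝ) 1, 0 < p r) :
    IntegrableOn (fun r => r ^ (n - k) * p r ^ (k + 1)) (Ioo 0 1) :=
  h.energy.congr_fun (fun r hr => by
    simp only
    rw [abs_of_pos (hp r hr)]) measurableSet_Ioo

theorem continuousOn_hardyForm (h : SemistableProfile n k c g v p) {ζ : ℝ → ℝ}
    (hζ : ContDiffOn ℝ 1 ζ (Ioi 0)) :
    ContinuousOn (fun r => r ^ (n - k) * p r ^ (k + 1) * hardyForm n k (ζ r) (deriv ζ r) r)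
      (Ioo 0 1) := by
  have hpc := h.continuousOn
  have hz : ContinuousOn ζ (Ioo 0 1) := hζ.continuousOn.mono Ioo_subset_Ioi_self
  have hz' : ContinuousOn (deriv ζ) (Ioo 0 1) :=
    (hζ.continuousOn_deriv_of_isOpen isOpen_Ioi le_rfl).mono Ioo_subset_Ioi_self
  have hne : ∀ r ∈ Ioo (0 : ℝ) 1, r ≠ 0 := fun r hr => hr.1.ne'
  have hne2 : ∀ r ∈ Ioo (0 : ℝ) 1, r ^ 2 ≠ 0 := fun r hr => pow_ne_zero _ hr.1.ne'
  unfold hardyForm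
  fun_prop (disch := assumption)

theorem integrableOn_hardyForm (h : SemistableProfile n k c g v p)
    (hp : ∀ r ∈ Ioo (0 : ℝ) 1, 0 < p r) {ζ : ℝ → ℝ} (hζ : ContDiffOn ℝ 1 ζ (Ioi 0)) {M : ℝ}
    (hM : ∀ r ∈ Ioo (0 : ℝ) 1, |ζ r| ≤ M * r ∧ |deriv ζ r| ≤ M) :
    IntegrableOn (fun r => r ^ (n - k) * p r ^ (k + 1) * hardyForm n k (ζ r) (deriv ζ r) r)
      (Ioo 0 1) := by
  refine Integrable.mono' ((h.integrableOn_weight hp).mul_const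
    ((1 + 2 * |((k : ℝ) - 1) / (k + 1)| + |(2 * (n : ℝ) - k - 1) / (k + 1)|) * M ^ 2))
    ((h.continuousOn_hardyForm hζ).aestronglyMeasurable measurableSet_Ioo) ?_
  refine (ae_restrict_mem measurableSet_Ioo).mono fun r hr => ?_
  have hw : 0 ≤ r ^ (n - k) * p r ^ (k + 1) :=
    mul_nonneg (pow_nonneg hr.1.le _) (pow_nonneg (hp r hr).le _)
  rw [norm_mul, Real.norm_of_nonneg hw, Real.norm_eq_abs]
  exact mul_le_mul_of_nonneg_left (abs_hardyForm_le n k hr.1 (hM r hr).1 (hM r hr).2) hw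

/-- The Hardy type inequality for test functions that are only `O(r)` at the origin. -/
theorem hardy_of_le (h : SemistableProfile n k c g v p) (hk : 1 ≤ k) (hkn : k ≤ n) (hc : 0 < c)
    (hp : ∀ r ∈ Ioo (0 : ℝ) 1, 0 < p r) {ζ : ℝ → ℝ} (hζ : ContDiffOn ℝ 1 ζ (Ioi 0))
    (hζ1 : ∀ r ≥ 3 / 4, ζ r = 0) {M : ℝ}
    (hM : ∀ r ∈ Ioo (0 : ℝ) 1, |ζ r| ≤ M * r ∧ |deriv ζ r| ≤ M) :
    0 ≤ ∫ r in Ioo (0 : ℝ) 1,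
      r ^ (n - k) * p r ^ (k + 1) * hardyForm n k (ζ r) (deriv ζ r) r := by
  obtain ⟨K, hK0, hK⟩ := exists_abs_deriv_smoothTransition_le
  have hM0 : 0 ≤ M := (abs_nonneg _).trans (hM (1 / 2) (by norm_num)).2
  -- Vanishes for r ≤ 1/(N+1) and equals 1 for r ≥ 2/(N+1).
  set χ : ℕ → ℝ → ℝ := fun N r => Real.smoothTransition ((N + 1) * r - 1)
  have hχC : ∀ N, ContDiff ℝ 1 (χ N) := fun N =>
    (Real.smoothTransition.contDiff (n := 1)).comp ((contDiff_const.mul contDiff_id).sub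
      contDiff_const)
  have hχd : ∀ N r, HasDerivAt (χ N)
      (deriv Real.smoothTransition ((N + 1) * r - 1) * (N + 1)) r := by
    intro N r
    have h1 : HasDerivAt (fun r : ℝ => ((N : ℝ) + 1) * r - 1) (N + 1) r := by
      simpa using ((hasDerivAt_id r).const_mul ((N : ℝ) + 1)).sub_const 1
    exact (smoothTransition_hasDerivAt _).comp r h1
  have hζd : ∀ r ∈ Ioo (0 : ℝ) 1, HasDerivAt ζ (deriv ζ r) r := fun r hr =>
    ((hζ.contDiffAt (Ioi_mem_nhds hr.1)).differentiableAt one_ne_zero).hasDerivAt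
  set Z : ℕ → ℝ → ℝ := fun N r => ζ r * χ N r
  have hχs : ∀ N, tsupport (χ N) ⊆ Ici ((N + 1 : ℝ)⁻¹) := by
    intro N
    refine closure_minimal (fun r hr => ?_) isClosed_Ici
    by_contra h0
    rw [mem_Ici, not_le] at h0
    refine hr (Real.smoothTransition.zero_of_nonpos ?_)
    have hN : (0 : ℝ) < N + 1 := by positivity
    have := (mul_lt_mul_of_pos_left h0 hN)
    rw [mul_inv_cancel₀ hN.ne'] at this
    linarith
  have hZC : ∀ N, ContDiff ℝ 1 (Z N) := fun N =>
    contDiff_mul_of_tsupport_subset isOpen_Ioi hζ (hχC N) fun r hr =>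
      (by positivity : (0 : ℝ) < (N + 1 : ℝ)⁻¹).trans_le (hχs N hr)
  have hZs : ∀ N, tsupport (Z N) ⊆ Icc ((N + 1 : ℝ)⁻¹) (3 / 4) := by
    intro N
    refine closure_minimal (fun r hr => ?_) isClosed_Icc
    have h1 : ζ r ≠ 0 := left_ne_zero_of_mul hr
    have h2 : χ N r ≠ 0 := right_ne_zero_of_mul hr
    refine ⟨hχs N (subset_closure h2), ?_⟩
    by_contra! h0
    exact h1 (hζ1 r h0.le)
  have hZd : ∀ N, ∀ r ∈ Ioo (0 : ℝ) 1, deriv (Z N) r = deriv ζ r * χ N r +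
      ζ r * (deriv Real.smoothTransition ((N + 1) * r - 1) * (N + 1)) := fun N r hr =>
    ((hζd r hr).mul (hχd N r)).deriv
  have hχ1 : ∀ N r, |χ N r| ≤ 1 := fun N r => by
    rw [abs_of_nonneg (Real.smoothTransition.nonneg _)]
    exact Real.smoothTransition.le_one _
  have hZb : ∀ N, ∀ r ∈ Ioo (0 : ℝ) 1, |Z N r| ≤ (M + M * (2 * K)) * r ∧
      |deriv (Z N) r| ≤ M + M * (2 * K) := by
    intro N r hr
    obtain ⟨h1, h2⟩ := hM r hr
    constructor
    · rw [abs_mul]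
      calc |ζ r| * |χ N r| ≤ (M * r) * 1 :=
            mul_le_mul h1 (hχ1 N r) (abs_nonneg _) (mul_nonneg hM0 hr.1.le)
        _ ≤ _ := by
          have : 0 ≤ M * (2 * K) * r := by have := hr.1.le; positivity
          linarith
    · rw [hZd N r hr]
      refine (abs_add_le _ _).trans (add_le_add ?_ ?_)
      · rw [abs_mul]
        calc |deriv ζ r| * |χ N r| ≤ M * 1 := mul_le_mul h2 (hχ1 N r) (abs_nonneg _) hM0
          _ = M := mul_one M
      · rw [abs_mul, abs_mul, abs_of_pos (by positivity : (0 : ℝ) < N + 1)]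
        -- Where the derivative of the cut-off is nonzero, (N+1) r ≤ 2, so its factor N + 1 is
        -- absorbed by |ζ| ≤ M r. The bound is uniform in N, and the finite energy then allows
        -- dominated convergence.
        by_cases ht : 1 < ((N : ℝ) + 1) * r - 1
        · rw [deriv_smoothTransition_eq_zero (Or.inr ht)]
          simp only [abs_zero, zero_mul, mul_zero]
          positivity
        · have h3 : ((N : ℝ) + 1) * r ≤ 2 := by linarith
          have hMr : 0 ≤ M * r := mul_nonneg hM0 hr.1.le
          calc |ζ r| * (|deriv Real.smoothTransition ((N + 1) * r - 1)| * (N + 1))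
              ≤ (M * r) * (K * (N + 1)) := by
                gcongr
                exact hK _
            _ = M * K * ((N + 1) * r) := by ring
            _ ≤ M * K * 2 := by gcongr
            _ = _ := by ring
  have hlim : Tendsto (fun N => ∫ r in Ioo (0 : ℝ) 1,
      r ^ (n - k) * p r ^ (k + 1) * hardyForm n k (Z N r) (deriv (Z N) r) r) atTop
      (𝓝 (∫ r in Ioo (0 : ℝ) 1,
        r ^ (n - k) * p r ^ (k + 1) * hardyForm n k (ζ r) (deriv ζ r) r)) := by
    refine tendsto_integral_of_dominated_convergence _
      (fun N => (h.continuousOn_hardyForm (hZC N).contDiffOn).aestronglyMeasurable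
        measurableSet_Ioo) ((h.integrableOn_weight hp).mul_const
          ((1 + 2 * |((k : ℝ) - 1) / (k + 1)| + |(2 * (n : ℝ) - k - 1) / (k + 1)|) *
            (M + M * (2 * K)) ^ 2)) ?_ ?_
    · intro N
      refine (ae_restrict_mem measurableSet_Ioo).mono fun r hr => ?_
      have hw : 0 ≤ r ^ (n - k) * p r ^ (k + 1) :=
        mul_nonneg (pow_nonneg hr.1.le _) (pow_nonneg (hp r hr).le _)
      rw [norm_mul, Real.norm_of_nonneg hw, Real.norm_eq_abs]
      exact mul_le_mul_of_nonneg_left (abs_hardyForm_le n k hr.1 (hZb N r hr).1 (hZb N r hr).2) hw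
    · refine (ae_restrict_mem measurableSet_Ioo).mono fun r hr => ?_
      refine tendsto_const_nhds.congr' ?_
      obtain ⟨N₀, hN₀⟩ := exists_nat_gt (2 / r)
      filter_upwards [eventually_ge_atTop N₀] with N hN
      have h1 : 2 / r < (N : ℝ) + 1 := hN₀.trans_le (by
        have : (N₀ : ℝ) ≤ N := by exact_mod_cast hN
        linarith)
      rw [div_lt_iff₀ hr.1] at h1
      have h2 : 1 < ((N : ℝ) + 1) * r - 1 := by linarith
      have h3 : χ N r = 1 := Real.smoothTransition.one_of_one_le h2.le
      rw [hZd N r hr, deriv_smoothTransition_eq_zero (Or.inr h2)]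
      simp [Z, h3]
  refine ge_of_tendsto' hlim fun N => ?_
  have hsub : Icc ((N + 1 : ℝ)⁻¹) (3 / 4) ⊆ Ioo (0 : ℝ) 1 := fun r hr =>
    ⟨(by positivity : (0 : ℝ) < (N + 1 : ℝ)⁻¹).trans_le hr.1, hr.2.trans_lt (by norm_num)⟩
  exact h.hardy hk hkn hc hp (hZC N)
    (isCompact_Icc.of_isClosed_subset (isClosed_tsupport _) (hZs N)) ((hZs N).trans hsub)

end SemistableProfile

/-! ### The critical power, and the choice of test function. -/

/-- The positive number `β` for which the quadratic form in the Hardy type inequality vanishes on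
`r ^ (-β)`. -/
def hardyExponent (n k : ℕ) : ℝ :=
  ((k : ℝ) - 1 + Real.sqrt (2 * ((k : ℝ) + 1) * n - 4 * k)) / (k + 1)

theorem hardyExponent_sq {n k : ℕ} (hkn : k ≤ n) :
    hardyExponent n k ^ 2 - 2 * (((k : ℝ) - 1) / (k + 1)) * hardyExponent n k -
      (2 * n - k - 1) / (k + 1) = 0 := by
  unfold hardyExponent
  have h0 : (0 : ℝ) ≤ 2 * ((k : ℝ) + 1) * n - 4 * k := by
    rcases Nat.eq_zero_or_pos k with rfl | hk
    · simp
    · have h1 : (1 : ℝ) ≤ k := by exact_mod_cast hk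
      have h2 : (k : ℝ) ≤ n := by exact_mod_cast hkn
      nlinarith
  have hs := Real.sq_sqrt h0
  set s := Real.sqrt (2 * ((k : ℝ) + 1) * n - 4 * k)
  have hk : (k : ℝ) + 1 ≠ 0 := by positivity
  field_simp
  linear_combination hs

/-- The inequality amounts to a square root being at least 2k, which is n ≥ 2k. This is the origin
of that restriction in the Hardy argument. -/
theorem le_hardyExponent {n k : ℕ} (hkn : 2 * k ≤ n) :
    1 + 2 * (((k : ℝ) - 1) / (k + 1)) ≤ hardyExponent n k := by
  unfold hardyExponent
  have h2 : 2 * (k : ℝ) ≤ n := by exact_mod_cast hkn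
  have hk0 : (0 : ℝ) ≤ k := by positivity
  have hs : 2 * (k : ℝ) ≤ Real.sqrt (2 * ((k : ℝ) + 1) * n - 4 * k) := by
    apply Real.le_sqrt_of_sq_le
    nlinarith
  have e : 1 + 2 * (((k : ℝ) - 1) / (k + 1)) = (3 * k - 1) / (k + 1) := by
    field_simp; ring
  rw [e]
  gcongr
  linarith

/-- Here X stands for (r + r₀)^{-1-β} and τ for r/(r + r₀): the test function r X is linear at the
origin and behaves like r^{-β} for r much larger than r₀. Because β is a root of the form, a factor
1 - τ splits off, and `le_hardyExponent` bounds the cofactor 1 - β + 2b - (1 + β) τ by -(1 + β) τ.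
-/
theorem hardyForm_le {n k : ℕ} (hkn : 2 * k ≤ n) {r X τ : ℝ} (hr : r ≠ 0)
    (h1 : τ ≤ 1) (hβ : 0 ≤ hardyExponent n k) :
    hardyForm n k (r * X) (X * (1 - (1 + hardyExponent n k) * τ)) r ≤
      -((1 + hardyExponent n k) ^ 2 * (τ * (1 - τ)) * X ^ 2) := by
  have hsq := hardyExponent_sq (n := n) (k := k) (by omega)
  have hle := le_hardyExponent hkn
  unfold hardyForm
  set β := hardyExponent n k
  set b := ((k : ℝ) - 1) / (k + 1)
  set d := (2 * (n : ℝ) - k - 1) / (k + 1)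
  have e : (X * (1 - (1 + β) * τ)) ^ 2 + 2 * b * (r * X * (X * (1 - (1 + β) * τ)) / r) -
      d * ((r * X) ^ 2 / r ^ 2) =
      X ^ 2 * ((1 + β) * (1 - τ) * (1 - β + 2 * b - (1 + β) * τ) + (β ^ 2 - 2 * b * β - d)) := by
    field_simp
    ring
  rw [e, hsq, add_zero]
  have h3 : (1 + β) * (1 - τ) * (1 - β + 2 * b - (1 + β) * τ) ≤
      (1 + β) * (1 - τ) * (-((1 + β) * τ)) :=
    mul_le_mul_of_nonneg_left (by linarith) (mul_nonneg (by linarith) (by linarith))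
  nlinarith [mul_le_mul_of_nonneg_left h3 (sq_nonneg X)]

theorem hasDerivAt_mul_add_rpow {r r₀ β : ℝ} (hr : 0 < r) (hr₀ : 0 < r₀) :
    HasDerivAt (fun r : ℝ => r * (r + r₀) ^ (-1 - β))
      ((r + r₀) ^ (-1 - β) * (1 - (1 + β) * (r / (r + r₀)))) r := by
  have hpos : 0 < r + r₀ := by positivity
  have h1 : HasDerivAt (fun r : ℝ => (r + r₀) ^ (-1 - β))
      (1 * (-1 - β) * (r + r₀) ^ (-1 - β - 1)) r :=
    ((hasDerivAt_id r).add_const r₀).rpow_const (Or.inl hpos.ne')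
  refine ((hasDerivAt_id r).fun_mul h1).congr_deriv ?_
  rw [Real.rpow_sub_one hpos.ne']
  simp only [id]
  field_simp
  ring

namespace SemistableProfile

variable {c : ℝ} {g v p : ℝ → ℝ}

/-- The monotone flux gives p^k ≤ 2^{n-k} q^k; the cruder factor 2^n spares a k-th root. -/
theorem deriv_le_of_half_le {n k : ℕ} {q r : ℝ} (h : SemistableProfile n k c g v p)
    (hk : 1 ≤ k) (hc : 0 < c)
    (hq : Tendsto p (𝓝[<] 1) (𝓝 q)) (hr : r ∈ Ico (1 / 2 : ℝ) 1) : p r ≤ 2 ^ n * q := by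
  have hr0 : 0 < r := lt_of_lt_of_le (by norm_num) hr.1
  have hq0 := h.boundary_deriv_nonneg hk hc hq
  have h1 := h.pow_mul_deriv_pow_le_boundary hc hq ⟨hr0, hr.2⟩
  have hp0 := h.deriv_nonneg hk hc ⟨hr0, hr.2⟩
  have h2 : (1 / 2 : ℝ) ^ (n - k) * p r ^ k ≤ q ^ k :=
    (mul_le_mul_of_nonneg_right (pow_le_pow_left₀ (by norm_num) hr.1 _)
      (pow_nonneg hp0 _)).trans h1
  have h3 : p r ^ k ≤ (2 ^ n * q) ^ k := by
    have h4 : p r ^ k ≤ 2 ^ (n - k) * q ^ k := by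
      have := mul_le_mul_of_nonneg_left h2 (by positivity : (0 : ℝ) ≤ 2 ^ (n - k))
      rwa [← mul_assoc, ← mul_pow, mul_one_div_cancel two_ne_zero, one_pow, one_mul] at this
    refine h4.trans ?_
    rw [mul_pow, ← pow_mul]
    have : n - k ≤ n * k := (Nat.sub_le n k).trans (Nat.le_mul_of_pos_right n hk)
    have h5 : (2 : ℝ) ^ (n - k) ≤ 2 ^ (n * k) := pow_le_pow_right₀ (by norm_num) this
    exact mul_le_mul_of_nonneg_right h5 (pow_nonneg hq0 _)
  exact le_of_pow_le_pow_left₀ (by omega) (by positivity) h3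

/-- The Hardy type inequality tested with `r (r + r₀) ^ (-1 - β)`. -/
theorem exists_deriv_pow_mul_le {n k : ℕ} (hk : 1 ≤ k) (hkn : 2 * k ≤ n) :
    ∃ C : ℝ, 0 < C ∧ ∀ (c : ℝ) (g v p : ℝ → ℝ) (q : ℝ), 0 < c → SemistableProfile n k c g v p →
      (∀ r ∈ Ioo (0 : ℝ) 1, 0 < p r) → Tendsto p (𝓝[<] 1) (𝓝 q) → ∀ r₀ ∈ Ioc (0 : ℝ) (1 / 2),
        p r₀ ^ (k + 1) * (r₀ ^ (n - k) * r₀ * (r₀ ^ (-1 - hardyExponent n k)) ^ 2) ≤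
          C * q ^ (k + 1) := by
  obtain ⟨K, hK0, hK⟩ := exists_abs_deriv_smoothTransition_le
  have hkn' : k ≤ n := by omega
  have hk1 : (1 : ℝ) ≤ k := by exact_mod_cast hk
  have hβ : 0 ≤ hardyExponent n k := by
    have := le_hardyExponent hkn
    have h2 : 0 ≤ ((k : ℝ) - 1) / (k + 1) := div_nonneg (by linarith) (by positivity)
    linarith
  set β := hardyExponent n k with hβdef
  set B : ℝ := 1 + 2 * |((k : ℝ) - 1) / (k + 1)| + |(2 * (n : ℝ) - k - 1) / (k + 1)|
  have hB : 0 < B := by positivity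
  -- Bounds |ζ|/r and |ζ'| on [1/2, 1), where X ≤ (1/2)^{-1-β}; the term 4K comes from the cut-off,
  -- whose argument has slope -4. It does not depend on r₀.
  set M₁ : ℝ := (1 / 2) ^ (-1 - β) * (2 + β + 4 * K)
  have hM₁ : 0 < M₁ := by positivity
  -- The factors come, in order, from r ≥ r₀/2 in the weight; from p r ≥ p r₀ / 2, as p/r is
  -- nonincreasing; from the bound for the form with τ (1 - τ) ≥ 1/8; from X r ≥ (2 r₀)^{-1-β}; and
  -- from the length r₀/2 of the interval (r₀/2, r₀).
  set κ : ℝ := (1 / 2) ^ (n - k) * (1 / 2) ^ (k + 1) * ((1 + β) ^ 2 * (1 / 8)) *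
    (2 ^ (-1 - β)) ^ 2 * (1 / 2)
  have hκ : 0 < κ := by positivity
  refine ⟨(2 ^ n) ^ (k + 1) * (B * M₁ ^ 2) / κ, by positivity, ?_⟩
  intro c g v p q hc h hp hq r₀ hr₀
  have hr₀0 := hr₀.1
  have hq0 := h.boundary_deriv_nonneg hk hc hq
  set X : ℝ → ℝ := fun r => (r + r₀) ^ (-1 - β)
  -- Equals 1 for r ≤ 1/2 and vanishes for r ≥ 3/4.
  set χ : ℝ → ℝ := fun r => Real.smoothTransition (3 - 4 * r)
  set ζ₀ : ℝ → ℝ := fun r => r * X r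
  set ζ : ℝ → ℝ := fun r => ζ₀ r * χ r
  have hζ₀d : ∀ r > 0, HasDerivAt ζ₀ (X r * (1 - (1 + β) * (r / (r + r₀)))) r := fun r hr =>
    hasDerivAt_mul_add_rpow hr hr₀0
  have hχd : ∀ r, HasDerivAt χ (deriv Real.smoothTransition (3 - 4 * r) * (-4)) r := by
    intro r
    have h1 : HasDerivAt (fun r : ℝ => 3 - 4 * r) (-4) r := by
      simpa using ((hasDerivAt_id r).const_mul (4 : ℝ)).const_sub 3
    exact (smoothTransition_hasDerivAt _).comp r h1
  have hζd : ∀ r > 0, HasDerivAt ζ (X r * (1 - (1 + β) * (r / (r + r₀))) * χ r +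
      ζ₀ r * (deriv Real.smoothTransition (3 - 4 * r) * (-4))) r := fun r hr =>
    (hζ₀d r hr).fun_mul (hχd r)
  have hζC : ContDiffOn ℝ 1 ζ (Ioi 0) := by
    have h1 : ContDiffOn ℝ 1 X (Ioi 0) :=
      ContDiffOn.rpow_const_of_ne (contDiff_id.add contDiff_const).contDiffOn
        fun r (hr : 0 < r) => (by positivity : r + r₀ ≠ 0)
    have h2 : ContDiff ℝ 1 χ := (Real.smoothTransition.contDiff (n := 1)).comp
      (contDiff_const.sub (contDiff_const.mul contDiff_id))
    exact (contDiffOn_id.mul h1).mul h2.contDiffOn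
  have hζ1 : ∀ r ≥ 3 / 4, ζ r = 0 := fun r hr => by
    have : χ r = 0 := Real.smoothTransition.zero_of_nonpos (by linarith)
    simp [ζ, this]
  have hχ1 : ∀ r, |χ r| ≤ 1 := fun r => by
    rw [abs_of_nonneg (Real.smoothTransition.nonneg _)]
    exact Real.smoothTransition.le_one _
  have hXpos : ∀ r > 0, 0 < X r := fun r hr => Real.rpow_pos_of_pos (by linarith) _
  have hXle : ∀ a > 0, ∀ r > 0, a ≤ r + r₀ → X r ≤ a ^ (-1 - β) := fun a ha r hr har =>
    Real.rpow_le_rpow_of_nonpos ha har (by linarith)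
  have hτ : ∀ r > 0, 0 ≤ r / (r + r₀) ∧ r / (r + r₀) ≤ 1 := fun r hr =>
    ⟨by positivity, (div_le_one (by positivity)).2 (by linarith)⟩
  have hθ : ∀ r > 0, |1 - (1 + β) * (r / (r + r₀))| ≤ 1 + β := by
    intro r hr
    obtain ⟨h1, h2⟩ := hτ r hr
    rw [abs_le]
    constructor <;> nlinarith
  have hbound : ∀ r ∈ Ioo (0 : ℝ) 1, ∀ Y, X r ≤ Y → |ζ r| ≤ Y * r ∧
      |deriv ζ r| ≤ Y * (1 + β + 4 * K) := by
    intro r hr Y hY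
    have hr0 := hr.1
    have hX := hXpos r hr0
    have h0 : |ζ₀ r| ≤ Y * r := by
      rw [abs_of_pos (mul_pos hr0 hX), mul_comm]
      gcongr
    have h0' : |ζ₀ r| ≤ Y := h0.trans (by nlinarith [hr.2])
    constructor
    · rw [abs_mul]
      exact (mul_le_mul h0 (hχ1 r) (abs_nonneg _) ((abs_nonneg _).trans h0)).trans_eq (mul_one _)
    · rw [(hζd r hr0).deriv]
      refine (abs_add_le _ _).trans ?_
      rw [abs_mul (X r * _), abs_mul (X r), abs_mul (ζ₀ r), abs_mul (deriv _ _), abs_of_pos hX]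
      have h4 : |(-4 : ℝ)| = 4 := by norm_num
      rw [h4]
      calc X r * |1 - (1 + β) * (r / (r + r₀))| * |χ r| +
          |ζ₀ r| * (|deriv Real.smoothTransition (3 - 4 * r)| * 4) ≤
          Y * (1 + β) * 1 + Y * (K * 4) := by
            have := hθ r hr0
            have := hχ1 r
            have := hK (3 - 4 * r)
            have hY0 : 0 ≤ Y := hX.le.trans hY
            gcongr
        _ = _ := by ring
  -- This bound degenerates as r₀ tends to 0. It only gives admissibility and integrability; no
  -- constant is taken from it.
  have hMall : ∀ r ∈ Ioo (0 : ℝ) 1, |ζ r| ≤ r₀ ^ (-1 - β) * (1 + β + 4 * K) * r ∧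
      |deriv ζ r| ≤ r₀ ^ (-1 - β) * (1 + β + 4 * K) := by
    intro r hr
    obtain ⟨h1, h2⟩ := hbound r hr _ (hXle r₀ hr₀0 r hr.1 (by linarith [hr.1]))
    refine ⟨h1.trans ?_, h2⟩
    have h3 : 0 < r₀ ^ (-1 - β) := Real.rpow_pos_of_pos hr₀0 _
    refine mul_le_mul_of_nonneg_right ?_ hr.1.le
    nlinarith
  have hhardy := h.hardy_of_le hk hkn' hc hp hζC hζ1 hMall
  have hint := h.integrableOn_hardyForm hp hζC hMall
  set W : ℝ → ℝ := fun r => r ^ (n - k) * p r ^ (k + 1) * hardyForm n k (ζ r) (deriv ζ r) r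
  have hw : ∀ r ∈ Ioo (0 : ℝ) 1, 0 ≤ r ^ (n - k) * p r ^ (k + 1) := fun r hr =>
    mul_nonneg (pow_nonneg hr.1.le _) (pow_nonneg (hp r hr).le _)
  -- the inner region
  have hin : ∀ r ∈ Ioo (0 : ℝ) (1 / 2), hardyForm n k (ζ r) (deriv ζ r) r ≤
      -((1 + β) ^ 2 * (r / (r + r₀) * (1 - r / (r + r₀))) * X r ^ 2) := by
    intro r hr
    have h1 : 1 < 3 - 4 * r := by linarith [hr.2]
    have h2 : χ r = 1 := Real.smoothTransition.one_of_one_le h1.le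
    have h3 : ζ r = r * X r := by simp [ζ, ζ₀, h2]
    have h4 : deriv ζ r = X r * (1 - (1 + β) * (r / (r + r₀))) := by
      rw [(hζd r hr.1).deriv, h2, deriv_smoothTransition_eq_zero (Or.inr h1)]
      ring
    rw [h3, h4]
    exact hardyForm_le hkn hr.1.ne' (hτ r hr.1).2 hβ
  have hWin : ∀ r ∈ Ioo (0 : ℝ) (1 / 2), W r ≤ 0 := by
    intro r hr
    refine mul_nonpos_of_nonneg_of_nonpos (hw r ⟨hr.1, by linarith [hr.2]⟩) ((hin r hr).trans ?_)
    obtain ⟨h1, h2⟩ := hτ r hr.1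
    have : 0 ≤ r / (r + r₀) * (1 - r / (r + r₀)) := mul_nonneg h1 (by linarith)
    have : 0 ≤ (1 + β) ^ 2 * (r / (r + r₀) * (1 - r / (r + r₀))) * X r ^ 2 := by positivity
    linarith
  -- The integrand being nonpositive on (0, 1/2), it suffices to keep (r₀/2, r₀), where the weight
  -- is comparable to its value at r₀.
  have hWmid : ∀ r ∈ Ioo (r₀ / 2) r₀, W r ≤
      -((r₀ / 2) ^ (n - k) * (p r₀ / 2) ^ (k + 1) *
        ((1 + β) ^ 2 * (1 / 8) * ((2 * r₀) ^ (-1 - β)) ^ 2)) := by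
    intro r hr
    have hr0 : 0 < r := by linarith [hr.1]
    have hr1 : r ∈ Ioo (0 : ℝ) 1 := ⟨hr0, by linarith [hr.2, hr₀.2]⟩
    have hr2 : r ∈ Ioo (0 : ℝ) (1 / 2) := ⟨hr0, by linarith [hr.2, hr₀.2]⟩
    have h1 : (r₀ / 2) ^ (n - k) * (p r₀ / 2) ^ (k + 1) ≤ r ^ (n - k) * p r ^ (k + 1) := by
      have hpr : p r₀ / 2 ≤ p r := by
        have h3 := h.deriv_mul_le hk hkn' hc hr0 hr.2.le (by linarith [hr₀.2])
        have h4 := hp r₀ ⟨hr₀0, by linarith [hr₀.2]⟩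
        have h5 : p r₀ * (r₀ / 2) ≤ p r * r₀ :=
          (mul_le_mul_of_nonneg_left hr.1.le h4.le).trans h3
        refine le_of_mul_le_mul_right ?_ hr₀0
        linarith
      have h4 := hp r₀ ⟨hr₀0, by linarith [hr₀.2]⟩
      have := hr.1.le
      gcongr
    have h2 : (1 + β) ^ 2 * (1 / 8) * ((2 * r₀) ^ (-1 - β)) ^ 2 ≤
        (1 + β) ^ 2 * (r / (r + r₀) * (1 - r / (r + r₀))) * X r ^ 2 := by
      have h3 : (1 / 8 : ℝ) ≤ r / (r + r₀) * (1 - r / (r + r₀)) := by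
        have e : r / (r + r₀) * (1 - r / (r + r₀)) = r * r₀ / (r + r₀) ^ 2 := by
          field_simp; ring
        rw [e, le_div_iff₀ (by positivity)]
        nlinarith [hr.1, hr.2]
      have h4 : (2 * r₀) ^ (-1 - β) ≤ X r :=
        Real.rpow_le_rpow_of_nonpos (by positivity) (by linarith [hr.2]) (by linarith)
      gcongr
    have h5 := hin r hr2
    have h6 : W r ≤ r ^ (n - k) * p r ^ (k + 1) *
        -((1 + β) ^ 2 * (1 / 8) * ((2 * r₀) ^ (-1 - β)) ^ 2) :=
      mul_le_mul_of_nonneg_left (h5.trans (neg_le_neg h2)) (hw r hr1)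
    refine h6.trans ?_
    rw [mul_neg]
    refine neg_le_neg (mul_le_mul_of_nonneg_right h1 (by positivity))
  have hWout : ∀ r ∈ Ico (1 / 2 : ℝ) 1, W r ≤ (2 ^ n * q) ^ (k + 1) * (B * M₁ ^ 2) := by
    intro r hr
    have hr0 : 0 < r := lt_of_lt_of_le (by norm_num) hr.1
    have hr1 : r ∈ Ioo (0 : ℝ) 1 := ⟨hr0, hr.2⟩
    obtain ⟨h1, h2⟩ := hbound r hr1 ((1 / 2) ^ (-1 - β))
      (hXle _ (by norm_num) r hr0 (by linarith [hr.1]))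
    have hpos : (0 : ℝ) < (1 / 2) ^ (-1 - β) := by positivity
    have h3 : hardyForm n k (ζ r) (deriv ζ r) r ≤ B * M₁ ^ 2 := by
      refine (le_abs_self _).trans (abs_hardyForm_le n k hr0 (h1.trans ?_) (h2.trans ?_))
      · refine mul_le_mul_of_nonneg_right ?_ hr0.le
        simp only [M₁]
        nlinarith
      · simp only [M₁]
        gcongr
        norm_num
    have h4 : r ^ (n - k) * p r ^ (k + 1) ≤ (2 ^ n * q) ^ (k + 1) := by
      have h5 := h.deriv_le_of_half_le hk hc hq hr
      have h6 := (hp r hr1).le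
      calc r ^ (n - k) * p r ^ (k + 1) ≤ 1 * (2 ^ n * q) ^ (k + 1) := by
            have := pow_le_one₀ hr0.le hr.2.le (n := n - k)
            gcongr
        _ = _ := one_mul _
    exact (mul_le_mul_of_nonneg_left h3 (hw r hr1)).trans
      (mul_le_mul_of_nonneg_right h4 (by positivity))
  -- splitting the integral
  have hsplit : ∫ r in Ioo (0 : ℝ) 1, W r =
      (∫ r in Ioo (0 : ℝ) (1 / 2), W r) + ∫ r in Ico (1 / 2 : ℝ) 1, W r := by
    rw [← setIntegral_union _ measurableSet_Ico
      (hint.mono_set (Ioo_subset_Ioo_right (by norm_num)))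
      (hint.mono_set fun r hr => ⟨lt_of_lt_of_le (by norm_num) hr.1, hr.2⟩),
      Ioo_union_Ico_eq_Ioo (by norm_num) (by norm_num)]
    exact Set.disjoint_left.2 fun r h1 h2 => absurd h1.2 (not_lt.2 h2.1)
  have hfirst : ∫ r in Ioo (0 : ℝ) (1 / 2), W r ≤ (r₀ / 2) * -((r₀ / 2) ^ (n - k) *
      (p r₀ / 2) ^ (k + 1) * ((1 + β) ^ 2 * (1 / 8) * ((2 * r₀) ^ (-1 - β)) ^ 2)) := by
    have hsub : Ioo (r₀ / 2) r₀ ⊆ Ioo (0 : ℝ) (1 / 2) := fun r hr =>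
      ⟨by linarith [hr.1], by linarith [hr.2, hr₀.2]⟩
    have hi := hint.mono_set (Ioo_subset_Ioo_right (by norm_num : (1 / 2 : ℝ) ≤ 1))
    have h1 : ∫ r in Ioo (0 : ℝ) (1 / 2), W r ≤ ∫ r in Ioo (r₀ / 2) r₀, W r := by
      have := setIntegral_mono_set (f := fun r => - W r) hi.neg
        ((ae_restrict_mem measurableSet_Ioo).mono fun r hr => by
          simpa using hWin r hr) (LE.le.eventuallyLE hsub)
      rw [integral_neg, integral_neg] at this
      linarith
    refine h1.trans ?_
    have h2 := setIntegral_mono_on (hi.mono_set hsub)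
      (integrableOn_const (by simp)) measurableSet_Ioo hWmid
    rw [setIntegral_const, smul_eq_mul] at h2
    refine h2.trans_eq ?_
    congr 1
    rw [measureReal_def, Real.volume_Ioo, ENNReal.toReal_ofReal (by linarith)]
    ring
  have hsecond : ∫ r in Ico (1 / 2 : ℝ) 1, W r ≤ (2 ^ n * q) ^ (k + 1) * (B * M₁ ^ 2) := by
    have h2 := setIntegral_mono_on
      (hint.mono_set fun r hr => ⟨lt_of_lt_of_le (by norm_num) hr.1, hr.2⟩)
      (integrableOn_const (by simp)) measurableSet_Ico hWout
    rw [setIntegral_const, smul_eq_mul] at h2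
    refine h2.trans ?_
    rw [measureReal_def, Real.volume_Ico, ENNReal.toReal_ofReal (by norm_num)]
    have : 0 ≤ (2 ^ n * q) ^ (k + 1) * (B * M₁ ^ 2) := by positivity
    linarith
  have hfinal : κ * (p r₀ ^ (k + 1) * (r₀ ^ (n - k) * r₀ * (r₀ ^ (-1 - β)) ^ 2)) ≤
      (2 ^ n * q) ^ (k + 1) * (B * M₁ ^ 2) := by
    have e : (r₀ / 2) * ((r₀ / 2) ^ (n - k) *
      (p r₀ / 2) ^ (k + 1) * ((1 + β) ^ 2 * (1 / 8) * ((2 * r₀) ^ (-1 - β)) ^ 2)) =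
      κ * (p r₀ ^ (k + 1) * (r₀ ^ (n - k) * r₀ * (r₀ ^ (-1 - β)) ^ 2)) := by
      rw [Real.mul_rpow (by norm_num) hr₀0.le]
      simp only [κ, div_eq_mul_one_div r₀ 2, div_eq_mul_one_div (p r₀) 2, mul_pow]
      ring
    rw [mul_neg, e] at hfirst
    linarith
  rw [mul_pow] at hfinal
  rw [div_mul_eq_mul_div, le_div_iff₀ hκ]
  linarith

end SemistableProfile

/-! ### Arithmetic of δ, and elementary inequalities for powers. -/

/-- Solving p^{k+1} r^{n-k-1-2β} ≤ C q^{k+1} for p gives the power r^{δ-1}. -/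
theorem delta_sub_one_mul {n k : ℕ} (hkn : k ≤ n) :
    ((k : ℝ) + 1) * (delta n k - 1) = 2 * hardyExponent n k + 1 - ((n - k : ℕ) : ℝ) := by
  unfold delta hardyExponent
  rw [Nat.cast_sub hkn]
  have : (k : ℝ) + 1 ≠ 0 := by positivity
  field_simp
  ring

/-- In this dimension the radicand is the square of 2(k + 2). -/
theorem delta_eq_zero {n k : ℕ} (h : n = 2 * k + 8) : delta n k = 0 := by
  have hs : Real.sqrt (2 * ((k : ℝ) + 1) * n - 4 * k) = 2 * (k + 2) := by
    have e : 2 * ((k : ℝ) + 1) * n - 4 * k = (2 * (k + 2)) ^ 2 := by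
      rw [h]
      push_cast
      ring
    rw [e, Real.sqrt_sq (by positivity)]
  unfold delta
  rw [hs, h]
  push_cast
  rw [div_eq_zero_iff]
  left
  ring

/-- With N = (k+1)n, the sign of δ depends on comparing the square root with (N - 2k² - 6k)/2. The
difference of their squares is (N - 2k(k+1)) ((k+1)(2k+8) - N)/4, which for n > 2k changes sign
exactly at n = 2k + 8. At n = 2k it vanishes, but there the square root is compared with a negative
number. -/
theorem delta_pos {n k : ℕ} (hkn : 2 * k ≤ n) (h : n < 2 * k + 8) (hk : 1 ≤ k) :
    0 < delta n k := by
  unfold delta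
  refine div_pos ?_ (by positivity)
  have h1 : 2 * (k : ℝ) ≤ n := by exact_mod_cast hkn
  have h2 : (n : ℝ) < 2 * k + 8 := by exact_mod_cast h
  have hk1 : (1 : ℝ) ≤ k := by exact_mod_cast hk
  set N := ((k : ℝ) + 1) * n with hN
  have hN1 : 2 * (k : ℝ) * (k + 1) ≤ N := by nlinarith
  have hN2 : N < (k + 1) * (2 * k + 8) := by nlinarith
  have hlt : (N - 2 * (k : ℝ) ^ 2 - 6 * k) / 2 <
      Real.sqrt (2 * ((k : ℝ) + 1) * n - 4 * k) := by
    rcases hN1.eq_or_lt with h3 | h3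
    · refine lt_of_lt_of_le ?_ (Real.sqrt_nonneg _)
      rw [← h3]
      nlinarith
    · apply Real.lt_sqrt_of_sq_lt
      have e : 2 * ((k : ℝ) + 1) * n - 4 * k - ((N - 2 * (k : ℝ) ^ 2 - 6 * k) / 2) ^ 2 =
          (N - 2 * k * (k + 1)) * ((k + 1) * (2 * k + 8) - N) / 4 := by
        rw [hN]; ring
      have := mul_pos (sub_pos.2 h3) (sub_pos.2 hN2)
      linarith
  have e3 : -((k : ℝ) + 1) * n = -N := by rw [hN]; ring
  rw [e3]
  linarith

theorem delta_neg {n k : ℕ} (h : 2 * k + 8 < n) : delta n k < 0 := by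
  unfold delta
  refine div_neg_of_neg_of_pos ?_ (by positivity)
  have h2 : 2 * (k : ℝ) + 8 < n := by exact_mod_cast h
  have hk0 : (0 : ℝ) ≤ k := by positivity
  set N := ((k : ℝ) + 1) * n with hN
  have hN2 : (k + 1) * (2 * (k : ℝ) + 8) < N := by nlinarith
  have hlt : Real.sqrt (2 * ((k : ℝ) + 1) * n - 4 * k) <
      (N - 2 * (k : ℝ) ^ 2 - 6 * k) / 2 := by
    rw [Real.sqrt_lt' (by nlinarith)]
    have e : 2 * ((k : ℝ) + 1) * n - 4 * k - ((N - 2 * (k : ℝ) ^ 2 - 6 * k) / 2) ^ 2 =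
        -((N - 2 * k * (k + 1)) * (N - (k + 1) * (2 * k + 8)) / 4) := by
      rw [hN]; ring
    have := mul_pos (by nlinarith : 0 < N - 2 * (k : ℝ) * (k + 1)) (sub_pos.2 hN2)
    linarith
  have e3 : -((k : ℝ) + 1) * n = -N := by rw [hN]; ring
  rw [e3]
  linarith

/-- Bernoulli's inequality for α ≥ 1; for α ≤ 1 already r ≤ r^α. -/
theorem one_sub_rpow_le {r α : ℝ} (hr : r ∈ Ioc (0 : ℝ) 1) (hα : 0 < α) :
    1 - r ^ α ≤ (1 + α) * (1 - r) := by
  have h1 : 0 ≤ 1 - r := by linarith [hr.2]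
  rcases le_total 1 α with h | h
  · have := one_add_mul_self_le_rpow_one_add (s := r - 1) (by linarith [hr.1]) h
    rw [add_sub_cancel] at this
    nlinarith
  · have : r ^ (1 : ℝ) ≤ r ^ α := Real.rpow_le_rpow_of_exponent_ge hr.1 hr.2 h
    rw [Real.rpow_one] at this
    nlinarith

theorem one_le_two_rpow_mul_rpow {r : ℝ} (e : ℝ) (hr : r ∈ Icc (1 / 2 : ℝ) 1) :
    1 ≤ 2 ^ |e| * r ^ e := by
  have hr0 : 0 < r := lt_of_lt_of_le (by norm_num) hr.1
  calc (1 : ℝ) = 2 ^ |e| * (1 / 2) ^ |e| := by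
        rw [← Real.mul_rpow (by norm_num) (by norm_num)]; norm_num
    _ ≤ 2 ^ |e| * r ^ |e| := by
        gcongr
        exact hr.1
    _ ≤ 2 ^ |e| * r ^ e := by
        gcongr ?_ * ?_
        exact Real.rpow_le_rpow_of_exponent_ge hr0 hr.2 (le_abs_self e)

/-! ### Pointwise estimates for profiles. -/

namespace SemistableProfile

variable {n k : ℕ} {c : ℝ} {g v p : ℝ → ℝ}

theorem deriv_pos_of_boundary_pos {q : ℝ} (h : SemistableProfile n k c g v p) (hk : 1 ≤ k)
    (hkn : k ≤ n) (hc : 0 < c) (hq : Tendsto p (𝓝[<] 1) (𝓝 q)) (hq0 : 0 < q) :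
    ∀ r ∈ Ioo (0 : ℝ) 1, 0 < p r := fun _ hr =>
  (mul_pos hq0 hr.1).trans_le (h.mul_boundary_deriv_le hk hkn hc hq hr)

/-- The monotone flux, solved for p. The power is integrable at 0 exactly when n < 2k. -/
theorem deriv_le_rpow_of_lt {q : ℝ} (h : SemistableProfile n k c g v p) (hk : 1 ≤ k)
    (hkn : k ≤ n) (hc : 0 < c) (hq : Tendsto p (𝓝[<] 1) (𝓝 q)) {r : ℝ}
    (hr : r ∈ Ioo (0 : ℝ) 1) : p r ≤ q * r ^ (((2 * k - n : ℝ) / k) - 1) := by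
  have hq0 := h.boundary_deriv_nonneg hk hc hq
  have h1 := h.pow_mul_deriv_pow_le_boundary hc hq hr
  have hr0 := hr.1
  have hk0 : (k : ℝ) ≠ 0 := by positivity
  refine le_of_pow_le_pow_left₀ (n := k) (by omega) (by positivity) ?_
  have e : r ^ (n - k) * (r ^ (((2 * k - n : ℝ) / k) - 1)) ^ k = 1 := by
    rw [← Real.rpow_natCast, ← Real.rpow_natCast, ← Real.rpow_mul hr0.le, ← Real.rpow_add hr0,
      Nat.cast_sub hkn]
    have : (n : ℝ) - k + ((2 * k - n) / k - 1) * k = 0 := by field_simp; ring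
    rw [this, Real.rpow_zero]
  rw [mul_pow]
  have h2 := mul_le_mul_of_nonneg_right h1
    (by positivity : 0 ≤ (r ^ (((2 * k - n : ℝ) / k) - 1)) ^ k)
  calc p r ^ k = (r ^ (n - k) * (r ^ (((2 * k - n : ℝ) / k) - 1)) ^ k) * p r ^ k := by
        rw [e, one_mul]
    _ ≤ _ := by linarith

theorem exists_deriv_le_rpow_delta (hk : 1 ≤ k) (hkn : 2 * k ≤ n) :
    ∃ C : ℝ, 0 < C ∧ ∀ (c : ℝ) (g v p : ℝ → ℝ) (q : ℝ), 0 < c → SemistableProfile n k c g v p →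
      Tendsto p (𝓝[<] 1) (𝓝 q) → 0 < q → ∀ r ∈ Ioo (0 : ℝ) 1,
        p r ≤ C * q * r ^ (delta n k - 1) := by
  obtain ⟨C, hC, hmain⟩ := exists_deriv_pow_mul_le hk hkn
  have hkn' : k ≤ n := by omega
  -- For r ≤ 1/2 the number 1 + C dominates the (k+1)-th root of C; the second summand covers [1/2,
  -- 1), where p ≤ 2^n q.
  refine ⟨(1 + C) + 2 ^ n * 2 ^ |delta n k - 1|, by positivity, ?_⟩
  intro c g v p q hc h hq hq0 r hr
  have hr0 := hr.1
  have hp := h.deriv_pos_of_boundary_pos hk hkn' hc hq hq0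
  rcases le_total r (1 / 2) with hr2 | hr2
  · have h1 := hmain c g v p q hc h hp hq r ⟨hr0, hr2⟩
    have e : (r ^ (n - k) * r * (r ^ (-1 - hardyExponent n k)) ^ 2) *
        (r ^ (delta n k - 1)) ^ (k + 1) = 1 := by
      have e1 : r ^ (n - k) * r = r ^ (((n - k : ℕ) : ℝ) + 1) := by
        rw [Real.rpow_add hr0, Real.rpow_natCast, Real.rpow_one]
      rw [e1, ← Real.rpow_natCast _ 2, ← Real.rpow_natCast _ (k + 1), ← Real.rpow_mul hr0.le,
        ← Real.rpow_mul hr0.le, ← Real.rpow_add hr0, ← Real.rpow_add hr0]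
      have h3 := delta_sub_one_mul hkn'
      have : ((n - k : ℕ) : ℝ) + 1 + (-1 - hardyExponent n k) * ((2 : ℕ) : ℝ) +
          (delta n k - 1) * ((k + 1 : ℕ) : ℝ) = 0 := by
        push_cast at h3 ⊢
        linarith
      rw [this, Real.rpow_zero]
    have h2 : p r ^ (k + 1) ≤ C * (q * r ^ (delta n k - 1)) ^ (k + 1) := by
      have h4 := mul_le_mul_of_nonneg_right h1
        (by positivity : 0 ≤ (r ^ (delta n k - 1)) ^ (k + 1))
      rw [mul_assoc, e, mul_one] at h4
      rw [mul_pow]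
      linarith
    have h3 : p r ^ (k + 1) ≤ ((1 + C) * (q * r ^ (delta n k - 1))) ^ (k + 1) := by
      refine h2.trans ?_
      rw [mul_pow (1 + C)]
      refine mul_le_mul_of_nonneg_right ?_ (by positivity)
      have : (1 + C) ^ 1 ≤ (1 + C) ^ (k + 1) := pow_le_pow_right₀ (by linarith) (by omega)
      linarith
    have h4 := le_of_pow_le_pow_left₀ (by omega) (by positivity) h3
    have h5 : 0 ≤ 2 ^ n * 2 ^ |delta n k - 1| * q * r ^ (delta n k - 1) := by positivity
    linarith
  · have h1 := h.deriv_le_of_half_le hk hc hq ⟨hr2, hr.2⟩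
    have h2 := one_le_two_rpow_mul_rpow (delta n k - 1) ⟨hr2, hr.2.le⟩
    have h3 : 2 ^ n * q ≤ 2 ^ n * q * (2 ^ |delta n k - 1| * r ^ (delta n k - 1)) :=
      le_mul_of_one_le_right (by positivity) h2
    have h5 : 0 ≤ (1 + C) * q * r ^ (delta n k - 1) := by positivity
    linarith

/-- Merges the two regimes: for n < 2k the exponent comes from the flux, otherwise it is δ. Below
dimension 2k + 8 only its positivity is needed. -/
theorem exists_deriv_le_rpow (hk : 1 ≤ k) (hkn : k ≤ n) :
    ∃ C α : ℝ, 0 < C ∧ (n < 2 * k + 8 → 0 < α) ∧ (2 * k + 8 ≤ n → α = delta n k) ∧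
      ∀ (c : ℝ) (g v p : ℝ → ℝ) (q : ℝ), 0 < c → SemistableProfile n k c g v p →
      Tendsto p (𝓝[<] 1) (𝓝 q) → ∀ r ∈ Ioo (0 : ℝ) 1, p r ≤ C * q * r ^ (α - 1) := by
  have hk0 : (0 : ℝ) < k := by exact_mod_cast hk
  rcases lt_or_ge n (2 * k) with hlt | hge
  · refine ⟨1, (2 * k - n : ℝ) / k, one_pos, fun _ => div_pos ?_ hk0, fun h => by omega, ?_⟩
    · have : (n : ℝ) < 2 * k := by exact_mod_cast hlt
      linarith
    · intro c g v p q hc h hq r hr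
      rw [one_mul]
      exact h.deriv_le_rpow_of_lt hk hkn hc hq hr
  · obtain ⟨C, hC, hmain⟩ := exists_deriv_le_rpow_delta hk hge
    refine ⟨C, delta n k, hC, fun h => delta_pos hge h hk, fun _ => rfl, ?_⟩
    intro c g v p q hc h hq r hr
    -- The Hardy argument needs p > 0, which follows from q > 0. If q = 0, the monotone flux forces
    -- p = 0 throughout.
    rcases (h.boundary_deriv_nonneg hk hc hq).eq_or_lt with h0 | h0
    · have h1 := h.pow_mul_deriv_pow_le_boundary hc hq hr
      rw [← h0, zero_pow (by omega)] at h1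
      have h2 : p r ^ k ≤ 0 := by
        by_contra! h3
        exact absurd h1 (not_le.2 (mul_pos (pow_pos hr.1 _) h3))
      have h3 : p r = 0 :=
        pow_eq_zero_iff (by omega) |>.1 (le_antisymm h2 (pow_nonneg (h.deriv_nonneg hk hc hr) _))
      rw [h3, ← h0]
      simp
    · exact hmain c g v p q hc h hq h0 r hr

/-- The pointwise estimates for a semistable radial profile, with a constant that depends only on
`n` and `k`. -/
theorem exists_estimate (hk : 1 ≤ k) (hkn : k ≤ n) :
    ∃ D : ℝ, 0 < D ∧ ∀ (c : ℝ) (g v p : ℝ → ℝ), 0 < c → SemistableProfile n k c g v p →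
      ∃ (V : ℝ → ℝ) (m : ℝ), (∀ r ∈ Ioo (0 : ℝ) 1, V r = v r) ∧ ContDiffOn ℝ 1 V (Ioc 0 1) ∧
        IsLeast ((fun t => derivWithin V (Ioc 0 1) t) '' Icc (1 / 2) 1) m ∧
        (n < 2 * k + 8 → ∀ r ∈ Ioc (0 : ℝ) 1, |V r - V 1| ≤ D * m * (1 - r)) ∧
        (n = 2 * k + 8 → ∀ r ∈ Ioc (0 : ℝ) 1, |V r - V 1| ≤ D * m * |Real.log r|) ∧
        (2 * k + 8 < n → ∀ r ∈ Ioc (0 : ℝ) 1,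
          |V r - V 1| ≤ D * m * (r ^ delta n k - 1)) := by
  obtain ⟨C, α, hC, hα1, hα2, hmain⟩ := exists_deriv_le_rpow hk hkn
  -- The factor 2C combines p ≤ C q r^{α-1} with q ≤ 2m, and the bracket absorbs the 1/|α| from
  -- integrating s^{α-1}. In the logarithmic case α = 0, division by zero yields 0 and the bracket
  -- is 1.
  set D : ℝ := 2 * C * (1 + (1 + |α|) / |α|)
  have hD : 0 < D := by positivity
  refine ⟨D, hD, ?_⟩
  intro c g v p hc h
  obtain ⟨V, P, hext, hV, hP⟩ := h.exists_extension hk hc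
  have hq : Tendsto p (𝓝[<] 1) (𝓝 (P 1)) := by
    have h1 : Tendsto P (𝓝[<] 1) (𝓝 (P 1)) :=
      (hP.continuousAt (Ioi_mem_nhds one_pos)).mono_left nhdsWithin_le_nhds
    refine h1.congr' ?_
    filter_upwards [eventually_Ioo_left zero_lt_one] with t ht
    exact (hext t ht).2
  have hq0 := h.boundary_deriv_nonneg hk hc hq
  have hP0 : ∀ r ∈ Ioc (0 : ℝ) 1, 0 ≤ P r := by
    intro r hr
    rcases hr.2.eq_or_lt with rfl | h1
    · exact hq0
    · rw [(hext r ⟨hr.1, h1⟩).2]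
      exact h.deriv_nonneg hk hc ⟨hr.1, h1⟩
  have hVC : ContDiffOn ℝ 1 V (Ioc 0 1) :=
    (contDiffOn_one_of_hasDerivAt isOpen_Ioi hV hP).mono Ioc_subset_Ioi_self
  have hVd : ∀ t ∈ Icc (1 / 2 : ℝ) 1, derivWithin V (Ioc 0 1) t = P t := fun t ht =>
    have ht0 : 0 < t := lt_of_lt_of_le (by norm_num) ht.1
    (hV t ht0).hasDerivWithinAt.derivWithin (uniqueDiffOn_Ioc 0 1 t ⟨ht0, ht.2⟩)
  obtain ⟨m, hm⟩ := (isCompact_Icc.image_of_continuousOn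
    (hP.mono fun t (ht : t ∈ Icc (1 / 2 : ℝ) 1) =>
      lt_of_lt_of_le (by norm_num) ht.1)).exists_isLeast
      ((nonempty_Icc.2 (by norm_num)).image P)
  -- Since p t ≥ q t, every value of the derivative on [1/2, 1] is at least q/2.
  have hqm : P 1 ≤ 2 * m := by
    obtain ⟨t, ht, rfl⟩ := hm.1
    rcases ht.2.eq_or_lt with h1 | h1
    · rw [h1]; linarith
    · have ht0 : 0 < t := lt_of_lt_of_le (by norm_num) ht.1
      rw [(hext t ⟨ht0, h1⟩).2]
      have := h.mul_boundary_deriv_le hk hkn hc hq ⟨ht0, h1⟩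
      nlinarith [ht.1]
  have hm0 : 0 ≤ m := by linarith
  have hint : ∀ r ∈ Ioc (0 : ℝ) 1, |V r - V 1| ≤ 2 * C * m * ∫ s in r..1, s ^ (α - 1) := by
    intro r hr
    have hsub : uIcc r 1 ⊆ Ioi 0 := by
      rw [uIcc_of_le hr.2]; exact fun s hs => hr.1.trans_le hs.1
    have hi : IntervalIntegrable P volume r 1 := (hP.mono hsub).intervalIntegrable
    have hi2 : IntervalIntegrable (fun s : ℝ => s ^ (α - 1)) volume r 1 :=
      (ContinuousOn.rpow_const continuousOn_id
        fun s hs => Or.inl (ne_of_gt (hsub hs))).intervalIntegrable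
    have h1 : ∫ s in r..1, P s = V 1 - V r :=
      intervalIntegral.integral_eq_sub_of_hasDerivAt (fun s hs => hV s (hsub hs)) hi
    have h2 : 0 ≤ ∫ s in r..1, P s :=
      intervalIntegral.integral_nonneg hr.2 fun s hs => hP0 s ⟨hr.1.trans_le hs.1, hs.2⟩
    rw [abs_sub_comm, abs_of_nonneg (by linarith), ← h1, ← intervalIntegral.integral_const_mul]
    refine intervalIntegral.integral_mono_on_of_le_Ioo hr.2 hi (hi2.const_mul _) fun s hs => ?_
    have hs1 : s ∈ Ioo (0 : ℝ) 1 := ⟨hr.1.trans hs.1, hs.2⟩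
    rw [(hext s hs1).2]
    refine (hmain c g v p _ hc h hq s hs1).trans ?_
    have h3 : 0 ≤ s ^ (α - 1) := Real.rpow_nonneg hs1.1.le _
    refine mul_le_mul_of_nonneg_right ?_ h3
    nlinarith
  have hrpow : α ≠ 0 → ∀ r ∈ Ioc (0 : ℝ) 1, ∫ s in r..1, s ^ (α - 1) = (1 - r ^ α) / α := by
    intro hα r hr
    rw [integral_rpow (Or.inr ⟨fun h0 => hα (by linarith), ?_⟩), sub_add_cancel, Real.one_rpow]
    rw [uIcc_of_le hr.2]
    exact fun h0 => absurd h0.1 (not_le.2 hr.1)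
  have hDC : ∀ x y : ℝ, 0 ≤ y → x ≤ (1 + (1 + |α|) / |α|) * y → 2 * C * m * x ≤ D * m * y := by
    intro x y _ hxy
    calc 2 * C * m * x ≤ 2 * C * m * ((1 + (1 + |α|) / |α|) * y) :=
          mul_le_mul_of_nonneg_left hxy (by positivity)
      _ = D * m * y := by simp only [D]; ring
  refine ⟨V, m, fun r hr => (hext r hr).1, hVC, ?_, fun hn r hr => ?_, fun hn r hr => ?_,
    fun hn r hr => ?_⟩
  · rwa [image_congr hVd]
  · have hα := hα1 hn
    refine (hint r hr).trans (hDC _ _ (by linarith [hr.2]) ?_)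
    have hr1 : 0 ≤ 1 - r := by linarith [hr.2]
    rw [hrpow hα.ne' r hr, abs_of_pos hα, div_le_iff₀ hα]
    have h1 := one_sub_rpow_le hr hα
    have e : (1 + (1 + α) / α) * (1 - r) * α = (1 + α) * (1 - r) + α * (1 - r) := by
      field_simp; ring
    rw [e]
    nlinarith
  · have hα := hα2 hn.ge
    rw [delta_eq_zero hn] at hα
    refine (hint r hr).trans (hDC _ _ (abs_nonneg _) ?_)
    have e : ∫ s in r..1, s ^ (α - 1) = |Real.log r| := by
      rw [hα, abs_of_nonpos (Real.log_nonpos hr.1.le hr.2)]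
      simp_rw [zero_sub, Real.rpow_neg_one]
      rw [integral_inv_of_pos hr.1 one_pos, one_div, Real.log_inv]
    rw [e]
    have : 0 ≤ (1 + |α|) / |α| * |Real.log r| := by positivity
    linarith
  · have hα := hα2 hn.le
    have hneg := delta_neg hn
    rw [← hα] at hneg ⊢
    have h1 : 1 ≤ r ^ α := Real.one_le_rpow_of_pos_of_le_one_of_nonpos hr.1 hr.2 hneg.le
    refine (hint r hr).trans (hDC _ _ (by linarith) ?_)
    rw [hrpow hneg.ne r hr, abs_of_neg hneg, div_le_iff_of_neg hneg]
    have e : (1 + (1 + -α) / -α) * (r ^ α - 1) * α = -((1 - 2 * α) * (r ^ α - 1)) := by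
      have := hneg.ne
      field_simp; ring
    rw [e]
    nlinarith

end SemistableProfile

/-! ### S_k on rank one perturbations of scalar matrices. -/

/-- For α ≠ 0 this is the matrix determinant lemma; both sides are continuous in α, which covers α =
0. -/
theorem det_smul_one_add_vecMulVec {m : Type*} [Fintype m] [DecidableEq m] [Nonempty m] (α : ℝ)
    (x y : m → ℝ) :
    (α • (1 : Matrix m m ℝ) + Matrix.vecMulVec x y).det =
      α ^ Fintype.card m + α ^ (Fintype.card m - 1) * (x ⬝ᵥ y) := by
  have hc1 : Continuous fun α : ℝ => (α • (1 : Matrix m m ℝ) + Matrix.vecMulVec x y).det := by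
    refine Continuous.matrix_det ?_
    fun_prop
  have hc2 : Continuous fun α : ℝ =>
      α ^ Fintype.card m + α ^ (Fintype.card m - 1) * (x ⬝ᵥ y) := by fun_prop
  refine congrFun (hc1.ext_on (dense_compl_singleton (0 : ℝ)) hc2 fun α (hα : α ≠ 0) => ?_) α
  have e : α • (1 : Matrix m m ℝ) + Matrix.vecMulVec x y =
      α • (1 + Matrix.vecMulVec (α⁻¹ • x) y) := by
    rw [smul_add, Matrix.smul_vecMulVec, smul_smul, mul_inv_cancel₀ hα, one_smul]
  have h1 : Fintype.card m = Fintype.card m - 1 + 1 :=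
    (Nat.succ_pred_eq_of_pos Fintype.card_pos).symm
  simp only
  rw [e, Matrix.det_smul, Matrix.vecMulVec_eq Unit,
    Matrix.det_one_add_replicateCol_mul_replicateRow,
    dotProduct_smul, dotProduct_comm, smul_eq_mul, mul_add, mul_one]
  congr 1
  nth_rewrite 1 [h1]
  rw [pow_succ]
  field_simp

/-- Double counting: each index lies in C(n-1, k-1) subsets of size k. -/
theorem sum_powersetCard_sum {n k : ℕ} (hk : 1 ≤ k) (f : Fin n → ℝ) :
    ∑ s ∈ (Finset.univ : Finset (Fin n)).powersetCard k, ∑ i ∈ s, f i =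
      ((n - 1).choose (k - 1) : ℝ) * ∑ i, f i := by
  rw [Finset.sum_comm' (t' := Finset.univ)
    (s' := fun i => ((Finset.univ : Finset (Fin n)).powersetCard k).filter (i ∈ ·)) (by simp),
    Finset.mul_sum]
  refine Finset.sum_congr rfl fun i _ => ?_
  rw [Finset.sum_const, nsmul_eq_mul]
  congr 2
  have : ((Finset.univ : Finset (Fin n)).powersetCard k).filter (i ∈ ·) =
      ((Finset.univ.erase i).powersetCard (k - 1)).image (insert i) := by
    ext s
    simp only [Finset.mem_filter, Finset.mem_powersetCard, Finset.mem_image, Finset.subset_univ,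
      true_and]
    constructor
    · rintro ⟨h1, h2⟩
      exact ⟨s.erase i, ⟨Finset.erase_subset_erase _ (Finset.subset_univ _), by
        rw [Finset.card_erase_of_mem h2, h1]⟩, Finset.insert_erase h2⟩
    · rintro ⟨t, ⟨h1, h2⟩, rfl⟩
      have : i ∉ t := fun h => by simpa using h1 h
      rw [Finset.card_insert_of_notMem this]
      exact ⟨by omega, Finset.mem_insert_self _ _⟩
  rw [this, Finset.card_image_of_injOn, Finset.card_powersetCard, Finset.card_erase_of_mem
    (Finset.mem_univ _), Finset.card_univ, Fintype.card_fin]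
  intro s hs t ht hst
  have hs' : i ∉ s := fun h => by simpa using (Finset.mem_powersetCard.1 hs).1 h
  have ht' : i ∉ t := fun h => by simpa using (Finset.mem_powersetCard.1 ht).1 h
  rw [← Finset.erase_insert hs', ← Finset.erase_insert ht', hst]

/-- Every principal submatrix is again a scalar matrix plus a matrix of rank at most one. -/
theorem kHessian_smul_one_add_vecMulVec {n k : ℕ} (hk : 1 ≤ k) (α : ℝ) (x y : Fin n → ℝ) :
    kHessian k (α • (1 : Matrix (Fin n) (Fin n) ℝ) + Matrix.vecMulVec x y) =
      (n.choose k : ℝ) * α ^ k + α ^ (k - 1) * (((n - 1).choose (k - 1) : ℝ) * (x ⬝ᵥ y)) := by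
  unfold kHessian
  have h1 : ∀ s ∈ (Finset.univ : Finset (Fin n)).powersetCard k,
      ((α • (1 : Matrix (Fin n) (Fin n) ℝ) + Matrix.vecMulVec x y).submatrix
        (fun i : s => (i : Fin n)) (fun i : s => (i : Fin n))).det =
      α ^ k + α ^ (k - 1) * ∑ i ∈ s, x i * y i := by
    intro s hs
    have hcard := (Finset.mem_powersetCard.1 hs).2
    have hne : Nonempty s := by
      rw [Finset.nonempty_coe_sort, ← Finset.card_pos]; omega
    have e : (α • (1 : Matrix (Fin n) (Fin n) ℝ) + Matrix.vecMulVec x y).submatrix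
        (fun i : s => (i : Fin n)) (fun i : s => (i : Fin n)) =
        α • (1 : Matrix s s ℝ) + Matrix.vecMulVec (fun i : s => x i) (fun i : s => y i) := by
      ext i j
      simp only [Matrix.submatrix_apply, Matrix.add_apply, Matrix.smul_apply, Matrix.one_apply,
        Matrix.vecMulVec_apply, Subtype.ext_iff]
    rw [e, det_smul_one_add_vecMulVec, Fintype.card_coe, hcard, dotProduct,
      Finset.sum_coe_sort s fun i => x i * y i]
  rw [Finset.sum_congr rfl h1, Finset.sum_add_distrib, Finset.sum_const, ← Finset.mul_sum,
    sum_powersetCard_sum hk, Finset.card_powersetCard, Finset.card_univ, Fintype.card_fin,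
    nsmul_eq_mul, dotProduct]

section

attribute [local instance] Matrix.normedAddCommGroup Matrix.normedSpace

theorem differentiable_kHessian (n k : ℕ) :
    Differentiable ℝ fun M : Matrix (Fin n) (Fin n) ℝ => kHessian k M := by
  unfold kHessian
  simp only [Matrix.det_apply]
  refine Differentiable.fun_sum fun s _ => Differentiable.fun_sum fun σ _ => ?_
  refine Differentiable.const_smul (c := Equiv.Perm.sign σ) ?_
  refine (contDiff_prod (n := 1) fun i _ => ?_).differentiable one_ne_zero
  exact contDiff_apply_apply ℝ ℝ (σ i : Fin n) (i : Fin n)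

/-- S_k is a polynomial in the entries, and the double sum is its differential applied to a bᵀ, so
no single S_k^{ij} has to be computed. The norm on matrices serves only to speak of the
differential. -/
theorem kHessianForm_eq_deriv {n : ℕ} (k : ℕ) (A : Matrix (Fin n) (Fin n) ℝ) (a b : Fin n → ℝ) :
    kHessianForm k A a b = deriv (fun t : ℝ => kHessian k (A + t • Matrix.vecMulVec a b)) 0 := by
  set F : Matrix (Fin n) (Fin n) ℝ → ℝ := fun M => kHessian k M
  have hd : ∀ B : Matrix (Fin n) (Fin n) ℝ,
      HasDerivAt (fun t : ℝ => kHessian k (A + t • B)) (fderiv ℝ F A B) 0 := by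
    intro B
    have h1 : HasDerivAt (fun t : ℝ => A + t • B) B 0 := by
      have h := ((hasDerivAt_id (0 : ℝ)).smul_const B).const_add A
      rwa [one_smul] at h
    have h2 : HasFDerivAt F (fderiv ℝ F A) (A + (0 : ℝ) • B) := by
      rw [zero_smul, add_zero]
      exact (differentiable_kHessian n k A).hasFDerivAt
    exact h2.comp_hasDerivAt (0 : ℝ) h1
  have h4 : ∀ i j, kHessianDeriv k A i j = fderiv ℝ F A (Matrix.single i j (1 : ℝ)) :=
    fun i j => (hd (Matrix.single i j (1 : ℝ))).deriv
  rw [(hd _).deriv]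
  unfold kHessianForm
  simp_rw [h4]
  have e : Matrix.vecMulVec a b =
      ∑ i, ∑ j, (a i * b j) • (Matrix.single i j (1 : ℝ)) := by
    refine (Matrix.matrix_eq_sum_single (Matrix.vecMulVec a b)).trans ?_
    refine Finset.sum_congr rfl fun i _ => Finset.sum_congr rfl fun j _ => ?_
    rw [Matrix.vecMulVec_apply, Matrix.smul_single, smul_eq_mul, mul_one]
  rw [e, map_sum]
  refine Finset.sum_congr rfl fun i _ => ?_
  rw [map_sum]
  refine Finset.sum_congr rfl fun j _ => ?_
  rw [map_smul, smul_eq_mul]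

end

/-- Moving along θθᵀ changes only the rank one part, in which S_k is affine. So γ, the only place
where the second radial derivative enters, drops out. -/
theorem kHessianForm_radial {n k : ℕ} (hk : 1 ≤ k) (α γ a b : ℝ) {θ : Fin n → ℝ}
    (hθ : θ ⬝ᵥ θ = 1) :
    kHessianForm k (α • (1 : Matrix (Fin n) (Fin n) ℝ) + γ • Matrix.vecMulVec θ θ)
      (a • θ) (b • θ) = ((n - 1).choose (k - 1) : ℝ) * α ^ (k - 1) * (a * b) := by
  rw [kHessianForm_eq_deriv]
  have e : (fun t : ℝ => kHessian k (α • (1 : Matrix (Fin n) (Fin n) ℝ) +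
      γ • Matrix.vecMulVec θ θ + t • Matrix.vecMulVec (a • θ) (b • θ))) =
      fun t => (n.choose k : ℝ) * α ^ k +
        α ^ (k - 1) * (((n - 1).choose (k - 1) : ℝ) * (γ + t * (a * b))) := by
    funext t
    have : γ • Matrix.vecMulVec θ θ + t • Matrix.vecMulVec (a • θ) (b • θ) =
        Matrix.vecMulVec ((γ + t * (a * b)) • θ) θ := by
      ext i j
      simp only [Matrix.add_apply, Matrix.smul_apply, Matrix.vecMulVec_apply, Pi.smul_apply,
        smul_eq_mul]
      ring
    rw [add_assoc, this, kHessian_smul_one_add_vecMulVec hk, smul_dotProduct, hθ, smul_eq_mul,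
      mul_one]
  rw [e]
  have : HasDerivAt (fun t : ℝ => (n.choose k : ℝ) * α ^ k +
        α ^ (k - 1) * (((n - 1).choose (k - 1) : ℝ) * (γ + t * (a * b))))
      (α ^ (k - 1) * (((n - 1).choose (k - 1) : ℝ) * (1 * (a * b)))) 0 :=
    ((((hasDerivAt_id (0 : ℝ)).mul_const (a * b)).const_add γ).const_mul _).const_mul _
      |>.const_add _
  rw [this.deriv]
  ring

/-! ### Calculus of radial functions. -/

section Calculus

variable {n : ℕ}

theorem isOpen_unitBall : IsOpen (unitBall n) := Metric.isOpen_ball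

theorem isOpen_puncturedBall : IsOpen (puncturedBall n) :=
  Metric.isOpen_ball.sdiff isClosed_singleton

theorem puncturedBall_subset_unitBall : puncturedBall n ⊆ unitBall n := sdiff_subset

theorem mem_unitBall {x : EuclideanSpace ℝ (Fin n)} : x ∈ unitBall n ↔ ‖x‖ < 1 := mem_ball_zero_iff

theorem mem_puncturedBall {x : EuclideanSpace ℝ (Fin n)} :
    x ∈ puncturedBall n ↔ ‖x‖ ∈ Ioo (0 : ℝ) 1 := by
  rw [puncturedBall, Set.mem_sdiff, mem_ball_zero_iff, mem_singleton_iff, mem_Ioo, norm_pos_iff,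
    and_comm]

theorem hasFDerivAt_norm {x : EuclideanSpace ℝ (Fin n)} (hx : x ≠ 0) :
    HasFDerivAt (fun y : EuclideanSpace ℝ (Fin n) => ‖y‖) (‖x‖⁻¹ • innerSL ℝ x) x := by
  have h1 : HasFDerivAt (fun y : EuclideanSpace ℝ (Fin n) => Real.sqrt (‖y‖ ^ 2))
      ((1 / (2 * Real.sqrt (‖x‖ ^ 2))) • ((2 : ℝ) • innerSL ℝ x)) x := by
    have h := (hasStrictFDerivAt_norm_sq x).hasFDerivAt
    have h' : HasFDerivAt (fun y : EuclideanSpace ℝ (Fin n) => ‖y‖ ^ 2)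
        ((2 : ℝ) • innerSL ℝ x) x := by
      refine h.congr_fderiv ?_
      ext v
      simp [two_smul]
    exact h'.sqrt (pow_ne_zero 2 (norm_ne_zero_iff.2 hx))
  have e : (fun y : EuclideanSpace ℝ (Fin n) => ‖y‖) = fun y => Real.sqrt (‖y‖ ^ 2) := by
    funext y; rw [Real.sqrt_sq (norm_nonneg _)]
  rw [e]
  refine h1.congr_fderiv ?_
  rw [Real.sqrt_sq (norm_nonneg _), smul_smul]
  congr 1
  have := norm_ne_zero_iff.2 hx
  field_simp

theorem hasFDerivAt_comp_norm {x : EuclideanSpace ℝ (Fin n)} (hx : x ≠ 0) {y : ℝ → ℝ} {y' : ℝ}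
    (hy : HasDerivAt y y' ‖x‖) :
    HasFDerivAt (fun z : EuclideanSpace ℝ (Fin n) => y ‖z‖) (y' • ‖x‖⁻¹ • innerSL ℝ x) x :=
  hy.comp_hasFDerivAt x (hasFDerivAt_norm hx)

theorem innerSL_single (x : EuclideanSpace ℝ (Fin n)) (i : Fin n) :
    innerSL ℝ x (EuclideanSpace.single i 1) = x i := by
  rw [innerSL_apply_apply, EuclideanSpace.inner_single_right]
  simp

theorem partialDeriv_comp_norm (i : Fin n) {x : EuclideanSpace ℝ (Fin n)} (hx : x ≠ 0)
    {y : ℝ → ℝ} {y' : ℝ} (hy : HasDerivAt y y' ‖x‖) :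
    partialDeriv i (fun z : EuclideanSpace ℝ (Fin n) => y ‖z‖) x = y' * (x i / ‖x‖) := by
  rw [partialDeriv, (hasFDerivAt_comp_norm hx hy).fderiv]
  simp only [smul_apply, innerSL_single, smul_eq_mul]
  ring

theorem partialDeriv_mul (i : Fin n) {f h : EuclideanSpace ℝ (Fin n) → ℝ}
    {x : EuclideanSpace ℝ (Fin n)} (hf : DifferentiableAt ℝ f x) (hh : DifferentiableAt ℝ h x) :
    partialDeriv i (fun y => f y * h y) x =
      f x * partialDeriv i h x + partialDeriv i f x * h x := by
  rw [partialDeriv, fderiv_fun_mul hf hh]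
  simp only [add_apply, smul_apply, smul_eq_mul,
    partialDeriv]
  ring

theorem hasFDerivAt_coord (i : Fin n) (x : EuclideanSpace ℝ (Fin n)) :
    HasFDerivAt (fun y : EuclideanSpace ℝ (Fin n) => y i)
      (EuclideanSpace.proj i : (EuclideanSpace ℝ (Fin n)) →L[ℝ] ℝ) x :=
  (EuclideanSpace.proj i : (EuclideanSpace ℝ (Fin n)) →L[ℝ] ℝ).hasFDerivAt

theorem partialDeriv_coord (i j : Fin n) (x : EuclideanSpace ℝ (Fin n)) :
    partialDeriv j (fun y : EuclideanSpace ℝ (Fin n) => y i) x = if i = j then 1 else 0 := by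
  rw [partialDeriv, (hasFDerivAt_coord i x).fderiv]
  simp

theorem contDiff_coord {m : WithTop ℕ∞} (i : Fin n) :
    ContDiff ℝ m fun y : EuclideanSpace ℝ (Fin n) => y i :=
  (EuclideanSpace.proj i : (EuclideanSpace ℝ (Fin n)) →L[ℝ] ℝ).contDiff

theorem contDiffOn_direction (m : WithTop ℕ∞) (i : Fin n) :
    ContDiffOn ℝ m (fun x : EuclideanSpace ℝ (Fin n) => x i / ‖x‖) (puncturedBall n) := fun _ hx =>
  ((contDiff_coord i).contDiffAt.div (contDiffAt_norm ℝ hx.2)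
    (norm_ne_zero_iff.2 hx.2)).contDiffWithinAt

theorem differentiableAt_direction (i : Fin n) {x : EuclideanSpace ℝ (Fin n)} (hx : x ≠ 0) :
    DifferentiableAt ℝ (fun x : EuclideanSpace ℝ (Fin n) => x i / ‖x‖) x :=
  ((contDiff_coord (m := 1) i).contDiffAt.div (contDiffAt_norm ℝ hx)
    (norm_ne_zero_iff.2 hx)).differentiableAt one_ne_zero

theorem partialDeriv_direction (i j : Fin n) {x : EuclideanSpace ℝ (Fin n)} (hx : x ≠ 0) :
    partialDeriv j (fun x : EuclideanSpace ℝ (Fin n) => x i / ‖x‖) x =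
      ((if i = j then 1 else 0) - x i / ‖x‖ * (x j / ‖x‖)) / ‖x‖ := by
  have hx' := norm_ne_zero_iff.2 hx
  have e : (fun x : EuclideanSpace ℝ (Fin n) => x i / ‖x‖) = fun x => x i * ‖x‖⁻¹ := by
    funext y; rw [div_eq_mul_inv]
  have h2 := partialDeriv_comp_norm j hx (hasDerivAt_inv hx')
  rw [e, partialDeriv_mul j (hasFDerivAt_coord i x).differentiableAt
    (hasFDerivAt_comp_norm hx (hasDerivAt_inv hx')).differentiableAt, h2, partialDeriv_coord]
  field_simp
  ring

theorem sum_direction_sq {x : EuclideanSpace ℝ (Fin n)} (hx : x ≠ 0) :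
    ∑ i, x i / ‖x‖ * (x i / ‖x‖) = 1 := by
  have h := EuclideanSpace.real_norm_sq_eq x
  have hx' := norm_ne_zero_iff.2 hx
  have : ∀ i, x i / ‖x‖ * (x i / ‖x‖) = x i ^ 2 / ‖x‖ ^ 2 := fun i => by field_simp
  simp_rw [this]
  rw [← Finset.sum_div, ← h, div_self (pow_ne_zero 2 hx')]

/-- The norm is not differentiable at the origin; there smoothness comes from y being constant on r
< a. -/
theorem contDiff_comp_norm {m : WithTop ℕ∞} {y : ℝ → ℝ} (hy : ContDiff ℝ m y) {a : ℝ} (ha : 0 < a)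
    (hya : ∀ r < a, y r = y 0) : ContDiff ℝ m fun x : EuclideanSpace ℝ (Fin n) => y ‖x‖ := by
  rw [contDiff_iff_contDiffAt]
  intro x
  by_cases hx : x = 0
  · refine (contDiffAt_const (c := y 0)).congr_of_eventuallyEq ?_
    filter_upwards [Metric.ball_mem_nhds x ha] with z hz
    rw [hx, mem_ball_zero_iff] at hz
    exact hya _ hz
  · exact hy.contDiffAt.comp x (contDiffAt_norm ℝ hx)

theorem tsupport_comp_norm_subset {y : ℝ → ℝ} {a b : ℝ} (hya : ∀ r < a, y r = 0)
    (hyb : ∀ r > b, y r = 0) :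
    tsupport (fun x : EuclideanSpace ℝ (Fin n) => y ‖x‖) ⊆ {x | a ≤ ‖x‖ ∧ ‖x‖ ≤ b} := by
  refine closure_minimal (fun x hx => ?_)
    ((isClosed_le continuous_const continuous_norm).inter
      (isClosed_le continuous_norm continuous_const))
  constructor
  · by_contra! h
    exact hx (hya _ h)
  · by_contra! h
    exact hx (hyb _ h)

theorem isTestFunction_unitBall_comp_norm {m : WithTop ℕ∞} {y : ℝ → ℝ} (hy : ContDiff ℝ m y)
    {a b : ℝ} (ha : 0 < a) (hya : ∀ r < a, y r = y 0) (hb : b < 1) (hyb : ∀ r > b, y r = 0) :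
    IsTestFunction m (unitBall n) fun x => y ‖x‖ := by
  have hs : tsupport (fun x : EuclideanSpace ℝ (Fin n) => y ‖x‖) ⊆ Metric.closedBall 0 b := by
    refine closure_minimal (fun x hx => ?_) Metric.isClosed_closedBall
    rw [mem_closedBall_zero_iff]
    by_contra! h
    exact hx (hyb _ h)
  refine ⟨contDiff_comp_norm hy ha hya, ?_, hs.trans (Metric.closedBall_subset_ball hb)⟩
  exact (isCompact_closedBall _ _).of_isClosed_subset (isClosed_tsupport _) hs

theorem isTestFunction_puncturedBall_comp_norm {m : WithTop ℕ∞} {y : ℝ → ℝ} (hy : ContDiff ℝ m y)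
    (hyc : HasCompactSupport y) (hys : tsupport y ⊆ Ioo 0 1) :
    IsTestFunction m (puncturedBall n) fun x => y ‖x‖ := by
  obtain ⟨a, b, ha, hab, hb, hK⟩ := exists_Icc_of_isCompact_subset_Ioo hyc hys
  have hz : ∀ r, r ∉ Ioo a b → y r = 0 := fun r hr =>
    image_eq_zero_of_notMem_tsupport fun h => hr (hK h)
  have hza : ∀ r < a, y r = 0 := fun r hr => hz r fun h => (lt_asymm hr h.1)
  have hzb : ∀ r > b, y r = 0 := fun r hr => hz r fun h => (lt_asymm hr h.2)
  have h1 := isTestFunction_unitBall_comp_norm (n := n) hy ha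
    (fun r hr => by rw [hza r hr, hza 0 ha]) hb hzb
  refine ⟨h1.1, h1.2.1, (tsupport_comp_norm_subset hza hzb).trans fun x hx => ?_⟩
  exact mem_puncturedBall.2 ⟨ha.trans_le hx.1, hx.2.trans_lt hb⟩

theorem exists_norm_bounds {K : Set (EuclideanSpace ℝ (Fin n))} (hK : IsCompact K)
    (h : K ⊆ puncturedBall n) :
    ∃ a b : ℝ, 0 < a ∧ a < b ∧ b < 1 ∧ ∀ x ∈ K, ‖x‖ ∈ Ioo a b := by
  obtain ⟨a, b, ha, hab, hb, h1⟩ := exists_Icc_of_isCompact_subset_Ioo (hK.image continuous_norm)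
    (by rintro _ ⟨x, hx, rfl⟩; exact mem_puncturedBall.1 (h hx))
  exact ⟨a, b, ha, hab, hb, fun x hx => h1 ⟨x, hx, rfl⟩⟩

theorem isCompact_annulus (a b : ℝ) : IsCompact {x : EuclideanSpace ℝ (Fin n) | ‖x‖ ∈ Icc a b} := by
  refine (isCompact_closedBall (0 : EuclideanSpace ℝ (Fin n)) b).of_isClosed_subset
    (isClosed_Icc.preimage continuous_norm) fun x hx => ?_
  exact mem_closedBall_zero_iff.2 hx.2

theorem annulus_subset_puncturedBall {a b : ℝ} (ha : 0 < a) (hb : b < 1) :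
    {x : EuclideanSpace ℝ (Fin n) | ‖x‖ ∈ Icc a b} ⊆ puncturedBall n := fun _ hx =>
  mem_puncturedBall.2 ⟨ha.trans_le hx.1, hx.2.trans_lt hb⟩

end Calculus

/-! ### Weak partial derivatives. -/

section WeakDerivative

variable {n : ℕ} {Ω : Set (EuclideanSpace ℝ (Fin n))} {i : Fin n}
  {f h : EuclideanSpace ℝ (Fin n) → ℝ}

theorem integrable_mul_of_tsupport_subset {X : Type*} [TopologicalSpace X]
    [MeasurableSpace X] [OpensMeasurableSpace X] [T2Space X] {μ : Measure X} {U : Set X}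
    {f φ : X → ℝ} (hf : LocallyIntegrableOn f U μ) (hφ : Continuous φ)
    (hc : HasCompactSupport φ) (hs : tsupport φ ⊆ U) : Integrable (fun x => f x * φ x) μ := by
  have h1 : IntegrableOn f (tsupport φ) μ := hf.integrableOn_compact_subset hs hc
  have h2 : IntegrableOn (fun x => f x * φ x) (tsupport φ) μ :=
    h1.mul_continuousOn hφ.continuousOn hc
  rwa [integrableOn_iff_integrable_of_support_subset] at h2
  exact fun x hx => subset_tsupport φ (right_ne_zero_of_mul hx)

theorem setIntegral_eq_integral_of_tsupport_subset {φ : EuclideanSpace ℝ (Fin n) → ℝ}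
    (hs : tsupport φ ⊆ Ω) (f : EuclideanSpace ℝ (Fin n) → ℝ) :
    ∫ x in Ω, f x * φ x = ∫ x, f x * φ x := by
  refine setIntegral_eq_integral_of_forall_compl_eq_zero fun x hx => ?_
  rw [image_eq_zero_of_notMem_tsupport fun h' => hx (hs h'), mul_zero]

theorem tsupport_partialDeriv_subset (i : Fin n) (φ : EuclideanSpace ℝ (Fin n) → ℝ) :
    tsupport (partialDeriv i φ) ⊆ tsupport φ :=
  tsupport_fderiv_apply_subset ℝ (EuclideanSpace.single i (1 : ℝ))

theorem IsTestFunction.hasCompactSupport_partialDeriv {m : WithTop ℕ∞}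
    {φ : EuclideanSpace ℝ (Fin n) → ℝ} (hφ : IsTestFunction m Ω φ) (i : Fin n) :
    HasCompactSupport (partialDeriv i φ) :=
  hφ.2.1.of_isClosed_subset (isClosed_tsupport _) (tsupport_partialDeriv_subset i φ)

theorem IsTestFunction.continuous_partialDeriv {m : WithTop ℕ∞}
    {φ : EuclideanSpace ℝ (Fin n) → ℝ} (hφ : IsTestFunction m Ω φ) (hm : 1 ≤ m) (i : Fin n) :
    Continuous (partialDeriv i φ) :=
  (hφ.1.continuous_fderiv (by positivity)).clm_apply continuous_const

theorem HasWeakPartial.mono {Ω' : Set (EuclideanSpace ℝ (Fin n))} (H : HasWeakPartial Ω i f h)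
    (hΩ : Ω' ⊆ Ω) : HasWeakPartial Ω' i f h := by
  refine ⟨H.1.mono_set hΩ, H.2.1.mono_set hΩ, fun φ hφ => ?_⟩
  have h1 := H.2.2 φ ⟨hφ.1, hφ.2.1, hφ.2.2.trans hΩ⟩
  have h2 := (tsupport_partialDeriv_subset i φ).trans hφ.2.2
  rw [setIntegral_eq_integral_of_tsupport_subset (h2.trans hΩ),
    setIntegral_eq_integral_of_tsupport_subset (hφ.2.2.trans hΩ)] at h1
  rw [setIntegral_eq_integral_of_tsupport_subset h2,
    setIntegral_eq_integral_of_tsupport_subset hφ.2.2, h1]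

theorem HasWeakPartial.unique (hΩ : IsOpen Ω) (H : HasWeakPartial Ω i f h)
    {f' h' : EuclideanSpace ℝ (Fin n) → ℝ} (H' : HasWeakPartial Ω i f' h')
    (hf : ∀ᵐ x ∂(volume.restrict Ω), f x = f' x) :
    ∀ᵐ x ∂(volume.restrict Ω), h x = h' x := by
  have h0 : ∀ᵐ x ∂volume, x ∈ Ω → h x - h' x = 0 := by
    refine hΩ.ae_eq_zero_of_integral_contDiff_smul_eq_zero (H.2.1.sub H'.2.1)
      fun φ hφ hφc hφs => ?_
    have h1 := H.2.2 φ ⟨hφ, hφc, hφs⟩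
    have h2 := H'.2.2 φ ⟨hφ, hφc, hφs⟩
    have e1 : ∫ x in Ω, f' x * partialDeriv i φ x = ∫ x in Ω, f x * partialDeriv i φ x :=
      integral_congr_ae (hf.mono fun x hx => by simp only; rw [hx])
    rw [e1, h1, neg_inj, setIntegral_eq_integral_of_tsupport_subset hφs,
      setIntegral_eq_integral_of_tsupport_subset hφs] at h2
    have i1 := integrable_mul_of_tsupport_subset H.2.1 hφ.continuous hφc hφs
    have i2 := integrable_mul_of_tsupport_subset H'.2.1 hφ.continuous hφc hφs
    have e : ∀ x, φ x • (h x - h' x) = h x * φ x - h' x * φ x := fun x => by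
      rw [smul_eq_mul]; ring
    simp_rw [e]
    rw [integral_sub i1 i2, h2, sub_self]
  rw [ae_restrict_iff' hΩ.measurableSet]
  exact h0.mono fun x hx hxΩ => sub_eq_zero.1 (hx hxΩ)

/-- The factor b is moved onto the test function: b φ, smooth after extension by zero, is again a
test function. -/
theorem HasWeakPartial.contDiffOn_mul (hΩ : IsOpen Ω) (H : HasWeakPartial Ω i f h)
    {b : EuclideanSpace ℝ (Fin n) → ℝ} (hb : ContDiffOn ℝ ∞ b Ω) :
    HasWeakPartial Ω i (fun x => b x * f x) (fun x => b x * h x + partialDeriv i b x * f x) := by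
  have hb' : ContinuousOn (partialDeriv i b) Ω :=
    (hb.continuousOn_fderiv_of_isOpen hΩ (by norm_num)).clm_apply continuousOn_const
  have i1 : LocallyIntegrableOn (fun x => b x * h x) Ω :=
    H.2.1.continuousOn_mul hb.continuousOn hΩ.isLocallyClosed
  have i2 : LocallyIntegrableOn (fun x => partialDeriv i b x * f x) Ω :=
    H.1.continuousOn_mul hb' hΩ.isLocallyClosed
  refine ⟨H.1.continuousOn_mul hb.continuousOn hΩ.isLocallyClosed, i1.add i2, fun φ hφ => ?_⟩
  have hbφ : IsTestFunction ∞ Ω fun x => b x * φ x :=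
    ⟨contDiff_mul_of_tsupport_subset hΩ hb hφ.1 hφ.2.2, hφ.2.1.mul_left,
      (closure_mono (Function.support_mul_subset_right _ _)).trans hφ.2.2⟩
  have h1 := H.2.2 _ hbφ
  have hs' := (tsupport_partialDeriv_subset i φ).trans hφ.2.2
  have e1 : ∫ x in Ω, f x * partialDeriv i (fun x => b x * φ x) x =
      ∫ x in Ω, (b x * f x * partialDeriv i φ x + partialDeriv i b x * f x * φ x) := by
    refine setIntegral_congr_fun hΩ.measurableSet fun x hx => ?_
    rw [partialDeriv_mul i ((hb.contDiffAt (hΩ.mem_nhds hx)).differentiableAt (by simp))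
      (hφ.1.contDiffAt.differentiableAt (by simp))]
    ring
  have j1 : IntegrableOn (fun x => b x * f x * partialDeriv i φ x) Ω :=
    (integrable_mul_of_tsupport_subset (H.1.continuousOn_mul hb.continuousOn hΩ.isLocallyClosed)
      (hφ.continuous_partialDeriv (by norm_num) i) (hφ.hasCompactSupport_partialDeriv i)
      hs').integrableOn
  have j2 : IntegrableOn (fun x => partialDeriv i b x * f x * φ x) Ω :=
    (integrable_mul_of_tsupport_subset i2 hφ.1.continuous hφ.2.1 hφ.2.2).integrableOn
  have j3 : IntegrableOn (fun x => b x * h x * φ x) Ω :=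
    (integrable_mul_of_tsupport_subset i1 hφ.1.continuous hφ.2.1 hφ.2.2).integrableOn
  rw [e1, integral_add j1 j2] at h1
  have e2 : ∫ x in Ω, (b x * h x + partialDeriv i b x * f x) * φ x =
      (∫ x in Ω, b x * h x * φ x) + ∫ x in Ω, partialDeriv i b x * f x * φ x := by
    rw [← integral_add j3 j2]
    exact integral_congr_ae (Filter.Eventually.of_forall fun x => by simp only; ring)
  have e3 : ∫ x in Ω, h x * (b x * φ x) = ∫ x in Ω, b x * h x * φ x :=
    integral_congr_ae (Filter.Eventually.of_forall fun x => by simp only; ring)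
  rw [e3] at h1
  rw [e2]
  linarith

theorem HasWeakPartial.sum {ι : Type*} (s : Finset ι)
    {f h : ι → EuclideanSpace ℝ (Fin n) → ℝ} (H : ∀ j ∈ s, HasWeakPartial Ω i (f j) (h j)) :
    HasWeakPartial Ω i (fun x => ∑ j ∈ s, f j x) (fun x => ∑ j ∈ s, h j x) := by
  have hloc : ∀ g : ι → EuclideanSpace ℝ (Fin n) → ℝ, (∀ j ∈ s, LocallyIntegrableOn (g j) Ω) →
      LocallyIntegrableOn (fun x => ∑ j ∈ s, g j x) Ω := by
    classical
    intro g hg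
    induction s using Finset.induction_on with
    | empty => simpa using (locallyIntegrable_const (0 : ℝ)).locallyIntegrableOn Ω
    | insert a s ha ih =>
      simp_rw [Finset.sum_insert ha]
      exact (hg a (Finset.mem_insert_self _ _)).add
        (ih (fun j hj => H j (Finset.mem_insert_of_mem hj))
          fun j hj => hg j (Finset.mem_insert_of_mem hj))
  refine ⟨hloc f fun j hj => (H j hj).1, hloc h fun j hj => (H j hj).2.1, fun φ hφ => ?_⟩
  have hs' := (tsupport_partialDeriv_subset i φ).trans hφ.2.2
  simp_rw [Finset.sum_mul]
  rw [integral_finsetSum, integral_finsetSum, ← Finset.sum_neg_distrib]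
  · exact Finset.sum_congr rfl fun j hj => (H j hj).2.2 φ hφ
  · exact fun j hj =>
      (integrable_mul_of_tsupport_subset (H j hj).2.1 hφ.1.continuous hφ.2.1 hφ.2.2).integrableOn
  · exact fun j hj => (integrable_mul_of_tsupport_subset (H j hj).1
      (hφ.continuous_partialDeriv (by norm_num) i) (hφ.hasCompactSupport_partialDeriv i)
      hs').integrableOn

end WeakDerivative

/-! ### Primitives of locally integrable functions on (0, 1). -/

section Primitive

/-- `P` is a primitive on `(0, 1)` of the locally integrable function `Q`. -/
structure IsPrimitive (P Q : ℝ → ℝ) : Prop where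
  locallyIntegrableOn : LocallyIntegrableOn Q (Ioo 0 1)
  sub_eq : ∀ a ∈ Ioo (0 : ℝ) 1, ∀ b ∈ Ioo (0 : ℝ) 1, P b - P a = ∫ r in a..b, Q r

variable {P Q : ℝ → ℝ}

theorem uIcc_subset_Ioo {a b : ℝ} (ha : a ∈ Ioo (0 : ℝ) 1) (hb : b ∈ Ioo (0 : ℝ) 1) :
    uIcc a b ⊆ Ioo (0 : ℝ) 1 :=
  fun _ hx => ⟨(lt_min ha.1 hb.1).trans_le hx.1, hx.2.trans_lt (max_lt ha.2 hb.2)⟩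

theorem LocallyIntegrableOn.intervalIntegrable_Ioo (hQ : LocallyIntegrableOn Q (Ioo (0 : ℝ) 1))
    {a b : ℝ} (ha : a ∈ Ioo (0 : ℝ) 1) (hb : b ∈ Ioo (0 : ℝ) 1) :
    IntervalIntegrable Q volume a b :=
  (hQ.integrableOn_compact_subset (uIcc_subset_Ioo ha hb) isCompact_uIcc).intervalIntegrable

theorem IsPrimitive.eq_add (h : IsPrimitive P Q) {a r : ℝ} (ha : a ∈ Ioo (0 : ℝ) 1)
    (hr : r ∈ Ioo (0 : ℝ) 1) : P r = P a + ∫ s in a..r, Q s := by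
  rw [← h.sub_eq a ha r hr]; ring

theorem IsPrimitive.continuousOn (h : IsPrimitive P Q) : ContinuousOn P (Ioo 0 1) := by
  intro r hr
  obtain ⟨a, ha0, har⟩ := exists_between hr.1
  obtain ⟨b, hrb, hb1⟩ := exists_between hr.2
  have ha : a ∈ Ioo (0 : ℝ) 1 := ⟨ha0, har.trans hr.2⟩
  have hb : b ∈ Ioo (0 : ℝ) 1 := ⟨hr.1.trans hrb, hb1⟩
  have h1 : ContinuousOn (fun s => P a + ∫ t in a..s, Q t) (uIcc a b) :=
    continuousOn_const.add (intervalIntegral.continuousOn_primitive_interval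
      (h.locallyIntegrableOn.integrableOn_compact_subset (uIcc_subset_Ioo ha hb) isCompact_uIcc))
  have h2 : ContinuousAt (fun s => P a + ∫ t in a..s, Q t) r := by
    refine h1.continuousAt ?_
    rw [uIcc_of_le (har.trans hrb).le]
    exact Icc_mem_nhds har hrb
  refine ContinuousAt.continuousWithinAt (h2.congr ?_)
  filter_upwards [Ioo_mem_nhds hr.1 hr.2] with s hs
  exact (h.eq_add ha hs).symm

theorem IsPrimitive.hasDerivAt (h : IsPrimitive P Q) {Q' : ℝ → ℝ}
    (hQ : ∀ᵐ r ∂(volume.restrict (Ioo (0 : ℝ) 1)), Q r = Q' r) (hc : ContinuousOn Q' (Ioo 0 1))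
    {r : ℝ} (hr : r ∈ Ioo (0 : ℝ) 1) : HasDerivAt P (Q' r) r := by
  have h1 : ∀ s ∈ Ioo (0 : ℝ) 1, P s = P r + ∫ t in r..s, Q' t := by
    intro s hs
    rw [h.eq_add hr hs]
    congr 1
    refine intervalIntegral.integral_congr_ae_restrict ?_
    exact ae_restrict_of_ae_restrict_of_subset
      (uIoc_subset_uIcc.trans (uIcc_subset_Ioo hr hs)) hQ
  have h2 : HasDerivAt (fun s => P r + ∫ t in r..s, Q' t) (Q' r) r := by
    refine (intervalIntegral.integral_hasDerivAt_right (by simp) ?_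
      (hc.continuousAt (isOpen_Ioo.mem_nhds hr))).const_add _
    exact hc.stronglyMeasurableAtFilter isOpen_Ioo r hr
  refine h2.congr_of_eventuallyEq ?_
  filter_upwards [isOpen_Ioo.mem_nhds hr] with s hs using h1 s hs

theorem eq_zero_of_notMem_Ioo {χ : ℝ → ℝ} {a b : ℝ} (hK : tsupport χ ⊆ Ioo a b) :
    ∀ r, r ∉ Ioo a b → χ r = 0 ∧ deriv χ r = 0 := by
  intro r hr
  have hr' : r ∉ tsupport χ := fun h' => hr (hK h')
  refine ⟨image_eq_zero_of_notMem_tsupport hr', ?_⟩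
  by_contra h0
  exact hr' (support_deriv_subset h0)

theorem IsPrimitive.integral_mul_deriv (h : IsPrimitive P Q) {χ : ℝ → ℝ} (hχ : ContDiff ℝ 1 χ)
    (hc : HasCompactSupport χ) (hs : tsupport χ ⊆ Ioo 0 1) :
    ∫ r in Ioo (0 : ℝ) 1, P r * deriv χ r = -∫ r in Ioo (0 : ℝ) 1, Q r * χ r := by
  obtain ⟨a, b, ha, hab, hb, hK⟩ := exists_Icc_of_isCompact_subset_Ioo hc hs
  have hz := eq_zero_of_notMem_Ioo hK
  have haA : a ∈ Ioo (0 : ℝ) 1 := ⟨ha, hab.trans hb⟩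
  have hbA : b ∈ Ioo (0 : ℝ) 1 := ⟨ha.trans hab, hb⟩
  rw [setIntegral_Ioo_eq_intervalIntegral ha hab hb fun r hr => by rw [(hz r hr).2, mul_zero],
    setIntegral_Ioo_eq_intervalIntegral ha hab hb fun r hr => by rw [(hz r hr).1, mul_zero]]
  have hi := LocallyIntegrableOn.intervalIntegrable_Ioo h.locallyIntegrableOn haA hbA
  set F : ℝ → ℝ := fun r => ∫ s in a..r, Q s
  have hF : AbsolutelyContinuousOnInterval F a b :=
    hi.absolutelyContinuousOnInterval_intervalIntegral (by simp)
  have hχAC : AbsolutelyContinuousOnInterval χ a b :=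
    hχ.contDiffOn.absolutelyContinuousOnInterval
  have h1 := hF.integral_mul_deriv_eq_deriv_mul hχAC
  rw [(hz a (by simp)).1, (hz b (by simp)).1, mul_zero, mul_zero, sub_zero, zero_sub] at h1
  have h2 : ∫ r in a..b, deriv F r * χ r = ∫ r in a..b, Q r * χ r := by
    refine intervalIntegral.integral_congr_ae ?_
    filter_upwards [hi.ae_hasDerivAt_integral] with r hr hr'
    rw [(hr (uIoc_subset_uIcc hr') a (by simp)).deriv]
  have h3 : ∫ r in a..b, P r * deriv χ r = ∫ r in a..b, (P a * deriv χ r + F r * deriv χ r) := by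
    refine intervalIntegral.integral_congr fun r hr => ?_
    rw [h.eq_add haA (uIcc_subset_Ioo haA hbA hr)]
    ring
  have hχc : IntervalIntegrable (deriv χ) volume a b :=
    (hχ.continuous_deriv le_rfl).intervalIntegrable _ _
  have h4 : ∫ r in a..b, deriv χ r = 0 := by
    rw [intervalIntegral.integral_deriv_eq_sub
      (fun s _ => hχ.differentiable one_ne_zero s) hχc, (hz a (by simp)).1, (hz b (by simp)).1,
      sub_zero]
  rw [h3, intervalIntegral.integral_add (hχc.const_mul _)
    (hχc.continuousOn_mul hF.continuousOn), intervalIntegral.integral_const_mul, h4, mul_zero,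
    zero_add, h1, h2]

/-- The **du Bois-Reymond lemma** on `(0, 1)`. -/
theorem exists_const_of_integral_mul_deriv_eq_zero {w : ℝ → ℝ}
    (hw : LocallyIntegrableOn w (Ioo 0 1))
    (h : ∀ χ : ℝ → ℝ, ContDiff ℝ ∞ χ → HasCompactSupport χ → tsupport χ ⊆ Ioo 0 1 →
      ∫ r in Ioo (0 : ℝ) 1, w r * deriv χ r = 0) :
    ∃ C : ℝ, ∀ᵐ r ∂(volume.restrict (Ioo (0 : ℝ) 1)), w r = C := by
  let B : ContDiffBump (1 / 2 : ℝ) := ⟨1 / 8, 1 / 4, by norm_num, by norm_num⟩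
  set χ₀ : ℝ → ℝ := B.normed volume
  have hχ₀ : ContDiff ℝ ∞ χ₀ := B.contDiff_normed
  have hχ₀c : HasCompactSupport χ₀ := B.hasCompactSupport_normed
  have hχ₀s : tsupport χ₀ ⊆ Ioo 0 1 := by
    rw [B.tsupport_normed_eq]
    intro x hx
    rw [Metric.mem_closedBall, Real.dist_eq] at hx
    have hx' : |x - 1 / 2| ≤ 1 / 4 := hx
    rw [abs_le] at hx'
    constructor <;> linarith [hx'.1, hx'.2]
  have hχ₀i : ∫ r, χ₀ r = 1 := B.integral_normed
  have hset : ∀ (f φ : ℝ → ℝ), tsupport φ ⊆ Ioo 0 1 →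
      ∫ r in Ioo (0 : ℝ) 1, f r * φ r = ∫ r, f r * φ r := fun f φ hs =>
    setIntegral_eq_integral_of_forall_compl_eq_zero fun x hx => by
      rw [image_eq_zero_of_notMem_tsupport fun h' => hx (hs h'), mul_zero]
  have hwφ : ∀ φ : ℝ → ℝ, Continuous φ → HasCompactSupport φ → tsupport φ ⊆ Ioo 0 1 →
      Integrable fun r => w r * φ r := fun φ h1 h2 h3 =>
    integrable_mul_of_tsupport_subset hw h1 h2 h3
  refine ⟨∫ r, w r * χ₀ r, ?_⟩
  set C := ∫ r, w r * χ₀ r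
  have h0 : ∀ᵐ r ∂volume, r ∈ Ioo (0 : ℝ) 1 → w r - C = 0 := by
    refine isOpen_Ioo.ae_eq_zero_of_integral_contDiff_smul_eq_zero
      (hw.sub ((locallyIntegrable_const C).locallyIntegrableOn _)) fun ψ hψ hψc hψs => ?_
    set I := ∫ r, ψ r
    -- Subtracting a multiple of the normalized bump makes the mean zero, so the primitive χ of ρ is
    -- again a test function.
    set ρ : ℝ → ℝ := fun r => ψ r - I * χ₀ r
    have hρ : ContDiff ℝ ∞ ρ := hψ.sub (contDiff_const.mul hχ₀)
    set χ : ℝ → ℝ := fun r => ∫ s in (0 : ℝ)..r, ρ s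
    have hχd : ∀ r, HasDerivAt χ (ρ r) r := fun r =>
      hρ.continuous.integral_hasStrictDerivAt 0 r |>.hasDerivAt
    have hχ' : deriv χ = ρ := funext fun r => (hχd r).deriv
    have hχC : ContDiff ℝ ∞ χ := by
      rw [contDiff_infty_iff_deriv]
      exact ⟨fun r => (hχd r).differentiableAt, hχ' ▸ hρ⟩
    obtain ⟨a, b, ha, hab, hb, hK⟩ := exists_Icc_of_isCompact_subset_Ioo
      (hψc.isCompact.union hχ₀c.isCompact) (union_subset hψs hχ₀s)
    have hz : ∀ r, r ∉ Ioo a b → ρ r = 0 := fun r hr => by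
      have h1 : ψ r = 0 := image_eq_zero_of_notMem_tsupport fun h' => hr (hK (Or.inl h'))
      have h2 : χ₀ r = 0 := image_eq_zero_of_notMem_tsupport fun h' => hr (hK (Or.inr h'))
      simp [ρ, h1, h2]
    have hψi : Integrable ψ := hψ.continuous.integrable_of_hasCompactSupport hψc
    have hχ₀i' : Integrable χ₀ := hχ₀.continuous.integrable_of_hasCompactSupport hχ₀c
    have hρ0 : ∫ r, ρ r = 0 := by
      rw [integral_sub hψi (hχ₀i'.const_mul _), integral_const_mul, hχ₀i, mul_one, sub_self]
    have hχz : ∀ r, r ∉ Icc a b → χ r = 0 := by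
      intro r hr
      rw [mem_Icc, not_and_or, not_le, not_le] at hr
      rcases hr with hr | hr
      · refine (intervalIntegral.integral_congr (g := fun _ => 0)
          fun s hs => hz s fun h' => ?_).trans
          (by simp)
        have := hs.2
        have h2 : max 0 r < a := max_lt ha hr
        linarith [h'.1]
      · rw [← hρ0]
        simp only [χ]
        rw [intervalIntegral.integral_of_le (by linarith)]
        refine setIntegral_eq_integral_of_forall_compl_eq_zero fun s hs => hz s fun h' => hs ?_
        exact ⟨ha.trans h'.1, (h'.2.trans hr).le⟩
    have hχs : tsupport χ ⊆ Icc a b := closure_minimal (fun r hr => by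
      by_contra h'
      exact hr (hχz r h')) isClosed_Icc
    have hχc : HasCompactSupport χ :=
      isCompact_Icc.of_isClosed_subset (isClosed_tsupport _) hχs
    have h1 := h χ hχC hχc (hχs.trans fun r hr => ⟨ha.trans_le hr.1, hr.2.trans_lt hb⟩)
    have i1 := hwφ ψ hψ.continuous hψc hψs
    have i2 := hwφ χ₀ hχ₀.continuous hχ₀c hχ₀s
    have e1 : ∫ r in Ioo (0 : ℝ) 1, w r * deriv χ r = (∫ r, w r * ψ r) - I * C := by
      rw [hset w _ ((tsupport_deriv_subset (f := χ)).trans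
        (hχs.trans fun r hr => ⟨ha.trans_le hr.1, hr.2.trans_lt hb⟩)), hχ',
        ← integral_const_mul, ← integral_sub i1 (i2.const_mul _)]
      exact integral_congr_ae (Filter.Eventually.of_forall fun r => by simp only [ρ]; ring)
    have e2 : ∫ r, ψ r • (w r - C) = (∫ r, w r * ψ r) - I * C := by
      rw [mul_comm I, ← integral_const_mul, ← integral_sub i1 (hψi.const_mul _)]
      exact integral_congr_ae (Filter.Eventually.of_forall fun r => by
        simp only [smul_eq_mul]; ring)
    rw [e2, ← e1, h1]
  rw [ae_restrict_iff' measurableSet_Ioo]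
  exact h0.mono fun r hr hr' => sub_eq_zero.1 (hr hr')

/-- The difference between f and a primitive of Q has zero weak derivative, hence is almost
everywhere constant. -/
theorem exists_isPrimitive {f Q : ℝ → ℝ} (hf : LocallyIntegrableOn f (Ioo 0 1))
    (hQ : LocallyIntegrableOn Q (Ioo 0 1))
    (h : ∀ χ : ℝ → ℝ, ContDiff ℝ ∞ χ → HasCompactSupport χ → tsupport χ ⊆ Ioo 0 1 →
      ∫ r in Ioo (0 : ℝ) 1, f r * deriv χ r = -∫ r in Ioo (0 : ℝ) 1, Q r * χ r) :
    ∃ P : ℝ → ℝ, IsPrimitive P Q ∧ ∀ᵐ r ∂(volume.restrict (Ioo (0 : ℝ) 1)), f r = P r := by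
  have hhalf : (1 / 2 : ℝ) ∈ Ioo (0 : ℝ) 1 := by norm_num
  set P₀ : ℝ → ℝ := fun r => ∫ s in (1 / 2 : ℝ)..r, Q s
  have hP₀ : IsPrimitive P₀ Q := ⟨hQ, fun a ha b hb =>
    intervalIntegral.integral_interval_sub_left
      (LocallyIntegrableOn.intervalIntegrable_Ioo hQ hhalf hb)
      (LocallyIntegrableOn.intervalIntegrable_Ioo hQ hhalf ha)⟩
  have hP₀l : LocallyIntegrableOn P₀ (Ioo 0 1) :=
    hP₀.continuousOn.locallyIntegrableOn measurableSet_Ioo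
  obtain ⟨C, hC⟩ := exists_const_of_integral_mul_deriv_eq_zero (hf.sub hP₀l)
    fun χ hχ hχc hχs => by
      have hχ1 : ContDiff ℝ 1 χ := hχ.of_le (by norm_num)
      have hs' := (tsupport_deriv_subset (f := χ)).trans hχs
      have hc' : HasCompactSupport (deriv χ) := hχc.deriv
      have i1 := integrable_mul_of_tsupport_subset hf (hχ1.continuous_deriv le_rfl) hc' hs'
      have i2 := integrable_mul_of_tsupport_subset hP₀l (hχ1.continuous_deriv le_rfl) hc' hs'
      simp only [Pi.sub_apply, sub_mul]
      rw [integral_sub i1.integrableOn i2.integrableOn, h χ hχ hχc hχs,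
        hP₀.integral_mul_deriv hχ1 hχc hχs, sub_self]
  refine ⟨fun r => P₀ r + C, ⟨hQ, fun a ha b hb => ?_⟩, ?_⟩
  · rw [← hP₀.sub_eq a ha b hb]; ring
  · filter_upwards [hC] with r hr
    simp only [Pi.sub_apply] at hr
    linarith

end Primitive

/-! ### Polar coordinates. -/

section Polar

variable {n : ℕ}

/-- The integral of `h` over the sphere of radius `r`, with respect to the surface measure of the
unit sphere. -/
def sphereIntegral (h : EuclideanSpace ℝ (Fin n) → ℝ) (r : ℝ) : ℝ :=
  ∫ θ : Metric.sphere (0 : EuclideanSpace ℝ (Fin n)) 1, h (r • (θ : EuclideanSpace ℝ (Fin n)))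
    ∂(volume : Measure (EuclideanSpace ℝ (Fin n))).toSphere

theorem ae_volumeIoiPow_iff (m : ℕ) {S : ℝ → Prop} :
    (∀ᵐ r : Ioi (0 : ℝ) ∂Measure.volumeIoiPow m, S (r : ℝ)) ↔
      ∀ᵐ r ∂(volume.restrict (Ioi (0 : ℝ))), S r := by
  rw [Measure.volumeIoiPow, ae_withDensity_iff (by fun_prop), ae_restrict_iff_subtype
    measurableSet_Ioi]
  refine ⟨fun h => h.mono fun r hr => hr ?_, fun h => h.mono fun r hr _ => hr⟩
  exact (ENNReal.ofReal_pos.2 (pow_pos r.2 m)).ne'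

theorem integrable_volumeIoiPow_iff (m : ℕ) {F : ℝ → ℝ} :
    Integrable (fun r : Ioi (0 : ℝ) => F r) (Measure.volumeIoiPow m) ↔
      IntegrableOn (fun r => r ^ m * F r) (Ioi 0) := by
  rw [integrableOn_iff_comap_subtypeVal measurableSet_Ioi, Measure.volumeIoiPow,
    integrable_withDensity_iff_integrable_smul' (by fun_prop) (by simp)]
  refine integrable_congr (Filter.Eventually.of_forall fun r => ?_)
  simp only [Function.comp, smul_eq_mul]
  rw [ENNReal.toReal_ofReal (pow_nonneg (le_of_lt r.2) m)]

theorem integral_volumeIoiPow (m : ℕ) (F : ℝ → ℝ) :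
    ∫ r : Ioi (0 : ℝ), F r ∂Measure.volumeIoiPow m = ∫ r in Ioi (0 : ℝ), r ^ m * F r := by
  simp only [Measure.volumeIoiPow, ENNReal.ofReal]
  rw [integral_withDensity_eq_integral_smul,
    integral_subtype_comap measurableSet_Ioi fun a => Real.toNNReal (a ^ m) • F a,
    setIntegral_congr_fun measurableSet_Ioi fun x hx => ?_]
  · rw [NNReal.smul_def, Real.coe_toNNReal _ (pow_nonneg (le_of_lt hx) _), smul_eq_mul]
  · exact (measurable_subtype_coe.pow_const _).real_toNNReal

theorem measurePreserving_polar : MeasurePreserving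
    (homeomorphUnitSphereProd (EuclideanSpace ℝ (Fin n))).symm
    ((volume : Measure (EuclideanSpace ℝ (Fin n))).toSphere.prod (Measure.volumeIoiPow (n - 1)))
    ((volume : Measure (EuclideanSpace ℝ (Fin n))).comap Subtype.val) := by
  have h := (volume : Measure (EuclideanSpace ℝ (Fin n))).measurePreserving_homeomorphUnitSphereProd
  rw [finrank_euclideanSpace_fin] at h
  exact h.symm (homeomorphUnitSphereProd (EuclideanSpace ℝ (Fin n))).toMeasurableEquiv

theorem measurableEmbedding_polar : MeasurableEmbedding
    (homeomorphUnitSphereProd (EuclideanSpace ℝ (Fin n))).symm :=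
  (homeomorphUnitSphereProd (EuclideanSpace ℝ (Fin n))).symm.measurableEmbedding

theorem integrable_polar {h : EuclideanSpace ℝ (Fin n) → ℝ} (hh : Integrable h) :
    Integrable (fun q : Metric.sphere (0 : EuclideanSpace ℝ (Fin n)) 1 × Ioi (0 : ℝ) =>
      h ((q.2 : ℝ) • (q.1 : EuclideanSpace ℝ (Fin n))))
      ((volume : Measure (EuclideanSpace ℝ (Fin n))).toSphere.prod
        (Measure.volumeIoiPow (n - 1))) := by
  have h1 : Integrable (fun x : ({0}ᶜ : Set (EuclideanSpace ℝ (Fin n))) => h x)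
      ((volume : Measure (EuclideanSpace ℝ (Fin n))).comap Subtype.val) :=
    (integrableOn_iff_comap_subtypeVal (measurableSet_singleton _).compl).1 hh.integrableOn
  exact (measurePreserving_polar.integrable_comp_emb measurableEmbedding_polar).2 h1

theorem ae_polar {T : EuclideanSpace ℝ (Fin n) → Prop} (hT : ∀ᵐ x, T x) :
    ∀ᵐ q ∂((volume : Measure (EuclideanSpace ℝ (Fin n))).toSphere.prod
        (Measure.volumeIoiPow (n - 1))), T ((q.2 : ℝ) • (q.1 : EuclideanSpace ℝ (Fin n))) := by
  have h1 : ∀ᵐ x : ({0}ᶜ : Set (EuclideanSpace ℝ (Fin n)))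
      ∂((volume : Measure (EuclideanSpace ℝ (Fin n))).comap Subtype.val), T x := by
    rw [← ae_restrict_iff_subtype (measurableSet_singleton _).compl]
    exact ae_restrict_of_ae hT
  exact measurePreserving_polar.quasiMeasurePreserving.ae h1

theorem norm_smul_sphere {r : ℝ} (hr : 0 ≤ r)
    (θ : Metric.sphere (0 : EuclideanSpace ℝ (Fin n)) 1) :
    ‖r • (θ : EuclideanSpace ℝ (Fin n))‖ = r := by
  rw [norm_smul, Real.norm_of_nonneg hr, mem_sphere_zero_iff_norm.1 θ.2, mul_one]

theorem integrableOn_pow_mul_sphereIntegral {h : EuclideanSpace ℝ (Fin n) → ℝ}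
    (hh : Integrable h) :
    IntegrableOn (fun r => r ^ (n - 1) * sphereIntegral h r) (Ioi 0) := by
  rw [← integrable_volumeIoiPow_iff]
  exact (integrable_polar hh).integral_prod_right

theorem ae_ae_sphere {T : EuclideanSpace ℝ (Fin n) → Prop} (hT : ∀ᵐ x, T x) :
    ∀ᵐ r ∂(volume.restrict (Ioi (0 : ℝ))),
      ∀ᵐ θ : Metric.sphere (0 : EuclideanSpace ℝ (Fin n)) 1
        ∂(volume : Measure (EuclideanSpace ℝ (Fin n))).toSphere,
        T (r • (θ : EuclideanSpace ℝ (Fin n))) := by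
  rw [← ae_volumeIoiPow_iff (n - 1)]
  exact Measure.ae_ae_of_ae_prod (Measure.measurePreserving_swap.quasiMeasurePreserving.ae
    (ae_polar hT))

theorem locallyIntegrableOn_sphereIntegral {h : EuclideanSpace ℝ (Fin n) → ℝ}
    (hh : LocallyIntegrableOn h (puncturedBall n)) :
    LocallyIntegrableOn (sphereIntegral h) (Ioo 0 1) := by
  rw [locallyIntegrableOn_iff isOpen_Ioo.isLocallyClosed]
  intro K hK hKc
  obtain ⟨a, b, ha, hab, hb, hKab⟩ := exists_Icc_of_isCompact_subset_Ioo hKc hK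
  have h1 : IntegrableOn h {x | ‖x‖ ∈ Icc a b} :=
    hh.integrableOn_compact_subset (annulus_subset_puncturedBall ha hb) (isCompact_annulus a b)
  have hmeas : MeasurableSet {x : EuclideanSpace ℝ (Fin n) | ‖x‖ ∈ Icc a b} :=
    (isCompact_annulus a b).measurableSet
  have h2 := (integrableOn_pow_mul_sphereIntegral
    ((integrable_indicator_iff hmeas).2 h1)).mono_set
    (fun r hr => ha.trans_le hr.1 : Icc a b ⊆ Ioi (0 : ℝ))
  have h3 : IntegrableOn (fun r => r ^ (n - 1) * sphereIntegral h r) (Icc a b) := by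
    refine h2.congr_fun (fun r hr => ?_) measurableSet_Icc
    have hr0 : 0 ≤ r := ha.le.trans hr.1
    simp only [sphereIntegral]
    congr 1
    refine integral_congr_ae (Filter.Eventually.of_forall fun θ => ?_)
    refine indicator_of_mem ?_ _
    simp only [mem_ofPred_eq]
    rwa [norm_smul_sphere hr0]
  have h4 : IntegrableOn (fun r => (r ^ (n - 1))⁻¹ * (r ^ (n - 1) * sphereIntegral h r))
      (Icc a b) := by
    refine h3.continuousOn_mul ?_ isCompact_Icc
    exact ((continuous_pow _).continuousOn).inv₀ fun r hr => pow_ne_zero _ (ha.trans_le hr.1).ne'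
  have h5 : IntegrableOn (sphereIntegral h) (Icc a b) := by
    refine h4.congr_fun (fun r hr => ?_) measurableSet_Icc
    simp only
    rw [← mul_assoc, inv_mul_cancel₀ (pow_ne_zero _ (ha.trans_le hr.1).ne'), one_mul]
  exact h5.mono_set (hKab.trans Ioo_subset_Icc_self)

theorem sphereIntegral_of_radial {w : EuclideanSpace ℝ (Fin n) → ℝ} {f : ℝ → ℝ}
    (hw : ∀ᵐ x ∂(volume.restrict (puncturedBall n)), w x = f ‖x‖) :
    ∀ᵐ r ∂(volume.restrict (Ioo (0 : ℝ) 1)), sphereIntegral w r =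
      (volume : Measure (EuclideanSpace ℝ (Fin n))).toSphere.real univ * f r := by
  rw [ae_restrict_iff' isOpen_puncturedBall.measurableSet] at hw
  have h := ae_restrict_of_ae_restrict_of_subset
    (fun r hr => hr.1 : Ioo (0 : ℝ) 1 ⊆ Ioi 0) (ae_ae_sphere hw)
  filter_upwards [h, ae_restrict_mem measurableSet_Ioo] with r hr hr1
  unfold sphereIntegral
  have : ∀ᵐ θ : Metric.sphere (0 : EuclideanSpace ℝ (Fin n)) 1
        ∂(volume : Measure (EuclideanSpace ℝ (Fin n))).toSphere,
        w (r • (θ : EuclideanSpace ℝ (Fin n))) = f r := by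
    filter_upwards [hr] with θ hθ
    have hn := norm_smul_sphere hr1.1.le θ
    rw [hθ (mem_puncturedBall.2 (by rwa [hn])), hn]
  rw [integral_congr_ae this, integral_const, smul_eq_mul]

theorem sphereIntegral_eq_zero {T : EuclideanSpace ℝ (Fin n) → ℝ} {s : Set ℝ}
    (hT : ∀ x, ‖x‖ ∉ s → T x = 0) {r : ℝ} (hr : 0 ≤ r) (hrs : r ∉ s) :
    sphereIntegral T r = 0 := by
  unfold sphereIntegral
  rw [integral_congr_ae (g := fun _ => 0) (Filter.Eventually.of_forall fun θ =>
    hT _ (by rwa [norm_smul_sphere hr])), integral_zero]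

variable [NeZero n]

theorem integral_eq_integral_sphereIntegral {h : EuclideanSpace ℝ (Fin n) → ℝ}
    (hh : Integrable h) :
    ∫ x, h x = ∫ r in Ioi (0 : ℝ), r ^ (n - 1) * sphereIntegral h r := by
  have : Nontrivial (EuclideanSpace ℝ (Fin n)) := by
    have : Nonempty (Fin n) := ⟨0⟩
    infer_instance
  rw [← integral_volumeIoiPow]
  have h1 : ∫ x, h x = ∫ x : ({0}ᶜ : Set (EuclideanSpace ℝ (Fin n))), h x
      ∂((volume : Measure (EuclideanSpace ℝ (Fin n))).comap Subtype.val) := by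
    rw [integral_subtype_comap (measurableSet_singleton _).compl h,
      restrict_compl_singleton]
  rw [h1, ← measurePreserving_polar.integral_comp measurableEmbedding_polar]
  exact integral_prod_symm _ (integrable_polar hh)

theorem toSphere_volume_ne_zero :
    (volume : Measure (EuclideanSpace ℝ (Fin n))).toSphere ≠ 0 := by
  have : Nontrivial (EuclideanSpace ℝ (Fin n)) := by
    have : Nonempty (Fin n) := ⟨0⟩
    infer_instance
  exact Measure.toSphere_ne_zero _

/-- In polar coordinates Lebesgue measure is a product with a nonzero measure on the sphere, so a
radial set is null exactly when its set of radii is. -/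
theorem ae_norm_iff {S : ℝ → Prop} :
    (∀ᵐ x : EuclideanSpace ℝ (Fin n), S ‖x‖) ↔ ∀ᵐ r ∂(volume.restrict (Ioi (0 : ℝ))), S r := by
  constructor
  · intro h
    have : NeBot (ae (volume : Measure (EuclideanSpace ℝ (Fin n))).toSphere) :=
      ae_neBot.2 toSphere_volume_ne_zero
    filter_upwards [ae_ae_sphere h, ae_restrict_mem measurableSet_Ioi] with r hr hr0
    obtain ⟨θ, hθ⟩ := hr.exists
    rwa [norm_smul_sphere (le_of_lt hr0)] at hθ
  · intro h
    rw [← ae_volumeIoiPow_iff (n - 1)] at h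
    have : Nontrivial (EuclideanSpace ℝ (Fin n)) := by
      have : Nonempty (Fin n) := ⟨0⟩
      infer_instance
    have h1 : ∀ᵐ q ∂((volume : Measure (EuclideanSpace ℝ (Fin n))).toSphere.prod
        (Measure.volumeIoiPow (n - 1))), S (q.2 : ℝ) :=
      Measure.quasiMeasurePreserving_snd.ae h
    have hmp : MeasurePreserving (homeomorphUnitSphereProd (EuclideanSpace ℝ (Fin n)))
        ((volume : Measure (EuclideanSpace ℝ (Fin n))).comap Subtype.val)
        ((volume : Measure (EuclideanSpace ℝ (Fin n))).toSphere.prod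
          (Measure.volumeIoiPow (n - 1))) := by
      have h := (volume : Measure
        (EuclideanSpace ℝ (Fin n))).measurePreserving_homeomorphUnitSphereProd
      rwa [finrank_euclideanSpace_fin] at h
    have h2 := hmp.quasiMeasurePreserving.ae h1
    simp only [homeomorphUnitSphereProd_apply_snd_coe] at h2
    rw [← ae_restrict_iff_subtype (measurableSet_singleton _).compl
      (p := fun x : EuclideanSpace ℝ (Fin n) => S ‖x‖), restrict_compl_singleton] at h2
    exact h2

theorem ae_unitBall_norm_iff {S : ℝ → Prop} :
    (∀ᵐ x ∂(volume.restrict (unitBall n)), S ‖x‖) ↔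
      ∀ᵐ r ∂(volume.restrict (Ioo (0 : ℝ) 1)), S r := by
  rw [ae_restrict_iff' isOpen_unitBall.measurableSet, ae_restrict_iff' measurableSet_Ioo]
  have h := ae_norm_iff (n := n) (S := fun r => r < 1 → S r)
  rw [ae_restrict_iff' measurableSet_Ioi] at h
  simp only [mem_unitBall, mem_Ioo]
  rw [h]
  exact ⟨fun h' => h'.mono fun r hr hr' => hr hr'.1 hr'.2,
    fun h' => h'.mono fun r hr h0 h1 => hr ⟨h0, h1⟩⟩

theorem restrict_puncturedBall :
    (volume : Measure (EuclideanSpace ℝ (Fin n))).restrict (puncturedBall n) =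
      volume.restrict (unitBall n) := by
  have : Nontrivial (EuclideanSpace ℝ (Fin n)) := by
    have : Nonempty (Fin n) := ⟨0⟩
    infer_instance
  exact Measure.restrict_congr_set (sdiff_null_ae_eq_self (measure_singleton 0))

theorem setIntegral_mul_comp_norm {h : EuclideanSpace ℝ (Fin n) → ℝ} {y : ℝ → ℝ}
    (hi : IntegrableOn (fun x => h x * y ‖x‖) (puncturedBall n)) :
    ∫ x in puncturedBall n, h x * y ‖x‖ =
      ∫ r in Ioo (0 : ℝ) 1, r ^ (n - 1) * y r * sphereIntegral h r := by
  have hm := (isOpen_puncturedBall (n := n)).measurableSet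
  rw [← integral_indicator hm, integral_eq_integral_sphereIntegral
    ((integrable_indicator_iff hm).2 hi)]
  have e : ∀ r ∈ Ioi (0 : ℝ), r ^ (n - 1) *
      sphereIntegral ((puncturedBall n).indicator fun x => h x * y ‖x‖) r =
      (Ioo (0 : ℝ) 1).indicator (fun r => r ^ (n - 1) * y r * sphereIntegral h r) r := by
    intro r hr
    have hr0 : (0 : ℝ) ≤ r := le_of_lt hr
    by_cases hr1 : r ∈ Ioo (0 : ℝ) 1
    · have e2 : sphereIntegral ((puncturedBall n).indicator fun x => h x * y ‖x‖) r =
          sphereIntegral (fun x => h x * y ‖x‖) r := by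
        refine integral_congr_ae (Filter.Eventually.of_forall fun θ => ?_)
        exact indicator_of_mem (mem_puncturedBall.2 (by rwa [norm_smul_sphere hr0])) _
      rw [indicator_of_mem hr1, e2]
      unfold sphereIntegral
      simp_rw [norm_smul_sphere hr0]
      rw [integral_mul_const]
      ring
    · rw [indicator_of_notMem hr1, sphereIntegral_eq_zero (s := Ioo (0 : ℝ) 1) _ hr0 hr1, mul_zero]
      exact fun x hx => indicator_of_notMem (fun h' => hx (mem_puncturedBall.1 h')) _
  rw [setIntegral_congr_fun measurableSet_Ioi e, setIntegral_indicator measurableSet_Ioo,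
    inter_eq_self_of_subset_right fun r hr => hr.1]

theorem integral_mul_comp_norm {h : EuclideanSpace ℝ (Fin n) → ℝ}
    (hh : LocallyIntegrableOn h (puncturedBall n)) {y : ℝ → ℝ} (hy : Continuous y)
    (hyc : HasCompactSupport y) (hys : tsupport y ⊆ Ioo 0 1) :
    ∫ x in puncturedBall n, h x * y ‖x‖ =
      ∫ r in Ioo (0 : ℝ) 1, r ^ (n - 1) * y r * sphereIntegral h r := by
  have ht := isTestFunction_puncturedBall_comp_norm (n := n) (m := 0)
    (contDiff_zero.2 hy) hyc hys
  exact setIntegral_mul_comp_norm (integrable_mul_of_tsupport_subset hh ht.1.continuous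
    ht.2.1 ht.2.2).integrableOn

theorem toSphere_real_univ_pos :
    0 < (volume : Measure (EuclideanSpace ℝ (Fin n))).toSphere.real univ := by
  rw [measureReal_def]
  exact ENNReal.toReal_pos (Measure.measure_univ_ne_zero.2 toSphere_volume_ne_zero)
    (measure_ne_top _ _)

theorem integrableOn_unitBall_comp_norm_iff {y : ℝ → ℝ} :
    IntegrableOn (fun x : EuclideanSpace ℝ (Fin n) => y ‖x‖) (unitBall n) ↔
      IntegrableOn (fun r => r ^ (n - 1) * y r) (Ioo 0 1) := by
  have : Nontrivial (EuclideanSpace ℝ (Fin n)) := by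
    have : Nonempty (Fin n) := ⟨0⟩
    infer_instance
  have h := integrableOn_fun_norm_addHaar (volume : Measure (EuclideanSpace ℝ (Fin n)))
    (f := y) (r := 1)
  rw [finrank_euclideanSpace_fin] at h
  simpa [unitBall] using h

theorem exists_integral_unitBall_comp_norm (n : ℕ) [NeZero n] : ∃ κ : ℝ, 0 < κ ∧ ∀ y : ℝ → ℝ,
    ∫ x in unitBall n, y ‖x‖ = κ * ∫ r in Ioo (0 : ℝ) 1, r ^ (n - 1) * y r := by
  have : Nontrivial (EuclideanSpace ℝ (Fin n)) := by
    have : Nonempty (Fin n) := ⟨0⟩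
    infer_instance
  refine ⟨n * (volume : Measure (EuclideanSpace ℝ (Fin n))).real (Metric.ball 0 1), ?_, ?_⟩
  · refine mul_pos (by exact_mod_cast NeZero.pos n) ?_
    rw [measureReal_def]
    exact ENNReal.toReal_pos (Metric.measure_ball_pos _ _ one_pos).ne' measure_ball_lt_top.ne
  · intro y
    have h1 : ∫ x in unitBall n, y ‖x‖ =
        ∫ x : EuclideanSpace ℝ (Fin n), (Iio 1).indicator y ‖x‖ := by
      rw [← integral_indicator isOpen_unitBall.measurableSet]
      refine integral_congr_ae (Filter.Eventually.of_forall fun x => ?_)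
      simp [indicator, mem_unitBall]
    have h2 := integral_fun_norm_addHaar (volume : Measure (EuclideanSpace ℝ (Fin n)))
      ((Iio 1).indicator y)
    rw [finrank_euclideanSpace_fin] at h2
    rw [h1, h2, nsmul_eq_mul, smul_eq_mul, ← mul_assoc]
    congr 1
    have h3 : ∀ r ∈ Ioi (0 : ℝ), r ^ (n - 1) • (Iio (1 : ℝ)).indicator y r =
        (Ioo (0 : ℝ) 1).indicator (fun r => r ^ (n - 1) * y r) r := by
      intro r hr
      by_cases hr1 : r < 1
      · rw [indicator_of_mem (mem_Iio.2 hr1),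
          indicator_of_mem (show r ∈ Ioo (0 : ℝ) 1 from ⟨hr, hr1⟩),
          smul_eq_mul]
      · rw [indicator_of_notMem (by simpa using hr1), indicator_of_notMem fun h => hr1 h.2,
          smul_zero]
    rw [setIntegral_congr_fun measurableSet_Ioi h3, setIntegral_indicator measurableSet_Ioo]
    congr 2
    ext r
    simp only [mem_inter_iff, mem_Ioi, mem_Ioo]
    tauto

end Polar

/-! ### Weak gradients of radial functions. -/

section RadialSobolev

variable {n : ℕ}

theorem IsPrimitive.integral_mul_eq_neg {P Q Y F : ℝ → ℝ} (h : IsPrimitive P Q)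
    (h' : IsPrimitive Y F) {a b : ℝ} (ha : a ∈ Ioo (0 : ℝ) 1) (hb : b ∈ Ioo (0 : ℝ) 1)
    (hYa : Y a = 0) (hYb : Y b = 0) :
    ∫ r in a..b, P r * F r = -∫ r in a..b, Q r * Y r := by
  have hi := LocallyIntegrableOn.intervalIntegrable_Ioo h.locallyIntegrableOn ha hb
  have hi' := LocallyIntegrableOn.intervalIntegrable_Ioo h'.locallyIntegrableOn ha hb
  set A : ℝ → ℝ := fun r => ∫ s in a..r, Q s
  set B : ℝ → ℝ := fun r => ∫ s in a..r, F s
  have hA : AbsolutelyContinuousOnInterval A a b :=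
    hi.absolutelyContinuousOnInterval_intervalIntegral (by simp)
  have hB : AbsolutelyContinuousOnInterval B a b :=
    hi'.absolutelyContinuousOnInterval_intervalIntegral (by simp)
  have hBY : ∀ r ∈ uIcc a b, Y r = B r := fun r hr => by
    rw [h'.eq_add ha (uIcc_subset_Ioo ha hb hr), hYa, zero_add]
  have hBb : B b = 0 := by rw [← hBY b (by simp), hYb]
  have hBa : B a = 0 := intervalIntegral.integral_same
  have h1 := hA.integral_mul_deriv_eq_deriv_mul hB
  rw [hBa, hBb, mul_zero, mul_zero, sub_zero, zero_sub] at h1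
  have h2 : ∫ r in a..b, deriv A r * B r = ∫ r in a..b, Q r * Y r := by
    refine intervalIntegral.integral_congr_ae ?_
    filter_upwards [hi.ae_hasDerivAt_integral] with r hr hr'
    rw [(hr (uIoc_subset_uIcc hr') a (by simp)).deriv, hBY r (uIoc_subset_uIcc hr')]
  have h3 : ∫ r in a..b, A r * deriv B r = ∫ r in a..b, A r * F r := by
    refine intervalIntegral.integral_congr_ae ?_
    filter_upwards [hi'.ae_hasDerivAt_integral] with r hr hr'
    rw [(hr (uIoc_subset_uIcc hr') a (by simp)).deriv]
  have h4 : ∫ r in a..b, P r * F r = ∫ r in a..b, (P a * F r + A r * F r) := by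
    refine intervalIntegral.integral_congr fun r hr => ?_
    rw [h.eq_add ha (uIcc_subset_Ioo ha hb hr)]
    ring
  rw [h4, intervalIntegral.integral_add (hi'.const_mul _) (hi'.continuousOn_mul hA.continuousOn),
    intervalIntegral.integral_const_mul, ← h3, h1, h2]
  change P a * B b + _ = _
  rw [hBb, mul_zero, zero_add]

variable [NeZero n]

theorem locallyIntegrableOn_comp_norm {Q : ℝ → ℝ} (hQ : LocallyIntegrableOn Q (Ioo 0 1)) :
    LocallyIntegrableOn (fun x : EuclideanSpace ℝ (Fin n) => Q ‖x‖) (puncturedBall n) := by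
  rw [locallyIntegrableOn_iff isOpen_puncturedBall.isLocallyClosed]
  intro K hK hKc
  obtain ⟨a, b, ha, hab, hb, hKab⟩ := exists_norm_bounds hKc hK
  have hsub : Icc a b ⊆ Ioo (0 : ℝ) 1 := fun r hr => ⟨ha.trans_le hr.1, hr.2.trans_lt hb⟩
  have h1 : IntegrableOn (fun r => r ^ (n - 1) * Q r) (Icc a b) :=
    (hQ.integrableOn_compact_subset hsub isCompact_Icc).continuousOn_mul
      (continuous_pow _).continuousOn isCompact_Icc
  have h2 : IntegrableOn (fun r => r ^ (n - 1) * (Icc a b).indicator Q r) (Ioo 0 1) := by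
    have : (fun r => r ^ (n - 1) * (Icc a b).indicator Q r) =
        (Icc a b).indicator fun r => r ^ (n - 1) * Q r := by
      funext r
      by_cases hr : r ∈ Icc a b
      · simp [hr]
      · simp [hr]
    rw [this]
    exact ((integrable_indicator_iff measurableSet_Icc).2 h1).integrableOn
  refine ((integrableOn_unitBall_comp_norm_iff.2 h2).mono_set
    (hK.trans puncturedBall_subset_unitBall)).congr_fun (fun x hx => ?_) hKc.measurableSet
  exact indicator_of_mem (Ioo_subset_Icc_self (hKab x hx)) _

/-- Polar coordinates turn the claim into an integration by parts on (0, 1) of P against spherical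
integrals. With T = ∂_i φ and T' = x_i φ/|x|, the divergence theorem on shells makes r^{n-1} times
the spherical integral of T' a primitive of r^{n-1} times that of T. -/
theorem IsPrimitive.hasWeakPartial_comp_norm {P Q : ℝ → ℝ} (h : IsPrimitive P Q) (i : Fin n) :
    HasWeakPartial (puncturedBall n) i (fun x => P ‖x‖) (fun x => x i / ‖x‖ * Q ‖x‖) := by
  have hΩ := isOpen_puncturedBall (n := n)
  have hP : LocallyIntegrableOn (fun x : EuclideanSpace ℝ (Fin n) => P ‖x‖) (puncturedBall n) :=
    locallyIntegrableOn_comp_norm (h.continuousOn.locallyIntegrableOn measurableSet_Ioo)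
  have hQ : LocallyIntegrableOn (fun x : EuclideanSpace ℝ (Fin n) => Q ‖x‖) (puncturedBall n) :=
    locallyIntegrableOn_comp_norm h.locallyIntegrableOn
  refine ⟨hP, hQ.continuousOn_mul (contDiffOn_direction 0 i).continuousOn hΩ.isLocallyClosed,
    fun φ hφ => ?_⟩
  have hs' := (tsupport_partialDeriv_subset i φ).trans hφ.2.2
  set T : EuclideanSpace ℝ (Fin n) → ℝ := partialDeriv i φ
  set T' : EuclideanSpace ℝ (Fin n) → ℝ := fun x => x i / ‖x‖ * φ x
  have hT'c : ContDiff ℝ ∞ T' :=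
    contDiff_mul_of_tsupport_subset hΩ (contDiffOn_direction ∞ i) hφ.1 hφ.2.2
  have hTc : Continuous T := hφ.continuous_partialDeriv (by norm_num) i
  have hTl : LocallyIntegrableOn T (puncturedBall n) := hTc.locallyIntegrable.locallyIntegrableOn _
  have hT'l : LocallyIntegrableOn T' (puncturedBall n) :=
    hT'c.continuous.locallyIntegrable.locallyIntegrableOn _
  obtain ⟨a, b, ha, hab, hb, hK⟩ := exists_norm_bounds hφ.2.1.isCompact hφ.2.2
  have hTz : ∀ x, ‖x‖ ∉ Ioo a b → T x = 0 := fun x hx =>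
    image_eq_zero_of_notMem_tsupport fun h' => hx (hK x (tsupport_partialDeriv_subset i φ h'))
  have hT'z : ∀ x, ‖x‖ ∉ Ioo a b → T' x = 0 := fun x hx => by
    simp only [T']
    rw [image_eq_zero_of_notMem_tsupport fun h' => hx (hK x h'), mul_zero]
  have haA : a ∈ Ioo (0 : ℝ) 1 := ⟨ha, hab.trans hb⟩
  have hbA : b ∈ Ioo (0 : ℝ) 1 := ⟨ha.trans hab, hb⟩
  have hloc : ∀ {S : EuclideanSpace ℝ (Fin n) → ℝ}, LocallyIntegrableOn S (puncturedBall n) →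
      LocallyIntegrableOn (fun r => r ^ (n - 1) * sphereIntegral S r) (Ioo 0 1) := fun hS =>
    (locallyIntegrableOn_sphereIntegral hS).continuousOn_mul (continuous_pow _).continuousOn
      isOpen_Ioo.isLocallyClosed
  -- The divergence theorem is obtained weakly: since ∂_i(χ(|x|)) = χ'(|x|) x_i/|x|, it is
  -- integration by parts in the whole space between φ and χ(|x|).
  obtain ⟨Y, hY, hYae⟩ := exists_isPrimitive (hloc hT'l) (hloc hTl) fun χ hχ hχc hχs => by
    have ht := isTestFunction_puncturedBall_comp_norm (n := n) hχ hχc hχs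
    have hχ'c : Continuous (deriv χ) := (hχ.of_le (by norm_num) : ContDiff ℝ 1 χ).continuous_deriv
      le_rfl
    have e1 := integral_mul_comp_norm hT'l hχ'c hχc.deriv
      ((tsupport_deriv_subset (f := χ)).trans hχs)
    have e2 := integral_mul_comp_norm hTl hχ.continuous hχc hχs
    have e3 : ∫ r in Ioo (0 : ℝ) 1, r ^ (n - 1) * sphereIntegral T' r * deriv χ r =
        ∫ x in puncturedBall n, T' x * deriv χ ‖x‖ := by
      rw [e1]
      exact integral_congr_ae (Filter.Eventually.of_forall fun r => by simp only; ring)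
    have e4 : ∫ r in Ioo (0 : ℝ) 1, r ^ (n - 1) * sphereIntegral T r * χ r =
        ∫ x in puncturedBall n, T x * χ ‖x‖ := by
      rw [e2]
      exact integral_congr_ae (Filter.Eventually.of_forall fun r => by simp only; ring)
    rw [e3, e4]
    have hp : ∀ x ∈ puncturedBall n, T' x * deriv χ ‖x‖ =
        φ x * partialDeriv i (fun x => χ ‖x‖) x := fun x hx => by
      rw [partialDeriv_comp_norm i hx.2 (hχ.differentiable (by simp) _).hasDerivAt]
      simp only [T']
      ring
    rw [setIntegral_congr_fun hΩ.measurableSet hp]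
    have hs2 := (tsupport_partialDeriv_subset i _).trans ht.2.2
    have e5 : ∫ x in puncturedBall n, T x * χ ‖x‖ = ∫ x, T x * χ ‖x‖ :=
      setIntegral_eq_integral_of_tsupport_subset ht.2.2 _
    rw [e5, setIntegral_eq_integral_of_tsupport_subset hs2]
    have hφl : LocallyIntegrableOn φ (puncturedBall n) :=
      hφ.1.continuous.locallyIntegrable.locallyIntegrableOn _
    exact integral_mul_fderiv_eq_neg_fderiv_mul_of_integrable
      (integrable_mul_of_tsupport_subset hTl ht.1.continuous ht.2.1 ht.2.2)
      (integrable_mul_of_tsupport_subset hφl (ht.continuous_partialDeriv (by norm_num) i)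
        (ht.hasCompactSupport_partialDeriv i) hs2)
      (integrable_mul_of_tsupport_subset hφl ht.1.continuous ht.2.1 ht.2.2)
      (fun x _ => hφ.1.differentiable (by simp) x) (fun x _ => ht.1.differentiable (by simp) x)
  -- Y is continuous and almost everywhere equal to a function that vanishes off (a, b). The
  -- intervals (0, a] and [b, 1) lie in the closures of their interiors, so Y vanishes on them, the
  -- endpoints a and b included.
  have hY0 : ∀ r ∈ Ioo (0 : ℝ) 1, r ∉ Ioo a b → Y r = 0 := by
    have hX : ∀ X ⊆ Ioo (0 : ℝ) 1, MeasurableSet X → X ⊆ closure (interior X) →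
        (∀ r ∈ X, r ∉ Ioo a b) → ∀ r ∈ X, Y r = 0 := fun X hX hXm hXc hXab => by
      refine Measure.eqOn_of_ae_eq (μ := volume) (g := fun _ => (0 : ℝ)) ?_
        (hY.continuousOn.mono hX) continuousOn_const hXc
      filter_upwards [ae_restrict_of_ae_restrict_of_subset hX hYae, ae_restrict_mem hXm]
        with r hr hrX
      rw [← hr, sphereIntegral_eq_zero hT'z (hX hrX).1.le (hXab r hrX), mul_zero]
    intro r hr hrab
    rw [mem_Ioo, not_and_or, not_lt, not_lt] at hrab
    rcases hrab with hra | hrb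
    · refine hX (Ioc 0 a) (fun s hs => ⟨hs.1, hs.2.trans_lt haA.2⟩) measurableSet_Ioc ?_
        (fun s hs hs' => absurd hs'.1 (not_lt.2 hs.2)) r ⟨hr.1, hra⟩
      rw [interior_Ioc, closure_Ioo ha.ne]
      exact Ioc_subset_Icc_self
    · refine hX (Ico b 1) (fun s hs => ⟨hbA.1.trans_le hs.1, hs.2⟩) measurableSet_Ico ?_
        (fun s hs hs' => absurd hs'.2 (not_lt.2 hs.1)) r ⟨hrb, hr.2⟩
      rw [interior_Ico, closure_Ioo hb.ne]
      exact Ico_subset_Icc_self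
  have hab' : ∀ {f : ℝ → ℝ}, (∀ r ∈ Ioo (0 : ℝ) 1, r ∉ Ioo a b → f r = 0) →
      ∫ r in Ioo (0 : ℝ) 1, f r = ∫ r in a..b, f r := fun hf => by
    rw [intervalIntegral.integral_of_le hab.le, integral_Ioc_eq_integral_Ioo]
    exact setIntegral_eq_of_subset_of_forall_sdiff_eq_zero measurableSet_Ioo
      (Ioo_subset_Ioo ha.le hb.le) fun x hx => hf x hx.1 hx.2
  have i1 : IntegrableOn (fun x => T x * P ‖x‖) (puncturedBall n) := by
    have := integrable_mul_of_tsupport_subset hP hTc (hφ.hasCompactSupport_partialDeriv i) hs'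
    simp_rw [mul_comm _ (T _)] at this
    exact this.integrableOn
  have i2 : IntegrableOn (fun x => T' x * Q ‖x‖) (puncturedBall n) := by
    have := integrable_mul_of_tsupport_subset hQ hT'c.continuous (hφ.2.1.mul_left)
      ((closure_mono (Function.support_mul_subset_right _ _)).trans hφ.2.2)
    simp_rw [mul_comm (Q _)] at this
    exact this.integrableOn
  have e1 : ∫ x in puncturedBall n, P ‖x‖ * T x = ∫ r in a..b,
      P r * (r ^ (n - 1) * sphereIntegral T r) := by
    simp_rw [mul_comm (P _) (T _)]
    rw [setIntegral_mul_comp_norm i1, ← hab' fun r hr hr' => by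
      rw [sphereIntegral_eq_zero hTz hr.1.le hr', mul_zero, mul_zero]]
    exact integral_congr_ae (Filter.Eventually.of_forall fun r => by simp only; ring)
  have e2 : ∫ x in puncturedBall n, x i / ‖x‖ * Q ‖x‖ * φ x = ∫ r in a..b, Q r * Y r := by
    have : ∀ x : EuclideanSpace ℝ (Fin n), x i / ‖x‖ * Q ‖x‖ * φ x = T' x * Q ‖x‖ := fun x => by
      simp only [T']; ring
    simp_rw [this]
    rw [setIntegral_mul_comp_norm i2, ← hab' fun r hr hr' => by rw [hY0 r hr hr', mul_zero]]
    refine integral_congr_ae (hYae.mono fun r hr => ?_)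
    simp only
    rw [← hr]; ring
  rw [e1, e2]
  exact h.integral_mul_eq_neg hY haA hbA (hY0 a haA (by simp)) (hY0 b hbA (by simp))

/-- Testing with the fields ψ(|x|) x/|x| shows that the spherical integral of w has as weak
derivative that of the radial component of W. So w has a locally absolutely continuous profile,
whose weak gradient is radial, and uniqueness identifies W with it. -/
theorem exists_isPrimitive_of_hasWeakGradient {w : EuclideanSpace ℝ (Fin n) → ℝ}
    {W : EuclideanSpace ℝ (Fin n) → EuclideanSpace ℝ (Fin n)} {f : ℝ → ℝ}
    (hw : ∀ᵐ x ∂(volume.restrict (puncturedBall n)), w x = f ‖x‖)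
    (H : HasWeakGradient (puncturedBall n) w W) :
    ∃ P Q : ℝ → ℝ, IsPrimitive P Q ∧
      (∀ᵐ x ∂(volume.restrict (puncturedBall n)), w x = P ‖x‖) ∧
      ∀ᵐ x ∂(volume.restrict (puncturedBall n)), ∀ i, W x i = x i / ‖x‖ * Q ‖x‖ := by
  have hΩ := isOpen_puncturedBall (n := n)
  have hwl : LocallyIntegrableOn w (puncturedBall n) := (H 0).1
  set R : EuclideanSpace ℝ (Fin n) → ℝ := fun x => ∑ i, x i / ‖x‖ * W x i
  have hRl : LocallyIntegrableOn R (puncturedBall n) := by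
    have : ∀ s : Finset (Fin n),
        LocallyIntegrableOn (fun x => ∑ i ∈ s, x i / ‖x‖ * W x i) (puncturedBall n) := by
      intro s
      induction s using Finset.induction_on with
      | empty => simpa using (locallyIntegrable_const (0 : ℝ)).locallyIntegrableOn _
      | insert i s his ih =>
        simp_rw [Finset.sum_insert his]
        exact ((H i).2.1.continuousOn_mul (contDiffOn_direction 0 i).continuousOn
          hΩ.isLocallyClosed).add ih
    exact this _
  set σ : ℝ := (volume : Measure (EuclideanSpace ℝ (Fin n))).toSphere.real univ
  have hσ : 0 < σ := toSphere_real_univ_pos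
  have key : ∀ χ : ℝ → ℝ, ContDiff ℝ ∞ χ → HasCompactSupport χ → tsupport χ ⊆ Ioo 0 1 →
      ∫ r in Ioo (0 : ℝ) 1, sphereIntegral w r * deriv χ r =
        -∫ r in Ioo (0 : ℝ) 1, sphereIntegral R r * χ r := by
    intro χ hχ hχc hχs
    -- With this factor the field ψ(|x|) x/|x| has divergence r^{1-n} χ', and the power cancels the
    -- Jacobian r^{n-1}.
    set ψ : ℝ → ℝ := fun r => (r ^ (n - 1))⁻¹ * χ r
    have hpow : ContDiffOn ℝ ∞ (fun r : ℝ => (r ^ (n - 1))⁻¹) (Ioo 0 1) :=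
      (contDiff_id.pow _).contDiffOn.inv fun r hr => pow_ne_zero _ hr.1.ne'
    have hψ : ContDiff ℝ ∞ ψ := contDiff_mul_of_tsupport_subset isOpen_Ioo hpow hχ hχs
    have hψs : tsupport ψ ⊆ Ioo 0 1 :=
      (closure_mono (Function.support_mul_subset_right _ _)).trans hχs
    have hψc : HasCompactSupport ψ := hχc.mul_left
    have ht := isTestFunction_puncturedBall_comp_norm (n := n) hψ hψc hψs
    set φ : Fin n → EuclideanSpace ℝ (Fin n) → ℝ := fun i x => x i / ‖x‖ * ψ ‖x‖
    have hφ : ∀ i, IsTestFunction ∞ (puncturedBall n) (φ i) := fun i =>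
      ⟨contDiff_mul_of_tsupport_subset hΩ (contDiffOn_direction ∞ i) ht.1 ht.2.2, ht.2.1.mul_left,
        (closure_mono (Function.support_mul_subset_right _ _)).trans ht.2.2⟩
    have hdiv : ∀ x ∈ puncturedBall n, ∑ i, partialDeriv i (φ i) x =
        (‖x‖ ^ (n - 1))⁻¹ * deriv χ ‖x‖ := by
      intro x hx
      have hr : ‖x‖ ≠ 0 := norm_ne_zero_iff.2 hx.2
      have hn : ((n - 1 : ℕ) : ℝ) = n - 1 := by
        rw [Nat.cast_sub (Nat.one_le_iff_ne_zero.2 (NeZero.ne n)), Nat.cast_one]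
      have hd : HasDerivAt ψ (-((n - 1) / ‖x‖) * ψ ‖x‖ + (‖x‖ ^ (n - 1))⁻¹ * deriv χ ‖x‖) ‖x‖ := by
        refine (((hasDerivAt_pow (n - 1) ‖x‖).inv (pow_ne_zero _ hr)).mul
          (hχ.differentiable (by simp) _).hasDerivAt).congr_deriv ?_
        simp only [ψ, Pi.inv_apply]
        rw [hn, ← hn]
        congr 1
        have h0 : ((n - 1 : ℕ) : ℝ) * ‖x‖ ^ (n - 1 - 1) * ‖x‖ =
            ((n - 1 : ℕ) : ℝ) * ‖x‖ ^ (n - 1) := by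
          rcases Nat.eq_zero_or_pos (n - 1) with h0 | h0
          · simp [h0]
          · rw [mul_assoc, ← pow_succ, Nat.sub_add_cancel h0]
        have h1 : ((n - 1 : ℕ) : ℝ) * ‖x‖ ^ (n - 1 - 1) =
            ((n - 1 : ℕ) : ℝ) * ‖x‖ ^ (n - 1) / ‖x‖ := by
          rw [eq_div_iff hr, h0]
        rw [h1]
        field_simp
      have hi : ∀ i, partialDeriv i (φ i) x = (x i / ‖x‖ * (x i / ‖x‖)) *
          (-((n - 1) / ‖x‖) * ψ ‖x‖ + (‖x‖ ^ (n - 1))⁻¹ * deriv χ ‖x‖) +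
          (1 - x i / ‖x‖ * (x i / ‖x‖)) / ‖x‖ * ψ ‖x‖ := fun i => by
        rw [partialDeriv_mul i (differentiableAt_direction i hx.2)
          (hasFDerivAt_comp_norm hx.2 hd).differentiableAt, partialDeriv_comp_norm i hx.2 hd,
          partialDeriv_direction i i hx.2, if_pos rfl]
        ring
      simp_rw [hi]
      rw [Finset.sum_add_distrib, ← Finset.sum_mul, sum_direction_sq hx.2, ← Finset.sum_mul,
        ← Finset.sum_div, Finset.sum_sub_distrib, sum_direction_sq hx.2]
      simp only [Finset.sum_const, Finset.card_univ, Fintype.card_fin, nsmul_eq_mul]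
      ring
    have hχ'c : Continuous (deriv χ) :=
      (hχ.of_le (by norm_num) : ContDiff ℝ 1 χ).continuous_deriv le_rfl
    have hχ's := (tsupport_deriv_subset (f := χ)).trans hχs
    have hρ : ContDiff ℝ 0 fun r => (r ^ (n - 1))⁻¹ * deriv χ r :=
      contDiff_mul_of_tsupport_subset isOpen_Ioo (hpow.of_le (by simp)) (contDiff_zero.2 hχ'c) hχ's
    have hpol := integral_mul_comp_norm hwl hρ.continuous hχc.deriv.mul_left
      ((closure_mono (Function.support_mul_subset_right _ _)).trans hχ's)
    have hpol' := integral_mul_comp_norm hRl hψ.continuous hψc hψs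
    have e1 : ∫ r in Ioo (0 : ℝ) 1, sphereIntegral w r * deriv χ r =
        ∫ x in puncturedBall n, w x * ((‖x‖ ^ (n - 1))⁻¹ * deriv χ ‖x‖) := by
      rw [hpol]
      refine setIntegral_congr_fun measurableSet_Ioo fun r hr => ?_
      rw [← mul_assoc (r ^ (n - 1)), mul_inv_cancel₀ (pow_ne_zero _ hr.1.ne')]
      ring
    have e2 : ∫ r in Ioo (0 : ℝ) 1, sphereIntegral R r * χ r =
        ∫ x in puncturedBall n, R x * ψ ‖x‖ := by
      rw [hpol']
      refine setIntegral_congr_fun measurableSet_Ioo fun r hr => ?_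
      simp only [ψ]
      rw [← mul_assoc (r ^ (n - 1)), mul_inv_cancel₀ (pow_ne_zero _ hr.1.ne')]
      ring
    have e3 : ∫ x in puncturedBall n, w x * ((‖x‖ ^ (n - 1))⁻¹ * deriv χ ‖x‖) =
        ∑ i, ∫ x in puncturedBall n, w x * partialDeriv i (φ i) x := by
      rw [← integral_finsetSum]
      · refine setIntegral_congr_fun hΩ.measurableSet fun x hx => ?_
        rw [← hdiv x hx, Finset.mul_sum]
      · exact fun i _ => (integrable_mul_of_tsupport_subset hwl
          ((hφ i).continuous_partialDeriv (by norm_num) i) ((hφ i).hasCompactSupport_partialDeriv i)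
          ((tsupport_partialDeriv_subset i _).trans (hφ i).2.2)).integrableOn
    have e4 : ∫ x in puncturedBall n, R x * ψ ‖x‖ =
        ∑ i, ∫ x in puncturedBall n, W x i * φ i x := by
      rw [← integral_finsetSum]
      · refine integral_congr_ae (Filter.Eventually.of_forall fun x => ?_)
        simp only [R, φ, Finset.sum_mul]
        exact Finset.sum_congr rfl fun i _ => by ring
      · exact fun i _ => (integrable_mul_of_tsupport_subset (H i).2.1
          (hφ i).1.continuous (hφ i).2.1 (hφ i).2.2).integrableOn
    rw [e1, e2, e3, e4, ← Finset.sum_neg_distrib]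
    exact Finset.sum_congr rfl fun i _ => (H i).2.2 _ (hφ i)
  have hf : ∀ᵐ r ∂(volume.restrict (Ioo (0 : ℝ) 1)), f r = σ⁻¹ * sphereIntegral w r :=
    (sphereIntegral_of_radial hw).mono fun r hr => by
      rw [hr, ← mul_assoc, inv_mul_cancel₀ hσ.ne', one_mul]
  obtain ⟨P, hP, hPae⟩ := exists_isPrimitive
    (f := fun r => σ⁻¹ * sphereIntegral w r) (Q := fun r => σ⁻¹ * sphereIntegral R r)
    ((locallyIntegrableOn_sphereIntegral hwl).continuousOn_mul continuousOn_const
      isOpen_Ioo.isLocallyClosed)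
    ((locallyIntegrableOn_sphereIntegral hRl).continuousOn_mul continuousOn_const
      isOpen_Ioo.isLocallyClosed) fun χ hχ hχc hχs => by
        simp_rw [mul_assoc]
        rw [integral_const_mul, integral_const_mul, key χ hχ hχc hχs, mul_neg]
  have hwP : ∀ᵐ x ∂(volume.restrict (puncturedBall n)), w x = P ‖x‖ := by
    have h1 : ∀ᵐ x ∂(volume.restrict (puncturedBall n)), f ‖x‖ = P ‖x‖ := by
      rw [restrict_puncturedBall, ae_unitBall_norm_iff (S := fun r => f r = P r)]
      filter_upwards [hf, hPae] with r h1 h2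
      rw [h1, h2]
    filter_upwards [hw, h1] with x h1 h2
    rw [h1, h2]
  exact ⟨P, _, hP, hwP, ae_all_iff.2 fun i =>
    (H i).unique hΩ (hP.hasWeakPartial_comp_norm i) hwP⟩

end RadialSobolev

/-! ### Weak Hessians of radial functions. -/

section RadialHessian

variable {n : ℕ}

/-- The Hessian matrix of a radial function with radial derivatives `p` and `q`. -/
def radialHessian (p q : ℝ → ℝ) (x : EuclideanSpace ℝ (Fin n)) : Matrix (Fin n) (Fin n) ℝ :=
  (p ‖x‖ / ‖x‖) • (1 : Matrix (Fin n) (Fin n) ℝ) + (q ‖x‖ - p ‖x‖ / ‖x‖) •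
    Matrix.vecMulVec (fun i => x i / ‖x‖) (fun i => x i / ‖x‖)

theorem radialHessian_apply (p q : ℝ → ℝ) (x : EuclideanSpace ℝ (Fin n)) (i j : Fin n) :
    radialHessian p q x i j = x i / ‖x‖ * (x j / ‖x‖ * q ‖x‖) +
      ((if i = j then 1 else 0) - x i / ‖x‖ * (x j / ‖x‖)) / ‖x‖ * p ‖x‖ := by
  simp only [radialHessian, Matrix.add_apply, Matrix.smul_apply, Matrix.one_apply,
    Matrix.vecMulVec_apply, smul_eq_mul]
  split_ifs <;> ring

theorem kHessianForm_radialHessian {k : ℕ} (hk : 1 ≤ k) (p q : ℝ → ℝ) (a b : ℝ)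
    {x : EuclideanSpace ℝ (Fin n)} (hx : x ≠ 0) :
    kHessianForm k (radialHessian p q x) (fun i => a * (x i / ‖x‖)) (fun i => b * (x i / ‖x‖)) =
      (n - 1).choose (k - 1) * (p ‖x‖ / ‖x‖) ^ (k - 1) * (a * b) := by
  have hθ : (fun i => x i / ‖x‖) ⬝ᵥ (fun i => x i / ‖x‖) = 1 := sum_direction_sq hx
  exact kHessianForm_radial hk (p ‖x‖ / ‖x‖) _ a b hθ

variable [NeZero n]

theorem ae_puncturedBall_norm_iff {S : ℝ → Prop} :
    (∀ᵐ x ∂(volume.restrict (puncturedBall n)), S ‖x‖) ↔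
      ∀ᵐ r ∂(volume.restrict (Ioo (0 : ℝ) 1)), S r := by
  rw [restrict_puncturedBall, ae_unitBall_norm_iff]

/-- The gradient result is applied twice: to u, and to the radial component of its gradient, which
is almost everywhere Q(|x|) and has a weak gradient by the product rule. The second use replaces Q
by a continuous representative p. -/
theorem exists_isPrimitive_of_hasWeakHessian {u : EuclideanSpace ℝ (Fin n) → ℝ}
    {A : EuclideanSpace ℝ (Fin n) → Matrix (Fin n) (Fin n) ℝ} {f : ℝ → ℝ}
    (hu : ∀ᵐ x ∂(volume.restrict (puncturedBall n)), u x = f ‖x‖)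
    (H : HasWeakHessian (puncturedBall n) u A) :
    ∃ v p q : ℝ → ℝ, IsPrimitive v p ∧ IsPrimitive p q ∧
      ∀ᵐ x ∂(volume.restrict (puncturedBall n)), u x = v ‖x‖ := by
  have hΩ := isOpen_puncturedBall (n := n)
  obtain ⟨G, hG, hA⟩ := H
  obtain ⟨v, Q, hv, huv, hGQ⟩ := exists_isPrimitive_of_hasWeakGradient hu hG
  have hw : ∀ᵐ x ∂(volume.restrict (puncturedBall n)), ∑ i, x i / ‖x‖ * G x i = Q ‖x‖ := by
    filter_upwards [hGQ, ae_restrict_mem hΩ.measurableSet] with x hx hxΩ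
    simp_rw [hx, ← mul_assoc]
    rw [← Finset.sum_mul, sum_direction_sq hxΩ.2, one_mul]
  have hW : HasWeakGradient (puncturedBall n) (fun x => ∑ i, x i / ‖x‖ * G x i)
      (fun x => WithLp.toLp 2 fun j => ∑ i, (x i / ‖x‖ * A x i j +
        partialDeriv j (fun x : EuclideanSpace ℝ (Fin n) => x i / ‖x‖) x * G x i)) := fun j =>
    HasWeakPartial.sum Finset.univ fun i _ => (hA i j).contDiffOn_mul hΩ (contDiffOn_direction ∞ i)
  obtain ⟨p, q, hp, hwp, -⟩ := exists_isPrimitive_of_hasWeakGradient hw hW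
  have hQp : ∀ᵐ r ∂(volume.restrict (Ioo (0 : ℝ) 1)), Q r = p r := by
    rw [← ae_puncturedBall_norm_iff (n := n)]
    filter_upwards [hw, hwp] with x h1 h2
    rw [← h1, ← h2]
  refine ⟨v, p, q, ⟨hp.continuousOn.locallyIntegrableOn measurableSet_Ioo, fun a ha b hb => ?_⟩,
    hp, huv⟩
  rw [hv.sub_eq a ha b hb]
  exact intervalIntegral.integral_congr_ae_restrict (ae_restrict_of_ae_restrict_of_subset
      (uIoc_subset_uIcc.trans (uIcc_subset_Ioo ha hb)) hQp)

theorem HasWeakGradient.ae_eq_of_isPrimitive {u : EuclideanSpace ℝ (Fin n) → ℝ}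
    {G : EuclideanSpace ℝ (Fin n) → EuclideanSpace ℝ (Fin n)} {v p : ℝ → ℝ}
    (H : HasWeakGradient (puncturedBall n) u G) (hv : IsPrimitive v p)
    (hu : ∀ᵐ x ∂(volume.restrict (puncturedBall n)), u x = v ‖x‖) :
    ∀ᵐ x ∂(volume.restrict (puncturedBall n)), ∀ i, G x i = x i / ‖x‖ * p ‖x‖ :=
  ae_all_iff.2 fun i => (H i).unique isOpen_puncturedBall (hv.hasWeakPartial_comp_norm i) hu

/-- The profile determines the weak Hessian almost everywhere, so the Hessians occurring in the weak
equation and in semistability agree. -/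
theorem HasWeakHessian.ae_eq_radialHessian {u : EuclideanSpace ℝ (Fin n) → ℝ}
    {A : EuclideanSpace ℝ (Fin n) → Matrix (Fin n) (Fin n) ℝ} {v p q : ℝ → ℝ}
    (H : HasWeakHessian (puncturedBall n) u A) (hv : IsPrimitive v p) (hp : IsPrimitive p q)
    (hu : ∀ᵐ x ∂(volume.restrict (puncturedBall n)), u x = v ‖x‖) :
    ∀ᵐ x ∂(volume.restrict (puncturedBall n)), A x = radialHessian p q x := by
  have hΩ := isOpen_puncturedBall (n := n)
  obtain ⟨G, hG, hA⟩ := H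
  have hGp := hG.ae_eq_of_isPrimitive hv hu
  have hij : ∀ i j, ∀ᵐ x ∂(volume.restrict (puncturedBall n)), A x i j = _ := fun i j =>
    (hA i j).unique hΩ
      ((hp.hasWeakPartial_comp_norm j).contDiffOn_mul hΩ (contDiffOn_direction ∞ i))
      (hGp.mono fun x hx => hx i)
  filter_upwards [ae_all_iff.2 fun i => ae_all_iff.2 (hij i), ae_restrict_mem hΩ.measurableSet]
    with x hx hxΩ
  ext i j
  rw [hx i j, radialHessian_apply, partialDeriv_direction i j hxΩ.2]

end RadialHessian

/-! ### Energy, stability and weak equation in one variable. -/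

section Reduction

variable {n k : ℕ} {g v p q : ℝ → ℝ} {u : EuclideanSpace ℝ (Fin n) → ℝ}

theorem norm_of_radial {x y : EuclideanSpace ℝ (Fin n)} (hx : x ≠ 0) {c : ℝ}
    (h : ∀ i, y i = x i / ‖x‖ * c) : ‖y‖ = |c| := by
  have h1 : ‖y‖ ^ 2 = c ^ 2 := by
    rw [EuclideanSpace.real_norm_sq_eq]
    have : ∀ i, y i ^ 2 = x i / ‖x‖ * (x i / ‖x‖) * c ^ 2 := fun i => by rw [h i]; ring
    simp_rw [this]
    rw [← Finset.sum_mul, sum_direction_sq hx, one_mul]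
  rw [← abs_of_nonneg (norm_nonneg y)]
  exact (sq_eq_sq_iff_abs_eq_abs _ _).1 h1

theorem pow_mul_div_pow {r : ℝ} (hr : 0 < r) (hk : 1 ≤ k) (hkn : k ≤ n) (c : ℝ) :
    r ^ (n - 1) * (c / r) ^ (k - 1) = r ^ (n - k) * c ^ (k - 1) := by
  have : n - 1 = (n - k) + (k - 1) := by omega
  rw [this, pow_add, div_pow, mul_assoc, mul_div_cancel₀ _ (pow_ne_zero _ hr.ne')]

variable [NeZero n]

/-- The weight |x|^{1-k} and the Jacobian r^{n-1} combine to r^{n-k}. -/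
theorem MemWeightedSobolev.integrableOn_profile (hu : MemWeightedSobolev k u) (hk : 1 ≤ k)
    (hkn : k ≤ n) (hv : IsPrimitive v p)
    (huv : ∀ᵐ x ∂(volume.restrict (puncturedBall n)), u x = v ‖x‖) :
    IntegrableOn (fun r => r ^ (n - k) * |p r| ^ (k + 1)) (Ioo 0 1) := by
  obtain ⟨-, G, hG, hi⟩ := hu
  have hG' : HasWeakGradient (puncturedBall n) u G := fun i =>
    (hG i).mono puncturedBall_subset_unitBall
  set Y : ℝ → ℝ := fun r => r ^ (1 - (k : ℤ)) * |p r| ^ (k + 1)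
  have h1 : IntegrableOn (fun x : EuclideanSpace ℝ (Fin n) => Y ‖x‖) (unitBall n) := by
    refine hi.congr ?_
    rw [← restrict_puncturedBall]
    filter_upwards [hG'.ae_eq_of_isPrimitive hv huv,
      ae_restrict_mem isOpen_puncturedBall.measurableSet] with x hx hxΩ
    simp only [Y]
    rw [norm_of_radial hxΩ.2 hx]
  refine (integrableOn_unitBall_comp_norm_iff.1 h1).congr_fun (fun r hr => ?_) measurableSet_Ioo
  simp only [Y]
  rw [← mul_assoc, ← zpow_natCast r (n - 1), ← zpow_add₀ hr.1.ne', ← zpow_natCast r (n - k)]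
  congr 2
  omega

theorem IsSemistable.profile (hst : IsSemistable k g u) (hk : 1 ≤ k)
    (hv : IsPrimitive v p) (hp : IsPrimitive p q)
    (huv : ∀ᵐ x ∂(volume.restrict (puncturedBall n)), u x = v ‖x‖) {ψ : ℝ → ℝ}
    (hψ : ContDiff ℝ 1 ψ) (hψc : HasCompactSupport ψ) (hψs : tsupport ψ ⊆ Ioo 0 1) :
    IntegrableOn (fun r => r ^ (n - 1) * ((n - 1).choose (k - 1) * (p r / r) ^ (k - 1) *
      deriv ψ r ^ 2 + deriv g (v r) * ψ r ^ 2)) (Ioo 0 1) ∧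
    0 ≤ ∫ r in Ioo (0 : ℝ) 1, r ^ (n - 1) * ((n - 1).choose (k - 1) * (p r / r) ^ (k - 1) *
      deriv ψ r ^ 2 + deriv g (v r) * ψ r ^ 2) := by
  obtain ⟨A, hA, h⟩ := hst
  have ht := isTestFunction_puncturedBall_comp_norm (n := n) hψ hψc hψs
  obtain ⟨h1, h2⟩ := h _ ht
  set Y : ℝ → ℝ := fun r => (n - 1).choose (k - 1) * (p r / r) ^ (k - 1) *
    deriv ψ r ^ 2 + deriv g (v r) * ψ r ^ 2
  have e : ∀ᵐ x ∂(volume.restrict (unitBall n)),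
      kHessianForm k (A x) (fun i => partialDeriv i (fun x => ψ ‖x‖) x)
        (fun j => partialDeriv j (fun x => ψ ‖x‖) x) + deriv g (u x) * ψ ‖x‖ ^ 2 =
      Y ‖x‖ := by
    rw [← restrict_puncturedBall]
    filter_upwards [hA.ae_eq_radialHessian hv hp huv, huv,
      ae_restrict_mem isOpen_puncturedBall.measurableSet] with x hx hux hxΩ
    have hd : ∀ i, partialDeriv i (fun x => ψ ‖x‖) x = deriv ψ ‖x‖ * (x i / ‖x‖) := fun i =>
      partialDeriv_comp_norm i hxΩ.2 (hψ.differentiable one_ne_zero _).hasDerivAt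
    simp_rw [hd]
    rw [hx, kHessianForm_radialHessian hk p q _ _ hxΩ.2, hux]
    simp only [Y]
    ring
  obtain ⟨κ, hκ, hint⟩ := exists_integral_unitBall_comp_norm n
  refine ⟨integrableOn_unitBall_comp_norm_iff.1 (h1.congr e), ?_⟩
  rw [integral_congr_ae e, hint] at h2
  exact nonneg_of_mul_nonneg_right h2 hκ

theorem IsWeakSolution.integrableOn_profile (hs : IsWeakSolution k g u)
    (huv : ∀ᵐ x ∂(volume.restrict (puncturedBall n)), u x = v ‖x‖) :
    IntegrableOn (fun r => r ^ (n - 1) * g (v r)) (Ioo 0 1) := by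
  refine (integrableOn_unitBall_comp_norm_iff (n := n) (y := fun r => g (v r))).1
    (hs.2.1.congr ?_)
  rw [← restrict_puncturedBall]
  exact huv.mono fun x hx => by simp only; rw [hx]

theorem IsWeakSolution.integral_profile (hs : IsWeakSolution k g u) (hk : 1 ≤ k)
    (hv : IsPrimitive v p) (hp : IsPrimitive p q)
    (huv : ∀ᵐ x ∂(volume.restrict (puncturedBall n)), u x = v ‖x‖) {y : ℝ → ℝ}
    (hy : ContDiff ℝ 1 y) {a b : ℝ} (ha : 0 < a) (hya : ∀ r < a, y r = y 0) (hb : b < 1)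
    (hyb : ∀ r > b, y r = 0) :
    ∫ r in Ioo (0 : ℝ) 1, r ^ (n - 1) * ((n - 1).choose (k - 1) / k * (p r / r) ^ (k - 1) *
      (p r * deriv y r) + g (v r) * y r) = 0 := by
  obtain ⟨-, -, G, A, hG, hA, -, h⟩ := hs
  have hG' : HasWeakGradient (puncturedBall n) u G := fun i =>
    (hG i).mono puncturedBall_subset_unitBall
  obtain ⟨-, h2⟩ := h _ (isTestFunction_unitBall_comp_norm hy ha hya hb hyb)
  set Y : ℝ → ℝ := fun r => (n - 1).choose (k - 1) / k * (p r / r) ^ (k - 1) *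
    (p r * deriv y r) + g (v r) * y r
  have e : ∀ᵐ x ∂(volume.restrict (unitBall n)),
      (1 / (k : ℝ)) * kHessianForm k (A x) (fun i => G x i)
        (fun j => partialDeriv j (fun x => y ‖x‖) x) + g (u x) * y ‖x‖ =
      Y ‖x‖ := by
    rw [← restrict_puncturedBall]
    filter_upwards [hA.ae_eq_radialHessian hv hp huv, huv, hG'.ae_eq_of_isPrimitive hv huv,
      ae_restrict_mem isOpen_puncturedBall.measurableSet] with x hx hux hGx hxΩ
    have hd : ∀ i, partialDeriv i (fun x => y ‖x‖) x = deriv y ‖x‖ * (x i / ‖x‖) := fun i =>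
      partialDeriv_comp_norm i hxΩ.2 (hy.differentiable one_ne_zero _).hasDerivAt
    simp_rw [hd, hGx, mul_comm (_ / _) (p _)]
    rw [hx, kHessianForm_radialHessian hk p q _ _ hxΩ.2, hux]
    simp only [Y]
    ring
  obtain ⟨κ, hκ, hint⟩ := exists_integral_unitBall_comp_norm n
  rw [integral_congr_ae e, hint] at h2
  exact (mul_eq_zero.1 h2).resolve_left hκ.ne'

/-- The radial weak equation says that the flux and the integral of the source have the same weak
derivative. It holds across the origin, so the test function may be a nonzero constant near 0, which
fixes the constant of integration. Continuity of both sides gives the identity at every radius. -/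
theorem IsWeakSolution.flux (hs : IsWeakSolution k g u) (hk : 1 ≤ k) (hkn : k ≤ n)
    (hv : IsPrimitive v p) (hp : IsPrimitive p q)
    (huv : ∀ᵐ x ∂(volume.restrict (puncturedBall n)), u x = v ‖x‖) {r : ℝ}
    (hr : r ∈ Ioo (0 : ℝ) 1) :
    (n - 1).choose (k - 1) / k * (r ^ (n - k) * p r ^ k) =
      ∫ s in (0 : ℝ)..r, s ^ (n - 1) * g (v s) := by
  set c : ℝ := (n - 1).choose (k - 1) / k
  set f : ℝ → ℝ := fun s => s ^ (n - 1) * g (v s)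
  have hf : IntegrableOn f (Ioo 0 1) := hs.integrableOn_profile huv
  have hfI : IntegrableOn f (Icc 0 1) := (integrableOn_Icc_iff_integrableOn_Ioo).2 hf
  have hfi : IntervalIntegrable f volume 0 1 := by
    rw [intervalIntegrable_iff_integrableOn_Ioo_of_le zero_le_one]; exact hf
  set F : ℝ → ℝ := fun r => ∫ s in (0 : ℝ)..r, f s
  have hFc : ContinuousOn F (Icc 0 1) := by
    have := intervalIntegral.continuousOn_primitive_interval (μ := volume) (f := f)
      (a := 0) (b := 1)
      (by rwa [uIcc_of_le zero_le_one])
    rwa [uIcc_of_le zero_le_one] at this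
  have hFI : ContinuousOn F (Ioo 0 1) := hFc.mono Ioo_subset_Icc_self
  have hΦ : ContinuousOn (fun r => c * (r ^ (n - k) * p r ^ k)) (Ioo 0 1) :=
    continuousOn_const.mul ((continuous_pow _).continuousOn.mul (hp.continuousOn.pow k))
  have hFl := hFI.locallyIntegrableOn (μ := volume) measurableSet_Ioo
  have hΦl := hΦ.locallyIntegrableOn (μ := volume) measurableSet_Ioo
  have h0 : ∀ᵐ r ∂volume, r ∈ Ioo (0 : ℝ) 1 → c * (r ^ (n - k) * p r ^ k) - F r = 0 := by
    refine isOpen_Ioo.ae_eq_zero_of_integral_contDiff_smul_eq_zero (hΦl.sub hFl)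
      fun χ hχ hχc hχs => ?_
    obtain ⟨a, b, ha, hab, hb, hK⟩ := exists_Icc_of_isCompact_subset_Ioo hχc hχs
    have hχz : ∀ r, r ∉ Ioo a b → χ r = 0 := fun r hr =>
      image_eq_zero_of_notMem_tsupport fun h' => hr (hK h')
    -- This is ∫_r^1 χ: its derivative is -χ, it vanishes near 1 and is constant near 0.
    set y : ℝ → ℝ := fun r => -∫ s in (1 : ℝ)..r, χ s
    have hyd : ∀ r, HasDerivAt y (-χ r) r := fun r =>
      (hχ.continuous.integral_hasStrictDerivAt 1 r).hasDerivAt.neg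
    have hy' : deriv y = fun r => -χ r := funext fun r => (hyd r).deriv
    have hyC : ContDiff ℝ 1 y := by
      rw [contDiff_one_iff_deriv]
      exact ⟨fun r => (hyd r).differentiableAt, hy' ▸ hχ.continuous.neg⟩
    have hya : ∀ r < a, y r = y 0 := fun r hr => by
      have h1 : ∫ s in (0 : ℝ)..r, χ s = 0 :=
        (intervalIntegral.integral_congr (g := fun _ => 0) fun s hs => hχz s fun h' => by
          have := hs.2
          have h2 : max 0 r < a := max_lt ha hr
          linarith [h'.1]).trans (by simp)
      simp only [y]
      rw [← intervalIntegral.integral_add_adjacent_intervals (b := 0)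
        (hχ.continuous.intervalIntegrable _ _) (hχ.continuous.intervalIntegrable _ _), h1, add_zero]
    have hyb : ∀ r > b, y r = 0 := fun r hr => by
      have h1 : ∫ s in (1 : ℝ)..r, χ s = 0 :=
        (intervalIntegral.integral_congr (g := fun _ => 0) fun s hs => hχz s fun h' => by
          have := hs.1
          have h2 : b < min 1 r := lt_min hb hr
          linarith [h'.2]).trans (by simp)
      simp only [y, h1, neg_zero]
    have key := hs.integral_profile hk hv hp huv hyC ha hya hb hyb
    have i1 := (integrable_mul_of_tsupport_subset hΦl hχ.continuous hχc hχs)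
    have i1' := (integrable_mul_of_tsupport_subset hFl hχ.continuous hχc hχs)
    have i2 : IntegrableOn (fun r => f r * y r) (Ioo 0 1) :=
      (hfI.mul_continuousOn hyC.continuous.continuousOn isCompact_Icc).mono_set Ioo_subset_Icc_self
    have e1 : ∫ r in Ioo (0 : ℝ) 1, r ^ (n - 1) * (c * (p r / r) ^ (k - 1) *
        (p r * deriv y r) + g (v r) * y r) =
        ∫ r in Ioo (0 : ℝ) 1, (-(c * (r ^ (n - k) * p r ^ k) * χ r) + f r * y r) := by
      refine setIntegral_congr_fun measurableSet_Ioo fun r hr => ?_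
      have h1 := pow_mul_div_pow hr.1 hk hkn (p r)
      have h2 : p r ^ k = p r ^ (k - 1) * p r := by rw [← pow_succ, Nat.sub_add_cancel hk]
      rw [hy', h2]
      simp only [f]
      linear_combination (-c * p r * χ r) * h1
    rw [e1, integral_add (f := fun r => -(c * (r ^ (n - k) * p r ^ k) * χ r))
      i1.neg.integrableOn i2, integral_neg] at key
    -- Integration by parts without boundary terms, since F 0 = 0 and y 1 = 0.
    have e2 : ∫ r in Ioo (0 : ℝ) 1, f r * y r = ∫ r in Ioo (0 : ℝ) 1, F r * χ r := by
      have hFAC : AbsolutelyContinuousOnInterval F 0 1 :=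
        hfi.absolutelyContinuousOnInterval_intervalIntegral (by simp)
      have hyAC : AbsolutelyContinuousOnInterval y 0 1 :=
        hyC.contDiffOn.absolutelyContinuousOnInterval
      have h1 := hFAC.integral_mul_deriv_eq_deriv_mul hyAC
      have hF0 : F 0 = 0 := intervalIntegral.integral_same
      rw [hyb 1 hb, hF0, mul_zero, zero_mul, sub_zero, zero_sub, hy'] at h1
      have h2 : ∫ r in (0 : ℝ)..1, deriv F r * y r = ∫ r in (0 : ℝ)..1, f r * y r := by
        refine intervalIntegral.integral_congr_ae ?_
        filter_upwards [hfi.ae_hasDerivAt_integral] with r hr hr'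
        rw [(hr (uIoc_subset_uIcc hr') 0 (by simp)).deriv]
      rw [h2, intervalIntegral.integral_of_le zero_le_one, intervalIntegral.integral_of_le
        zero_le_one, integral_Ioc_eq_integral_Ioo, integral_Ioc_eq_integral_Ioo] at h1
      simp_rw [mul_neg] at h1
      rw [integral_neg, neg_inj] at h1
      exact h1.symm
    have hset : ∀ h : ℝ → ℝ, ∫ r in Ioo (0 : ℝ) 1, h r * χ r = ∫ r, h r * χ r := fun h =>
      setIntegral_eq_integral_of_forall_compl_eq_zero fun x hx => by
        rw [image_eq_zero_of_notMem_tsupport fun h' => hx (hχs h'), mul_zero]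
    rw [e2, hset F, hset fun r => c * (r ^ (n - k) * p r ^ k)] at key
    have e3 : ∀ r, χ r • (c * (r ^ (n - k) * p r ^ k) - F r) =
        c * (r ^ (n - k) * p r ^ k) * χ r - F r * χ r := fun r => by
      rw [smul_eq_mul]; ring
    simp_rw [e3]
    rw [integral_sub i1 i1']
    linarith
  refine Measure.eqOn_open_of_ae_eq (μ := volume) ?_ isOpen_Ioo hΦ hFI hr
  rw [Filter.EventuallyEq, ae_restrict_iff' measurableSet_Ioo]
  exact h0.mono fun r h hr => sub_eq_zero.1 (h hr)

end Reduction

/-! ### Classical solutions, and the common reduction. -/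

section Classical

variable {n k : ℕ} {g v p q : ℝ → ℝ} {u : EuclideanSpace ℝ (Fin n) → ℝ}

theorem kHessian_radialHessian (hk : 1 ≤ k) (p q : ℝ → ℝ) {x : EuclideanSpace ℝ (Fin n)}
    (hx : x ≠ 0) :
    kHessian k (radialHessian p q x) = n.choose k * (p ‖x‖ / ‖x‖) ^ k + (p ‖x‖ / ‖x‖) ^ (k - 1) *
      ((n - 1).choose (k - 1) * (q ‖x‖ - p ‖x‖ / ‖x‖)) := by
  have hθ : (fun i => x i / ‖x‖) ⬝ᵥ (fun i => x i / ‖x‖) = 1 := sum_direction_sq hx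
  rw [radialHessian, ← Matrix.smul_vecMulVec, kHessian_smul_one_add_vecMulVec hk, smul_dotProduct,
    hθ, smul_eq_mul, mul_one]

/-- The divergence form of S_k on radial functions. With c = C(n-1, k-1)/k the binomials match
because C(n, k) = c (n - k) + C(n-1, k-1). -/
theorem hasDerivAt_flux (hk : 1 ≤ k) (hkn : k ≤ n) {r p' : ℝ} (hr : 0 < r)
    (hp : HasDerivAt p p' r) :
    HasDerivAt (fun r => (n - 1).choose (k - 1) / k * (r ^ (n - k) * p r ^ k))
      (r ^ (n - 1) * (n.choose k * (p r / r) ^ k + (p r / r) ^ (k - 1) *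
        ((n - 1).choose (k - 1) * (p' - p r / r)))) r := by
  refine (((hasDerivAt_pow (n - k) r).mul (hp.pow k)).const_mul _).congr_deriv ?_
  have hk0 : (k : ℝ) ≠ 0 := by exact_mod_cast (by omega : k ≠ 0)
  have h1 : ((n - k : ℕ) : ℝ) * r ^ (n - k - 1) = ((n - k : ℕ) : ℝ) * (r ^ (n - k) / r) := by
    rcases Nat.eq_zero_or_pos (n - k) with h0 | h0
    · simp [h0]
    · rw [eq_div_of_mul_eq hr.ne' (show r ^ (n - k - 1) * r = r ^ (n - k) by
        rw [← pow_succ, Nat.sub_add_cancel h0])]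
  have h2 : (n.choose k : ℝ) = (n - 1).choose (k - 1) / k * (n - k : ℕ) +
      (n - 1).choose (k - 1) := by
    obtain ⟨l, rfl⟩ := Nat.exists_eq_add_of_le' hk
    obtain ⟨m, rfl⟩ := Nat.exists_eq_add_of_le' (hk.trans hkn)
    have h3 := Nat.choose_succ_right_eq m l
    have h4 := Nat.choose_succ_succ m l
    have h5 : m + 1 - (l + 1) = m - l := by omega
    simp only [Nat.add_sub_cancel, h5]
    rw [h4, div_mul_eq_mul_div, ← Nat.cast_mul, ← h3]
    push_cast at hk0 ⊢
    field_simp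
    ring
  have h3 := pow_mul_div_pow hr hk hkn (p r)
  have h4 : ∀ z : ℝ, z ^ k = z ^ (k - 1) * z := fun z => by rw [← pow_succ, Nat.sub_add_cancel hk]
  simp only [Pi.pow_apply]
  rw [h1, h2, h4, h4]
  have h5 : r ^ (n - 1) * ((((n - 1).choose (k - 1) : ℝ) / k * (n - k : ℕ) +
      (n - 1).choose (k - 1)) * ((p r / r) ^ (k - 1) * (p r / r)) + (p r / r) ^ (k - 1) *
        ((n - 1).choose (k - 1) * (p' - p r / r))) = r ^ (n - k) * p r ^ (k - 1) *
        (((n - 1).choose (k - 1) : ℝ) / k * (n - k : ℕ) * (p r / r) +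
          (n - 1).choose (k - 1) * p') := by
    rw [← h3]; ring
  rw [h5]
  field_simp

theorem IsClassicalSolution.eqOn (hs : IsClassicalSolution k g u) (hv : ContinuousOn v (Ioo 0 1))
    (huv : ∀ᵐ x ∂(volume.restrict (puncturedBall n)), u x = v ‖x‖) :
    ∀ x ∈ puncturedBall n, u x = v ‖x‖ := by
  refine Measure.eqOn_open_of_ae_eq (μ := volume) huv isOpen_puncturedBall
    (hs.1.continuousOn.mono puncturedBall_subset_unitBall) ?_
  exact hv.comp continuous_norm.continuousOn fun x hx => mem_puncturedBall.1 hx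

theorem IsClassicalSolution.contDiffOn_partialDeriv (hs : IsClassicalSolution k g u) (i : Fin n) :
    ContDiffOn ℝ 1 (partialDeriv i u) (unitBall n) :=
  (hs.1.fderiv_of_isOpen isOpen_unitBall (by norm_num)).clm_apply contDiffOn_const

theorem partialDeriv_radial (hv : ∀ r ∈ Ioo (0 : ℝ) 1, HasDerivAt v (p r) r)
    (huv : ∀ x ∈ puncturedBall n, u x = v ‖x‖) (i : Fin n) {x : EuclideanSpace ℝ (Fin n)}
    (hx : x ∈ puncturedBall n) : partialDeriv i u x = x i / ‖x‖ * p ‖x‖ := by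
  have h1 : u =ᶠ[𝓝 x] fun y => v ‖y‖ := by
    filter_upwards [isOpen_puncturedBall.mem_nhds hx] with y hy using huv y hy
  rw [partialDeriv, h1.fderiv_eq, mul_comm]
  exact partialDeriv_comp_norm i hx.2 (hv _ (mem_puncturedBall.1 hx))

variable [NeZero n]

/-- The first coordinate vector. -/
def axis (n : ℕ) [NeZero n] : EuclideanSpace ℝ (Fin n) := EuclideanSpace.single 0 1

theorem norm_smul_axis (r : ℝ) : ‖r • axis n‖ = |r| := by
  rw [norm_smul, axis, PiLp.norm_single, norm_one, mul_one, Real.norm_eq_abs]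

theorem smul_axis_apply_zero (r : ℝ) : (r • axis n) 0 = r := by
  simp [axis]

/-- On the positive first axis p coincides with the first partial derivative of u, a C¹ function. -/
theorem IsClassicalSolution.differentiableAt (hs : IsClassicalSolution k g u)
    (hv : ∀ r ∈ Ioo (0 : ℝ) 1, HasDerivAt v (p r) r)
    (huv : ∀ x ∈ puncturedBall n, u x = v ‖x‖) {r : ℝ} (hr : r ∈ Ioo (0 : ℝ) 1) :
    DifferentiableAt ℝ p r := by
  have h1 : DifferentiableAt ℝ (fun s : ℝ => partialDeriv 0 u (s • axis n)) r := by
    refine DifferentiableAt.comp r (g := partialDeriv 0 u) ?_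
      (differentiableAt_id.smul_const (axis n))
    refine ((hs.contDiffOn_partialDeriv 0).contDiffAt
      (isOpen_unitBall.mem_nhds ?_)).differentiableAt one_ne_zero
    rw [mem_unitBall, norm_smul_axis, abs_of_pos hr.1]
    exact hr.2
  refine h1.congr_of_eventuallyEq ?_
  filter_upwards [isOpen_Ioo.mem_nhds hr] with s hs'
  rw [partialDeriv_radial hv huv 0
    (mem_puncturedBall.2 (by rwa [norm_smul_axis, abs_of_pos hs'.1])),
    norm_smul_axis, smul_axis_apply_zero, abs_of_pos hs'.1, div_self hs'.1.ne', one_mul]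

/-- On the positive and the negative first axis the first partial derivative of u is p and -p. Both
tend to its value at the origin, which is therefore 0. This removes the flux at the origin even when
n = k. -/
theorem IsClassicalSolution.tendsto_zero (hs : IsClassicalSolution k g u)
    (hv : ∀ r ∈ Ioo (0 : ℝ) 1, HasDerivAt v (p r) r)
    (huv : ∀ x ∈ puncturedBall n, u x = v ‖x‖) : Tendsto p (𝓝[>] 0) (𝓝 0) := by
  have hc : ContinuousAt (partialDeriv 0 u) (0 : EuclideanSpace ℝ (Fin n)) :=
    (hs.contDiffOn_partialDeriv 0).continuousOn.continuousAt
      (isOpen_unitBall.mem_nhds (by rw [mem_unitBall, norm_zero]; exact one_pos))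
  have hlim : ∀ c : ℝ, Tendsto (fun s : ℝ => partialDeriv 0 u ((c * s) • axis n)) (𝓝[>] 0)
      (𝓝 (partialDeriv 0 u 0)) := fun c => by
    refine hc.tendsto.comp (Tendsto.mono_left ?_ nhdsWithin_le_nhds)
    have : Continuous fun s : ℝ => (c * s) • axis n := by fun_prop
    simpa using this.tendsto 0
  have hev : ∀ᶠ s : ℝ in 𝓝[>] 0, s ∈ Ioo (0 : ℝ) 1 := Ioo_mem_nhdsGT one_pos
  have h1 : Tendsto p (𝓝[>] 0) (𝓝 (partialDeriv 0 u 0)) := by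
    refine (hlim 1).congr' ?_
    filter_upwards [hev] with s hs'
    rw [one_mul, partialDeriv_radial hv huv 0
      (mem_puncturedBall.2 (by rwa [norm_smul_axis, abs_of_pos hs'.1])),
      norm_smul_axis, smul_axis_apply_zero, abs_of_pos hs'.1, div_self hs'.1.ne', one_mul]
  have h2 : Tendsto p (𝓝[>] 0) (𝓝 (-partialDeriv 0 u 0)) := by
    refine (hlim (-1)).neg.congr' ?_
    filter_upwards [hev] with s hs'
    rw [partialDeriv_radial hv huv 0
      (mem_puncturedBall.2 (by rwa [norm_smul_axis, neg_one_mul, abs_neg, abs_of_pos hs'.1])),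
      norm_smul_axis, smul_axis_apply_zero, neg_one_mul, abs_neg, abs_of_pos hs'.1, neg_div,
      div_self hs'.1.ne', neg_one_mul, neg_neg]
  have h3 := tendsto_nhds_unique h1 h2
  have h4 : partialDeriv 0 u (0 : EuclideanSpace ℝ (Fin n)) = 0 := by linarith
  rwa [h4] at h1

theorem IsClassicalSolution.hasDerivAt_flux (hs : IsClassicalSolution k g u) (hk : 1 ≤ k)
    (hkn : k ≤ n) (hv : ∀ r ∈ Ioo (0 : ℝ) 1, HasDerivAt v (p r) r)
    (huv : ∀ x ∈ puncturedBall n, u x = v ‖x‖) {r : ℝ} (hr : r ∈ Ioo (0 : ℝ) 1) :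
    HasDerivAt (fun r => (n - 1).choose (k - 1) / k * (r ^ (n - k) * p r ^ k))
      (r ^ (n - 1) * g (v r)) r := by
  have hd := (hs.differentiableAt hv huv hr).hasDerivAt
  have hn : ‖r • axis n‖ = r := by rw [norm_smul_axis, abs_of_pos hr.1]
  have hx : r • axis n ∈ puncturedBall n := mem_puncturedBall.2 (by rwa [hn])
  have hA : classicalHessian u (r • axis n) = radialHessian p (deriv p) (r • axis n) := by
    ext i j
    rw [radialHessian_apply, classicalHessian, Matrix.of_apply]
    have h1 : partialDeriv i u =ᶠ[𝓝 (r • axis n)] fun y => y i / ‖y‖ * p ‖y‖ := by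
      filter_upwards [isOpen_puncturedBall.mem_nhds hx] with y hy
      exact partialDeriv_radial hv huv i hy
    have hd' : HasDerivAt p (deriv p ‖r • axis n‖) ‖r • axis n‖ := by rwa [hn]
    have h2 := partialDeriv_mul j (differentiableAt_direction i hx.2)
      (hasFDerivAt_comp_norm hx.2 hd').differentiableAt
    rw [partialDeriv_comp_norm j hx.2 hd', partialDeriv_direction i j hx.2] at h2
    rw [partialDeriv, h1.fderiv_eq]
    refine h2.trans ?_
    ring
  refine (KHessian.hasDerivAt_flux hk hkn hr.1 hd).congr_deriv ?_
  have h3 := hs.2.2.2.2 _ (puncturedBall_subset_unitBall hx)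
  rw [hA, kHessian_radialHessian hk p _ hx.2, huv _ hx, hn] at h3
  rw [h3]

/-- u is bounded below on the closed ball and g is nonincreasing, so g(u) is bounded. -/
theorem IsClassicalSolution.integrableOn_profile (hs : IsClassicalSolution k g u)
    (hg0 : ∀ t, 0 ≤ g t) (hg : Antitone g) (hgc : Continuous g) (hv : ContinuousOn v (Ioo 0 1))
    (huv : ∀ x ∈ puncturedBall n, u x = v ‖x‖) :
    IntegrableOn (fun r => r ^ (n - 1) * g (v r)) (Ioo 0 1) := by
  obtain ⟨M, hM⟩ := (isCompact_closedBall (0 : EuclideanSpace ℝ (Fin n)) 1).bddBelow_image hs.2.1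
  refine Integrable.of_bound (C := g M) ?_ ?_
  · exact ((continuous_pow _).continuousOn.mul (hgc.comp_continuousOn hv)).aestronglyMeasurable
      measurableSet_Ioo
  · filter_upwards [ae_restrict_mem measurableSet_Ioo] with r hr
    have hn : ‖r • axis n‖ = r := by rw [norm_smul_axis, abs_of_pos hr.1]
    have h1 := huv (r • axis n) (mem_puncturedBall.2 (by rwa [hn]))
    rw [hn] at h1
    have h2 : M ≤ v r := by
      rw [← h1]
      exact hM ⟨_, mem_closedBall_zero_iff.2 (by rw [hn]; exact hr.2.le), rfl⟩
    rw [Real.norm_of_nonneg (mul_nonneg (pow_nonneg hr.1.le _) (hg0 _))]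
    calc r ^ (n - 1) * g (v r) ≤ 1 * g M :=
          mul_le_mul (pow_le_one₀ hr.1.le hr.2.le) (hg h2) (hg0 _) zero_le_one
      _ = g M := one_mul _

theorem IsClassicalSolution.flux (hs : IsClassicalSolution k g u) (hk : 1 ≤ k) (hkn : k ≤ n)
    (hf : IntegrableOn (fun r => r ^ (n - 1) * g (v r)) (Ioo 0 1))
    (hv : ∀ r ∈ Ioo (0 : ℝ) 1, HasDerivAt v (p r) r)
    (huv : ∀ x ∈ puncturedBall n, u x = v ‖x‖) {r : ℝ} (hr : r ∈ Ioo (0 : ℝ) 1) :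
    (n - 1).choose (k - 1) / k * (r ^ (n - k) * p r ^ k) =
      ∫ s in (0 : ℝ)..r, s ^ (n - 1) * g (v s) := by
  have h0 : Tendsto (fun r : ℝ => ((n - 1).choose (k - 1) : ℝ) / k * (r ^ (n - k) * p r ^ k))
      (𝓝[>] 0) (𝓝 0) := by
    have h1 := (hs.tendsto_zero hv huv).pow k
    rw [zero_pow (by omega)] at h1
    have h2 : Tendsto (fun r : ℝ => r ^ (n - k)) (𝓝[>] 0) (𝓝 (0 ^ (n - k))) :=
      ((continuous_pow (n - k)).tendsto 0).mono_left nhdsWithin_le_nhds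
    simpa using (h2.mul h1).const_mul (((n - 1).choose (k - 1) : ℝ) / k)
  have h1 := intervalIntegral.integral_eq_sub_of_hasDerivAt_of_tendsto hr.1
    (fun s hs' => hs.hasDerivAt_flux hk hkn hv huv ⟨hs'.1, hs'.2.trans hr.2⟩)
    ((intervalIntegrable_iff_integrableOn_Ioo_of_le hr.1.le).2
      (hf.mono_set (Ioo_subset_Ioo_right hr.2.le))) h0
    ((hs.hasDerivAt_flux hk hkn hv huv hr).continuousAt.tendsto.mono_left nhdsWithin_le_nhds)
  rw [h1, sub_zero]

/-- The weak Hessian supplied by semistability gives the C¹ profile for both kinds of solution,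
which differ only in how the integrability of the source and the flux identity are obtained. The
constant c makes k c equal to C(n-1, k-1), the coefficient of the stability form. -/
theorem exists_semistableProfile (hk : 1 ≤ k) (hkn : k ≤ n) (hg0 : ∀ t, 0 ≤ g t)
    (hg : Antitone g) (hgl : LocallyLipschitz g) (hu : MemWeightedSobolev k u) (hr : IsRadial u)
    (hs : IsSolution k g u) (hst : IsSemistable k g u) :
    ∃ v p : ℝ → ℝ, SemistableProfile n k ((n - 1).choose (k - 1) / k) g v p ∧
      ∀ᵐ x ∂(volume.restrict (unitBall n)), u x = v ‖x‖ := by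
  obtain ⟨f, hf⟩ := hr
  rw [← restrict_puncturedBall] at hf ⊢
  obtain ⟨A, hA, -⟩ := id hst
  obtain ⟨v, p, q, hv, hp, huv⟩ := exists_isPrimitive_of_hasWeakHessian hf hA
  have hvd : ∀ r ∈ Ioo (0 : ℝ) 1, HasDerivAt v (p r) r := fun r hr =>
    hv.hasDerivAt (Filter.Eventually.of_forall fun _ => rfl) hp.continuousOn hr
  have hk0 : (k : ℝ) ≠ 0 := by exact_mod_cast (by omega : k ≠ 0)
  have hint : IntegrableOn (fun r => r ^ (n - 1) * g (v r)) (Ioo 0 1) := by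
    rcases hs with hs | hs
    · exact hs.integrableOn_profile hg0 hg hgl.continuous hv.continuousOn
        (hs.eqOn hv.continuousOn huv)
    · exact hs.integrableOn_profile huv
  refine ⟨v, p, ⟨hg0, hg, hgl, hvd, hp.continuousOn, hint, fun r hr => ?_, fun ψ h1 h2 h3 => ?_,
    hu.integrableOn_profile hk hkn hv huv⟩, huv⟩
  · rcases hs with hs | hs
    · exact hs.flux hk hkn hint hvd (hs.eqOn hv.continuousOn huv) hr
    · exact hs.flux hk hkn hv hp huv hr
  · rw [mul_div_cancel₀ _ hk0]
    exact hst.profile hk hv hp huv h1 h2 h3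

end Classical

end KHessian

end

theorem theorem1p9 (n k : ℕ) (hn : 2 ≤ n) (hk : 1 ≤ k) (hkn : k ≤ n) :
    ∃ D : ℝ, 0 < D ∧
      ∀ (g : ℝ → ℝ) (u : EuclideanSpace ℝ (Fin n) → ℝ),
        (∀ t, 0 ≤ g t) → Antitone g → LocallyLipschitz g →
        KHessian.MemWeightedSobolev k u → KHessian.IsRadial u →
        KHessian.IsSolution k g u → KHessian.IsSemistable k g u →
        ∃ (v : ℝ → ℝ) (m : ℝ),
          (∀ᵐ x ∂(volume.restrict (KHessian.unitBall n)), u x = v ‖x‖) ∧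
          ContDiffOn ℝ 1 v (Ioc 0 1) ∧
          IsLeast ((fun t => derivWithin v (Ioc 0 1) t) '' Icc (1 / 2) 1) m ∧
          (n < 2 * k + 8 → ∀ r ∈ Ioc (0 : ℝ) 1, |v r - v 1| ≤ D * m * (1 - r)) ∧
          (n = 2 * k + 8 → ∀ r ∈ Ioc (0 : ℝ) 1, |v r - v 1| ≤ D * m * |Real.log r|) ∧
          (2 * k + 8 < n → ∀ r ∈ Ioc (0 : ℝ) 1,
            |v r - v 1| ≤ D * m * (r ^ KHessian.delta n k - 1)) := by
  have : NeZero n := ⟨by omega⟩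
  obtain ⟨D, hD, h⟩ := KHessian.SemistableProfile.exists_estimate hk hkn
  refine ⟨D, hD, fun g u hg0 hg hgl hu hr hs hst => ?_⟩
  obtain ⟨v, p, hv, huv⟩ := KHessian.exists_semistableProfile hk hkn hg0 hg hgl hu hr hs hst
  have hc : (0 : ℝ) < (n - 1).choose (k - 1) / k := by
    have : 0 < (n - 1).choose (k - 1) := Nat.choose_pos (by omega)
    positivity
  obtain ⟨V, m, hVv, hV⟩ := h _ g v p hc hv
  refine ⟨V, m, ?_, hV⟩
  have h1 : ∀ᵐ x ∂(volume.restrict (KHessian.unitBall n)), v ‖x‖ = V ‖x‖ :=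
    (KHessian.ae_unitBall_norm_iff (S := fun r => v r = V r)).2
      ((ae_restrict_mem measurableSet_Ioo).mono fun r hr => (hVv r hr).symm)
  filter_upwards [huv, h1] with x h2 h3
  rw [h2, h3]
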